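/- **Setting.** Let $d\ge 2$, let $L$ be a power of $2$ and let $P\subseteq\{0,\dots,L\}^d$. For $\mathbf a\in\{1,\dots,L\}^d$ let $D(\mathbf a)$ be the dissection of the cube $\prod_{i=1}^d[-a_i+\tfrac12,\,2L-a_i+\tfrac12]$: starting from this cube, every cell of side length greater than $1$ is split into its $2^d$ congruent subcubes of half the side length. A *face* is a $(d-1)$-dimensional face of a cell of $D(\mathbf a)$; it lies in a unique hyperplane $\{x_j=\tfrac12+z\}$, $z\in\mathbb Z$. A face is *maximal* if it is not properly contained in another face. A *salesman path* for $P$ is a closed polygonal path in $\mathbb R^d$ that visits every point of $P$ (and may make digressions); $\mathrm{wt}$ denotes its length. A *crossing* of a hyperplane $h$ by a closed path is a maximal time interval (usually a single time) that the path spends in $h$ and before and after which it is strictly on opposite sides of $h$. The path crosses a face $F\subset h$ at the points of the relative interior of $F$ that it visits during its crossings of $h$, and the number of times it crosses $F$ is the number of crossings of $h$ during which it visits the relative interior of $F$. For $g=q^{d-1}$ with an integer $q\ge1$, $\mathrm{grid}(F,g)$ is the set of the centres of the $g$ congruent $(d-1)$-cubes into which $F$ can be divided (so its spacing is the side length of $F$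 divided by $g^{1/(d-1)}$). A closed path is *$r$-simple* with respect to $D(\mathbf a)$ if for every face $F$ of every cell of $D(\mathbf a)$ either (a) it crosses $F$ at no more than one point, or (b) for some integer $m\ge1$ and some $g=q^{d-1}\le r^{2d-2}/m$ it crosses $F$ at most $m$ times, and only at points of $\mathrm{grid}(F,g)$; and, moreover, for every face $F\subset h$ and every point $p$ of the relative interior of $F$, it crosses $h$ at most twice via $p$. **Theorem (Structure Theorem).** There are absolute constants $C>0$ and $r_0$ such that the following holds for all $d$, $L$, $P$ as above. Let $\pi$ be a salesman path for $P$ all of whose edges of positive length have length at least $1$, and let $r\ge r_0$ be an integer. Then for every shift $\mathbf a\in\{1,\dots,L\}^d$ there is a salesman path $\pi'=\pi'_{\mathbf a}$ for $P$ that is $r$-simple with respect to $D(\mathbf a)$, such that 1. for $\mathbf a$ uniformly random in $\{1,\dots,L\}^d$, $\mathbb E_{\mathbf a}[\mathrm{wt}(\pi'_{\mathbf a})-\mathrm{wt}(\pi)]\le C\,d^2\,\mathrm{wt}(\pi)/r$; and 2. for every $\mathbf a$, if $\pi$ crosses a maximal face $F$ of $D(\mathbf a)$ at exactly one point, then $\pi'_{\mathbf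 a}$ crosses $F$ at the same point and at no other point. -/

import Mathlib

open Set Filter Topology

noncomputable section

namespace StructThm

/-- Points of Euclidean `d`-space. -/
abbrev Pt (d : ℕ) : Type := EuclideanSpace ℝ (Fin d)

/-- A closed polygonal path: a cyclic sequence of `n ≥ 1` vertices, indexed periodically by `ℤ`. -/
structure ClosedPath (d : ℕ) where
  n : ℕ
  n_pos : 0 < n
  vertex : ℤ → Pt d
  periodic : ∀ k : ℤ, vertex (k + n) = vertex k

namespace ClosedPath

variable {d : ℕ}

/-- The position at time `t`: on `[k, k + 1]` the path runs along the `k`-th edge.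
One full turn takes time `n`. -/
def pos (γ : ClosedPath d) (t : ℝ) : Pt d :=
  AffineMap.lineMap (γ.vertex ⌊t⌋) (γ.vertex (⌊t⌋ + 1)) (Int.fract t)

/-- The total length. -/
def wt (γ : ClosedPath d) : ℝ :=
  ∑ k ∈ Finset.range γ.n, dist (γ.vertex k) (γ.vertex (k + 1))

/-- A salesman path for `P`: the closed path visits every point of `P`; digressions are allowed. -/
def Visits (γ : ClosedPath d) (P : Finset (Pt d)) : Prop :=
  ∀ p ∈ P, ∃ t : ℝ, γ.pos t = p

/-- No edge of positive length is shorter than the unit of the integer grid. -/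
def EdgesAtLeastOne (γ : ClosedPath d) : Prop :=
  ∀ k : ℤ, γ.vertex k ≠ γ.vertex (k + 1) → 1 ≤ dist (γ.vertex k) (γ.vertex (k + 1))

/-- The time interval `[s, t]` is a crossing of the hyperplane `{x | x j = c}`: during `[s, t]` the
path is in the hyperplane, and it is strictly on opposite sides just before `s` and just
after `t`. (If the path passes through the hyperplane without running along it, then `s = t`.)
The condition `0 ≤ s < n` makes each crossing of the periodic path count once. -/
def IsCrossing (γ : ClosedPath d) (j : Fin d) (c : ℝ) (s t : ℝ) : Prop :=
  0 ≤ s ∧ s < γ.n ∧ s ≤ t ∧ (∀ u ∈ Icc s t, γ.pos u j = c) ∧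
    (((∀ᶠ u in 𝓝[<] s, γ.pos u j < c) ∧ (∀ᶠ u in 𝓝[>] t, c < γ.pos u j)) ∨
      ((∀ᶠ u in 𝓝[<] s, c < γ.pos u j) ∧ (∀ᶠ u in 𝓝[>] t, γ.pos u j < c)))

end ClosedPath

/-- The axis-parallel cube `∏ i, [lo i, lo i + side]`. -/
structure Cube (d : ℕ) where
  lo : Fin d → ℝ
  side : ℝ

/-- The `(d-1)`-dimensional axis-parallel cube orthogonal to the direction `axis`. -/
structure Facet (d : ℕ) where
  axis : Fin d
  lo : Fin d → ℝ
  side : ℝ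

namespace Facet

variable {d : ℕ}

/-- The closed point set of a facet. -/
def carrier (F : Facet d) : Set (Pt d) :=
  {x | x F.axis = F.lo F.axis ∧ ∀ k, k ≠ F.axis → x k ∈ Icc (F.lo k) (F.lo k + F.side)}

/-- The relative interior of a facet. -/
def relInt (F : Facet d) : Set (Pt d) :=
  {x | x F.axis = F.lo F.axis ∧ ∀ k, k ≠ F.axis → x k ∈ Ioo (F.lo k) (F.lo k + F.side)}

/-- The regular set of `g = q ^ (d - 1)` portals on `F`: the orthogonal lattice of spacing
`side / q = side / g ^ (1 / (d - 1))` formed by the centres of the `q ^ (d - 1)` congruent cubes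
into which `F` is divided. -/
def grid (F : Facet d) (q : ℕ) : Set (Pt d) :=
  {x | x F.axis = F.lo F.axis ∧
    ∀ k, k ≠ F.axis → ∃ i : ℕ, i < q ∧ x k = F.lo k + ((i : ℝ) + 1 / 2) * (F.side / q)}

end Facet

/-- The facet of a cube orthogonal to direction `j`, on the lower (`false`) or upper (`true`)
side. -/
def Cube.facet {d : ℕ} (C : Cube d) (j : Fin d) (upper : Bool) : Facet d where
  axis := j
  lo := Function.update C.lo j (if upper then C.lo j + C.side else C.lo j)
  side := C.side

/-- The cells of the dissection `D(a)` of `∏ i, [-a i + 1/2, 2 L - a i + 1/2]`: start with this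
cube and halve all sides until unit cubes are reached. -/
inductive IsCell {d : ℕ} (L : ℕ) (a : Fin d → ℕ) : Cube d → Prop
  | root : IsCell L a ⟨fun i => -(a i : ℝ) + 1 / 2, 2 * (L : ℝ)⟩
  | child (C : Cube d) (upper : Fin d → Bool) (hC : IsCell L a C) (hside : 1 < C.side) :
      IsCell L a ⟨fun i => if upper i then C.lo i + C.side / 2 else C.lo i, C.side / 2⟩

/-- `F` is a facet of some cell of `D(a)`. -/
def IsCellFacet {d : ℕ} (L : ℕ) (a : Fin d → ℕ) (F : Facet d) : Prop :=
  ∃ (C : Cube d) (j : Fin d) (b : Bool), IsCell L a C ∧ F = C.facet j b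

/-- `F` is a facet of a cell that is not properly contained in another facet of a cell. -/
def IsMaximalFacet {d : ℕ} (L : ℕ) (a : Fin d → ℕ) (F : Facet d) : Prop :=
  IsCellFacet L a F ∧
    ∀ G : Facet d, IsCellFacet L a G → F.carrier ⊆ G.carrier → G.carrier = F.carrier

namespace ClosedPath

variable {d : ℕ}

/-- The crossings of the hyperplane of `F` that go through the relative interior of `F`. -/
def crossings (γ : ClosedPath d) (F : Facet d) : Set (ℝ × ℝ) :=
  {I | γ.IsCrossing F.axis (F.lo F.axis) I.1 I.2 ∧ ∃ u ∈ Icc I.1 I.2, γ.pos u ∈ F.relInt}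

/-- The points at which the path crosses `F`. -/
def crossingPoints (γ : ClosedPath d) (F : Facet d) : Set (Pt d) :=
  {x | x ∈ F.relInt ∧
    ∃ s t : ℝ, γ.IsCrossing F.axis (F.lo F.axis) s t ∧ ∃ u ∈ Icc s t, γ.pos u = x}

/-- The crossings of the hyperplane of `F` via the point `p`. -/
def crossingsVia (γ : ClosedPath d) (F : Facet d) (p : Pt d) : Set (ℝ × ℝ) :=
  {I | γ.IsCrossing F.axis (F.lo F.axis) I.1 I.2 ∧ ∃ u ∈ Icc I.1 I.2, γ.pos u = p}

/-- `r`-simplicity with respect to `D(a)`. For every facet `F` of every cell, either the path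
crosses `F` at no more than one point, or, for some `m` and some `g = q ^ (d - 1)` with
`g ≤ r ^ (2 d - 2) / m`, it crosses `F` at most `m` times and only at points of `grid(F, g)`.
Moreover, no point is used for more than two crossings. -/
def IsSimple (L : ℕ) (a : Fin d → ℕ) (r : ℕ) (γ : ClosedPath d) : Prop :=
  ∀ F : Facet d, IsCellFacet L a F →
    ((γ.crossingPoints F).Subsingleton ∨
      ∃ m q : ℕ, 0 < m ∧ 0 < q ∧ m * q ^ (d - 1) ≤ r ^ (2 * d - 2) ∧
        (γ.crossings F).encard ≤ m ∧ γ.crossingPoints F ⊆ F.grid q) ∧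
    ∀ p ∈ F.relInt, (γ.crossingsVia F p).encard ≤ 2

end ClosedPath

/-- The possible shifts `a ∈ {1, …, L} ^ d`. -/
def shifts (d L : ℕ) : Finset (Fin d → ℕ) :=
  Fintype.piFinset fun _ => Finset.Icc 1 L

/-- The expectation of `f a` for `a` uniform in `{1, …, L} ^ d`. -/
def expect (d L : ℕ) (f : (Fin d → ℕ) → ℝ) : ℝ :=
  (∑ a ∈ shifts d L, f a) / (shifts d L).card

end StructThm

end

/-!
The proof follows the patching technique for random dissections, with two changes that keep the
bound free of logarithms: crossings are moved along a forest adapted to the path, and the number of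
portals of a face depends on the number of crossing points that are left in it.

*From paths to walks.* The path is followed through the unit cells centred at the integer points
(`Discretization`). A crossing of a half-integer hyperplane is the same as a change of cell, and as
the edges have length at least one, there are at most `2 * d * γ.wt` changes
(`nonempty_discretization`). For a fixed shift this gives a closed walk made of links
(`Discretization.exists_closedWalk`), where each end of a link carries a side of the face on which
it lies, and a crossing is a joint of two links on different sides. Walks can be manipulated
combinatorially. Three crossings at one point are replaced by one, by reversing or exchanging two
pieces of the walk (`ClosedWalk.reduce`). The crossings at a point are moved to another point of the
same face by detours inside the face, and if this is done along a forest, from the leaves to the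
roots, then each edge is used at most four times (`ClosedWalk.patch`). Finally a walk is drawn again
as a path with exactly its crossings (`exists_path_of_closedWalk`): at each joint the path makes a
short spike in diagonal direction, so that it never crosses a face elsewhere by accident. It
suffices to treat the maximal faces, since all grids of portals are dyadic (`isSimple_of_maximal`).

*The forest.* Let `2 ^ ρ ≤ r < 2 ^ (ρ + 1)`. In each hyperplane the crossing points are ordered so
that interior points of faces precede boundary points (`key`), and `threshold` is the smallest scale
`σ` at which a point `x` has a predecessor in its dyadic cell of side `2 ^ σ`. In a face of side
`2 ^ e`, a point with `σ ≤ e - ρ` is joined to its predecessor at the cost `O(√d * 2 ^ σ)`. At most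
`2 ^ (ρ * (d - 1))` points are left. If only one point is left, it stays where it is, which gives
the statement on faces that are crossed once. If `c ≥ 2` points are left, they are moved to a grid
with `2 ^ (f * (d - 1))` points, where `f` is the largest number that `r`-simplicity allows up to
rounding, `2 * ρ - 1` minus the rounded logarithm of `c` to the base `2 ^ (d - 1)`. Most of the `c`
points have a small threshold, and so the cost can be distributed among them: a point with
`e - ρ < σ ≤ e` pays `O(√d * 2 ^ (2 * e - σ) / 4 ^ ρ)` (`card_mul_le_sum`, `exists_face_forest`).

*Expectation.* For hyperplanes orthogonal to the direction `j`, thresholds depend on the coordinates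
of the shift other than `a j` only, while the size `2 ^ e` of the faces depends on `a j` only, and a
given `e` has probability at most `2 / 2 ^ e` (`card_lev_eq_mul_le`). Hence the expected cost of a
crossing point is bounded by two geometric series in `e`, below and above `σ + ρ`, with the sum
`O(√d / 2 ^ ρ)` (`sum_moveCost_div_le`). Summation over the at most `2 * d * γ.wt` crossings gives
the bound (`sum_shifts_cost_le`).
-/

namespace StructThm

/-! ### Cells followed by a sequence of reals -/

/-- The step from `i` to `i + 1` of the sequence `g` stays in a single half-integer. -/
def Stuck (g : ℤ → ℝ) (i : ℤ) : Prop :=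
  ∃ z : ℤ, g i = z + 1 / 2 ∧ g (i + 1) = z + 1 / 2

lemma Stuck.eq {g : ℤ → ℝ} {i : ℤ} (h : Stuck g i) : g (i + 1) = g i := by
  obtain ⟨z, h1, h2⟩ := h
  rw [h1, h2]

/-- By periodicity, a non-stuck step can be found at or before every index, unless all steps are
stuck. -/
lemma exists_last_not_stuck {g : ℤ → ℝ} {K : ℕ} (hK : 0 < K) (hper : ∀ i, g (i + K) = g i)
    (hne : ∃ i, ¬ Stuck g i) (i : ℤ) :
    ∃ l ≤ i, ¬ Stuck g l ∧ ∀ m, l < m → m ≤ i → Stuck g m := by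
  obtain ⟨i₀, h₀⟩ := hne
  have hst : ∀ i, Stuck g (i + K) ↔ Stuck g i := by
    intro i
    have : i + (K : ℤ) + 1 = i + 1 + K := by ring
    simp only [Stuck, this, hper]
  have hst' : ∀ (m : ℕ) (i : ℤ), Stuck g (i - m * K) ↔ Stuck g i := by
    intro m
    induction m with
    | zero => intro i; simp
    | succ m ih =>
      intro i
      rw [← ih i, ← hst (i - (m + 1 : ℕ) * K)]
      have : i - ((m + 1 : ℕ) : ℤ) * K + K = i - m * K := by push_cast; ring
      rw [this]
  obtain ⟨l, ⟨h1, h2⟩, h3⟩ := Int.exists_greatest_of_bdd (P := fun l => l ≤ i ∧ ¬ Stuck g l)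
    ⟨i, fun z hz => hz.1⟩ ⟨i₀ - ((i₀ - i).toNat : ℕ) * K, by
      constructor
      · have h4 : i₀ - i ≤ ((i₀ - i).toNat : ℤ) := Int.self_le_toNat _
        have h5 : ((i₀ - i).toNat : ℤ) * 1 ≤ ((i₀ - i).toNat : ℤ) * K := by
          apply mul_le_mul_of_nonneg_left _ (by positivity)
          exact_mod_cast hK
        linarith
      · rwa [hst']⟩
  refine ⟨l, h1, h2, fun m hm hmi => ?_⟩
  by_contra hc
  exact absurd (h3 m ⟨hmi, hc⟩) (by omega)

lemma eq_of_stuck {g : ℤ → ℝ} {l i : ℤ} (hli : l ≤ i) (h : ∀ m, l ≤ m → m < i → Stuck g m) :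
    g i = g l := by
  induction i, hli using Int.leInduction with
  | base => rfl
  | succ i hi ih =>
    rw [(h i hi (by omega)).eq]
    exact ih fun m h1 h2 => h m h1 (by omega)

/-- A periodic sequence that never jumps over a half-integer has a sequence of unit intervals
`[κ - 1/2, κ + 1/2]` containing its consecutive steps, where the interval is kept for as long as
the sequence is stuck in a half-integer. -/
lemma exists_cellIndex {g : ℤ → ℝ} {K : ℕ} (hK : 0 < K) (hper : ∀ i, g (i + K) = g i)
    (hok : ∀ i, ∀ z : ℤ, ¬ (min (g i) (g (i + 1)) < z + 1 / 2 ∧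
      (z : ℝ) + 1 / 2 < max (g i) (g (i + 1)))) :
    ∃ κ : ℤ → ℤ, (∀ i, κ (i + K) = κ i) ∧ (∀ i, |g i - κ i| ≤ 1 / 2) ∧
      (∀ i, |g (i + 1) - κ i| ≤ 1 / 2) ∧ (∀ i, Stuck g i → κ i = κ (i - 1)) := by
  have hst : ∀ i, Stuck g (i + K) ↔ Stuck g i := by
    intro i
    have : i + (K : ℤ) + 1 = i + 1 + K := by ring
    simp only [Stuck, this, hper]
  by_cases hne : ∃ i, ¬ Stuck g i
  · choose l hl1 hl2 hl3 using exists_last_not_stuck hK hper hne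
    have huniq : ∀ i l', l' ≤ i → ¬ Stuck g l' → (∀ m, l' < m → m ≤ i → Stuck g m) →
        l i = l' := by
      intro i l' h1 h2 h3
      rcases lt_trichotomy (l i) l' with h | h | h
      · exact absurd (hl3 i l' h h1) h2
      · exact h
      · exact absurd (h3 _ h (hl1 i)) (hl2 i)
    -- a step that is not stuck has its midpoint off the half-integers, which determines its cell
    set κ₀ : ℤ → ℤ := fun i => ⌊(g i + g (i + 1)) / 2 + 1 / 2⌋ with hκ₀
    have hclose : ∀ i, ¬ Stuck g i → |g i - κ₀ i| ≤ 1 / 2 ∧ |g (i + 1) - κ₀ i| ≤ 1 / 2 := by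
      intro i hi
      have h1 : (κ₀ i : ℝ) ≤ (g i + g (i + 1)) / 2 + 1 / 2 := Int.floor_le _
      have h2 : (g i + g (i + 1)) / 2 + 1 / 2 < κ₀ i + 1 := Int.lt_floor_add_one _
      have h3 := hok i (κ₀ i)
      have h4 := hok i (κ₀ i - 1)
      push_cast at h4
      have h5 : ¬ (g i = (κ₀ i - 1 : ℤ) + 1 / 2 ∧ g (i + 1) = (κ₀ i - 1 : ℤ) + 1 / 2) :=
        fun h => hi ⟨_, h⟩
      push_cast at h5
      rcases le_total (g i) (g (i + 1)) with h | h
      · rw [min_eq_left h, max_eq_right h] at h3 h4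
        constructor <;> rw [abs_le] <;> constructor <;> by_contra hcon <;> push Not at hcon
        all_goals first
          | (apply h3; constructor <;> linarith)
          | (apply h4; constructor <;> linarith)
      · rw [min_eq_right h, max_eq_left h] at h3 h4
        constructor <;> rw [abs_le] <;> constructor <;> by_contra hcon <;> push Not at hcon
        all_goals first
          | (apply h3; constructor <;> linarith)
          | (apply h4; constructor <;> linarith)
    refine ⟨fun i => κ₀ (l i), fun i => ?_, fun i => ?_, fun i => ?_, fun i hi => ?_⟩
    · have : l (i + K) = l i + K := by
        apply huniq
        · have := hl1 i; omega
        · rw [hst]; exact hl2 i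
        · intro m h1 h2
          rw [← sub_add_cancel m (K : ℤ), hst]
          exact hl3 i _ (by omega) (by omega)
      have h2 : l i + (K : ℤ) + 1 = l i + 1 + K := by ring
      simp only [this, hκ₀, h2, hper]
    · change |g i - κ₀ (l i)| ≤ 1 / 2
      rcases (hl1 i).eq_or_lt with h | h
      · have := (hclose _ (hl2 i)).1
        rwa [h] at this ⊢
      · rw [eq_of_stuck (l := l i + 1) (i := i) (by omega)
          fun m h1 h2 => hl3 i m (by omega) (by omega)]
        exact (hclose _ (hl2 i)).2
    · rw [eq_of_stuck (l := l i + 1) (i := i + 1) (by have := hl1 i; omega)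
          fun m h1 h2 => hl3 i m (by omega) (by omega)]
      exact (hclose _ (hl2 i)).2
    · have : l (i - 1) = l i := by
        apply huniq
        · rcases (hl1 i).eq_or_lt with h | h
          · rw [← h] at hi; exact absurd hi (hl2 i)
          · omega
        · exact hl2 i
        · intro m h1 h2
          exact hl3 i _ (by omega) (by omega)
      simp only [this]
  -- if all steps are stuck, then `g` is constant
  · push Not at hne
    have hc : ∀ i, g (i + 1) = g i := fun i => (hne i).eq
    have hfl : ∀ i, |g i - ⌊g i⌋| ≤ 1 / 2 := by
      intro i
      obtain ⟨z, h1, -⟩ := hne i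
      have : ⌊g i⌋ = z := by
        rw [Int.floor_eq_iff, h1]; constructor <;> linarith
      rw [this, h1]
      norm_num
    refine ⟨fun i => ⌊g i⌋, fun i => by simp only [hper], hfl, fun i => ?_, fun i _ => ?_⟩
    · rw [hc]; exact hfl i
    · have := hc (i - 1)
      rw [sub_add_cancel] at this
      simp only [this]

/-! ### Crossings of a level by a piecewise affine function -/

/-- If `f` equals `c` on `[α, β]` and differs from `c` just before and just after, then `[α, β]` is
the only such interval through any of its points. -/
lemma level_interval_unique {f : ℝ → ℝ} {c s t α β u : ℝ} (hst : ∀ v ∈ Icc s t, f v = c)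
    (hs : ∀ᶠ v in 𝓝[<] s, f v ≠ c) (ht : ∀ᶠ v in 𝓝[>] t, f v ≠ c)
    (hαβ : ∀ v ∈ Icc α β, f v = c) (hα : ∀ᶠ v in 𝓝[<] α, f v ≠ c) (hβ : ∀ᶠ v in 𝓝[>] β, f v ≠ c)
    (hu : u ∈ Icc s t) (hu' : u ∈ Icc α β) : s = α ∧ t = β := by
  have key1 : ∀ {s t α β : ℝ}, (∀ v ∈ Icc s t, f v = c) → (∀ᶠ v in 𝓝[<] α, f v ≠ c) →
      u ∈ Icc s t → u ∈ Icc α β → α ≤ s := by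
    intro s t α β h1 h2 h3 h4
    by_contra! hlt
    obtain ⟨v, hv1, hv2⟩ := (h2.and (Ioo_mem_nhdsLT hlt)).exists
    exact hv1 (h1 v ⟨hv2.1.le, hv2.2.le.trans (h4.1.trans h3.2)⟩)
  have key2 : ∀ {s t α β : ℝ}, (∀ v ∈ Icc s t, f v = c) → (∀ᶠ v in 𝓝[>] β, f v ≠ c) →
      u ∈ Icc s t → u ∈ Icc α β → t ≤ β := by
    intro s t α β h1 h2 h3 h4
    by_contra! hlt
    obtain ⟨v, hv1, hv2⟩ := (h2.and (Ioo_mem_nhdsGT hlt)).exists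
    exact hv1 (h1 v ⟨(h3.1.trans h4.2).trans hv2.1.le, hv2.2.le⟩)
  exact ⟨le_antisymm (key1 hαβ hs hu' hu) (key1 hst hα hu hu'),
    le_antisymm (key2 hst hβ hu hu') (key2 hαβ ht hu' hu)⟩

/-- `f` is affine between consecutive breakpoints of `T`. The coefficient `μ` need not be the relative
position of `u`; it only has to be positive and less than `1` strictly between the breakpoints. -/
def AffineBetween (T : ℤ → ℝ) (f : ℝ → ℝ) : Prop :=
  ∀ i, ∀ u ∈ Icc (T i) (T (i + 1)), ∃ μ ∈ Icc (0 : ℝ) 1, (T i < u → 0 < μ) ∧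
    (u < T (i + 1) → μ < 1) ∧ f u = (1 - μ) * f (T i) + μ * f (T (i + 1))

section

variable {T : ℤ → ℝ} {f : ℝ → ℝ} {κ : ℤ → ℤ}

lemma AffineBetween.eq_of_stuck (hf : AffineBetween T f) {i : ℤ} (h : Stuck (fun i => f (T i)) i)
    {u : ℝ} (hu : u ∈ Icc (T i) (T (i + 1))) : f u = f (T i) := by
  obtain ⟨μ, -, -, -, h1⟩ := hf i u hu
  have h2 : f (T (i + 1)) = f (T i) := h.eq
  rw [h1, h2]
  ring

lemma AffineBetween.mem_cell (hf : AffineBetween T f) {i : ℤ}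
    (h : ¬ Stuck (fun i => f (T i)) i) (h1 : |f (T i) - κ i| ≤ 1 / 2)
    (h2 : |f (T (i + 1)) - κ i| ≤ 1 / 2) {u : ℝ} (hu : u ∈ Ioo (T i) (T (i + 1))) :
    |f u - κ i| < 1 / 2 := by
  obtain ⟨μ, -, hμ0, hμ1, hfu⟩ := hf i u ⟨hu.1.le, hu.2.le⟩
  have h0 := hμ0 hu.1
  have h01 := hμ1 hu.2
  rw [abs_le] at h1 h2
  rw [abs_lt]
  constructor
  · by_contra! hc
    apply h
    refine ⟨κ i - 1, ?_, ?_⟩ <;> push_cast <;> nlinarith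
  · by_contra! hc
    apply h
    refine ⟨κ i, ?_, ?_⟩ <;> nlinarith

/-- Just after leaving a half-integer at time `T i`, the function is in the interior of its cell. -/
lemma AffineBetween.eventually_right (hT : StrictMono T) (hf : AffineBetween T f) {i z : ℤ}
    (hz : f (T i) = z + 1 / 2) (h : ¬ Stuck (fun i => f (T i)) i) (h1 : |f (T i) - κ i| ≤ 1 / 2)
    (h2 : |f (T (i + 1)) - κ i| ≤ 1 / 2) :
    ((κ i : ℝ) < f (T i) ∧ ∀ᶠ u in 𝓝[>] (T i), f u < f (T i)) ∨
      (f (T i) < κ i ∧ ∀ᶠ u in 𝓝[>] (T i), f (T i) < f u) := by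
  have hev : ∀ᶠ u in 𝓝[>] (T i), |f u - κ i| < 1 / 2 := by
    filter_upwards [Ioo_mem_nhdsGT (hT (show i < i + 1 by omega))] with u hu
    exact hf.mem_cell h h1 h2 hu
  have h3 : κ i = z ∨ κ i = z + 1 := by
    rw [hz, abs_le] at h1
    have h4 : (κ i : ℝ) ≤ z + 1 := by linarith
    have h5 : (z : ℝ) ≤ κ i := by linarith
    have h4 : κ i ≤ z + 1 := by exact_mod_cast h4
    have h5 : z ≤ κ i := by exact_mod_cast h5
    omega
  rcases h3 with h3 | h3
  · left
    rw [hz]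
    rw [h3] at hev ⊢
    refine ⟨by linarith, hev.mono fun u hu => ?_⟩
    rw [abs_lt] at hu
    linarith
  · right
    rw [hz]
    rw [h3] at hev ⊢
    push_cast at hev ⊢
    refine ⟨by linarith, hev.mono fun u hu => ?_⟩
    rw [abs_lt] at hu
    linarith

/-- Before time `T i` the function runs along its half-integer value `f (T i)` for some
(possibly trivial) time `[α, T i]`, having arrived there from the cell followed at step `i - 1`. -/
lemma AffineBetween.exists_run_left (hT : StrictMono T) (hf : AffineBetween T f) {K : ℕ}
    (hK : 0 < K) (hper : ∀ i, f (T (i + K)) = f (T i))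
    (h1 : ∀ i, |f (T i) - κ i| ≤ 1 / 2) (h2 : ∀ i, |f (T (i + 1)) - κ i| ≤ 1 / 2)
    (h3 : ∀ i, Stuck (fun i => f (T i)) i → κ i = κ (i - 1))
    (hne : ∃ i, ¬ Stuck (fun i => f (T i)) i) {i z : ℤ} (hz : f (T i) = z + 1 / 2) :
    ∃ α ≤ T i, (∀ u ∈ Icc α (T i), f u = f (T i)) ∧
      (((κ (i - 1) : ℝ) < f (T i) ∧ ∀ᶠ u in 𝓝[<] α, f u < f (T i)) ∨
      (f (T i) < κ (i - 1) ∧ ∀ᶠ u in 𝓝[<] α, f (T i) < f u)) := by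
  obtain ⟨l, hli, hl, hls⟩ := exists_last_not_stuck (g := fun i => f (T i)) hK hper hne (i - 1)
  have hκ : ∀ m, l ≤ m → m ≤ i - 1 → κ m = κ l := by
    intro m hm
    induction m, hm using Int.leInduction with
    | base => intro _; rfl
    | succ m hm ih =>
      intro hmi
      rw [h3 (m + 1) (hls _ (by omega) hmi)]
      simpa using ih (by omega)
  have hrun : ∀ m, l + 1 ≤ m → m ≤ i → ∀ u ∈ Icc (T (l + 1)) (T m), f u = f (T (l + 1)) := by
    intro m hm
    induction m, hm using Int.leInduction with
    | base => intro _ u hu; rw [le_antisymm hu.2 hu.1]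
    | succ m hm ih =>
      intro hmi u hu
      rcases le_total u (T m) with h | h
      · exact ih (by omega) u ⟨hu.1, h⟩
      · rw [hf.eq_of_stuck (hls m (by omega) (by omega)) ⟨h, hu.2⟩]
        exact ih (by omega) _ ⟨hT.monotone hm, le_rfl⟩
  have hli' : T (l + 1) ≤ T i := hT.monotone (by omega)
  have heq : f (T (l + 1)) = f (T i) := (hrun i (by omega) le_rfl _ ⟨hli', le_rfl⟩).symm
  refine ⟨T (l + 1), hli', fun u hu => ?_, ?_⟩
  · rw [hrun i (by omega) le_rfl u hu, heq]
  have hev : ∀ᶠ u in 𝓝[<] (T (l + 1)), |f u - κ l| < 1 / 2 := by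
    filter_upwards [Ioo_mem_nhdsLT (hT (show l < l + 1 by omega))] with u hu
    exact hf.mem_cell hl (h1 l) (h2 l) hu
  rw [hκ (i - 1) hli le_rfl]
  have h4 := h2 l
  rw [heq, hz] at h4
  rw [hz]
  have h5 : κ l = z ∨ κ l = z + 1 := by
    rw [abs_le] at h4
    have h4' : (κ l : ℝ) ≤ z + 1 := by linarith
    have h5' : (z : ℝ) ≤ κ l := by linarith
    have h4 : κ l ≤ z + 1 := by exact_mod_cast h4'
    have h5 : z ≤ κ l := by exact_mod_cast h5'
    omega
  rcases h5 with h5 | h5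
  · left
    rw [h5] at hev ⊢
    refine ⟨by linarith, hev.mono fun u hu => ?_⟩
    rw [abs_lt] at hu
    linarith
  · right
    rw [h5] at hev ⊢
    push_cast at hev ⊢
    refine ⟨by linarith, hev.mono fun u hu => ?_⟩
    rw [abs_lt] at hu
    linarith

/-- A change of cell is the end of a crossing. -/
lemma AffineBetween.exists_crossing (hT : StrictMono T) (hf : AffineBetween T f) {K : ℕ}
    (hK : 0 < K) (hper : ∀ i, f (T (i + K)) = f (T i))
    (h1 : ∀ i, |f (T i) - κ i| ≤ 1 / 2) (h2 : ∀ i, |f (T (i + 1)) - κ i| ≤ 1 / 2)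
    (h3 : ∀ i, Stuck (fun i => f (T i)) i → κ i = κ (i - 1)) {i : ℤ} (hi : κ (i - 1) ≠ κ i) :
    ∃ s ≤ T i, (∀ u ∈ Icc s (T i), f u = f (T i)) ∧
      (((∀ᶠ u in 𝓝[<] s, f u < f (T i)) ∧ (∀ᶠ u in 𝓝[>] (T i), f (T i) < f u)) ∨
      ((∀ᶠ u in 𝓝[<] s, f (T i) < f u) ∧ (∀ᶠ u in 𝓝[>] (T i), f u < f (T i)))) := by
  have hns : ¬ Stuck (fun i => f (T i)) i := fun h => hi (h3 i h).symm
  have h4 := h2 (i - 1)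
  rw [sub_add_cancel] at h4
  have h5 := h1 i
  rw [abs_le] at h4 h5
  have h6 : κ i ≤ κ (i - 1) + 1 := by
    have : (κ i : ℝ) ≤ κ (i - 1) + 1 := by linarith
    exact_mod_cast this
  have h7 : κ (i - 1) ≤ κ i + 1 := by
    have : (κ (i - 1) : ℝ) ≤ κ i + 1 := by linarith
    exact_mod_cast this
  have hcase : κ i = κ (i - 1) + 1 ∨ κ (i - 1) = κ i + 1 := by omega
  have hz : ∃ z : ℤ, f (T i) = z + 1 / 2 ∧ (κ i = κ (i - 1) + 1 ∧ κ (i - 1) = z ∨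
      κ (i - 1) = κ i + 1 ∧ κ i = z) := by
    rcases hcase with h | h
    · refine ⟨κ (i - 1), ?_, by omega⟩
      rw [h] at h5; push_cast at h5; linarith
    · refine ⟨κ i, ?_, by omega⟩
      rw [h] at h4; push_cast at h4; linarith
  obtain ⟨z, hz, hz'⟩ := hz
  obtain ⟨α, hα, hrun, hl⟩ := hf.exists_run_left hT hK hper h1 h2 h3 ⟨i, hns⟩ hz
  have hr := hf.eventually_right hT hz hns (h1 i) (h2 i)
  refine ⟨α, hα, hrun, ?_⟩
  rw [hz] at hl hr ⊢
  rcases hz' with ⟨h, h'⟩ | ⟨h, h'⟩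
  · left
    rw [h, h'] at hr
    rw [h'] at hl
    push_cast at hr
    exact ⟨(hl.resolve_right (by rintro ⟨h, -⟩; linarith)).2,
      (hr.resolve_left (by rintro ⟨h, -⟩; linarith)).2⟩
  · right
    rw [h, h'] at hl
    rw [h'] at hr
    push_cast at hl
    exact ⟨(hl.resolve_left (by rintro ⟨h, -⟩; linarith)).2,
      (hr.resolve_right (by rintro ⟨h, -⟩; linarith)).2⟩

/-- A crossing of a half-integer level ends with a change of cell. -/
lemma AffineBetween.exists_cell_change (hT : StrictMono T) (hf : AffineBetween T f) {K : ℕ}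
    (hK : 0 < K) (hper : ∀ i, f (T (i + K)) = f (T i))
    (h1 : ∀ i, |f (T i) - κ i| ≤ 1 / 2) (h2 : ∀ i, |f (T (i + 1)) - κ i| ≤ 1 / 2)
    (h3 : ∀ i, Stuck (fun i => f (T i)) i → κ i = κ (i - 1))
    (hcov : ∀ t, ∃ i, T i ≤ t ∧ t < T (i + 1)) {s t : ℝ} {z : ℤ} (hst : s ≤ t)
    (heq : ∀ u ∈ Icc s t, f u = z + 1 / 2)
    (hcr : ((∀ᶠ u in 𝓝[<] s, f u < z + 1 / 2) ∧ (∀ᶠ u in 𝓝[>] t, (z : ℝ) + 1 / 2 < f u)) ∨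
      ((∀ᶠ u in 𝓝[<] s, (z : ℝ) + 1 / 2 < f u) ∧ (∀ᶠ u in 𝓝[>] t, f u < z + 1 / 2))) :
    ∃ i, T i = t ∧ κ (i - 1) ≠ κ i := by
  obtain ⟨i, hi1, hi2⟩ := hcov t
  have hft : f t = z + 1 / 2 := heq t ⟨hst, le_rfl⟩
  have hsne : ∀ᶠ u in 𝓝[<] s, f u ≠ z + 1 / 2 := by
    rcases hcr with h | h
    · exact h.1.mono fun u hu => hu.ne
    · exact h.1.mono fun u hu => hu.ne'
  have htne : ∀ᶠ u in 𝓝[>] t, f u ≠ z + 1 / 2 := by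
    rcases hcr with h | h
    · exact h.2.mono fun u hu => hu.ne'
    · exact h.2.mono fun u hu => hu.ne
  have hns : ¬ Stuck (fun i => f (T i)) i := by
    intro h
    obtain ⟨v, hv1, hv2⟩ := (htne.and (Ioo_mem_nhdsGT hi2)).exists
    apply hv1
    rw [hf.eq_of_stuck h ⟨hi1.trans hv2.1.le, hv2.2.le⟩, ← hft,
      hf.eq_of_stuck h ⟨hi1, hi2.le⟩]
  have hti : T i = t := by
    rcases hi1.eq_or_lt with h | h
    · exact h
    · have := hf.mem_cell hns (h1 i) (h2 i) ⟨h, hi2⟩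
      rw [hft, abs_lt] at this
      have h4 : (z : ℝ) < κ i := by linarith
      have h5 : (κ i : ℝ) < z + 1 := by linarith
      have h4 : z < κ i := by exact_mod_cast h4
      have h5 : κ i < z + 1 := by exact_mod_cast h5
      omega
  refine ⟨i, hti, fun hκ => ?_⟩
  subst hti
  obtain ⟨α, hα, hrun, hl⟩ := hf.exists_run_left hT hK hper h1 h2 h3 ⟨i, hns⟩ hft
  have hr := hf.eventually_right hT hft hns (h1 i) (h2 i)
  rw [hκ] at hl
  rw [hft] at *
  have hαne : ∀ᶠ u in 𝓝[<] α, f u ≠ z + 1 / 2 := by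
    rcases hl with h | h
    · exact h.2.mono fun u hu => hu.ne
    · exact h.2.mono fun u hu => hu.ne'
  obtain ⟨rfl, -⟩ := level_interval_unique heq hsne htne hrun hαne htne
    ⟨hst, le_rfl⟩ ⟨hα, le_rfl⟩
  rcases hl with ⟨hl1, hl2⟩ | ⟨hl1, hl2⟩ <;> rcases hr with ⟨hr1, hr2⟩ | ⟨hr1, hr2⟩ <;>
    rcases hcr with ⟨hc1, hc2⟩ | ⟨hc1, hc2⟩
  all_goals first
    | (exfalso; linarith)
    | (obtain ⟨v, hv⟩ := (hl2.and hc1).exists; linarith [hv.1, hv.2])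
    | (obtain ⟨v, hv⟩ := (hr2.and hc2).exists; linarith [hv.1, hv.2])

end

/-! ### The position function of a closed path -/

namespace ClosedPath

variable {d : ℕ}

lemma pos_intCast_add (γ : ClosedPath d) (k : ℤ) {l : ℝ} (hl : l ∈ Icc (0 : ℝ) 1) :
    γ.pos (k + l) = AffineMap.lineMap (γ.vertex k) (γ.vertex (k + 1)) l := by
  rcases hl.2.eq_or_lt with h | h
  · subst h
    have h1 : ⌊(k : ℝ) + 1⌋ = k + 1 := by
      rw [Int.floor_eq_iff]; push_cast; constructor <;> linarith
    have h2 : Int.fract ((k : ℝ) + 1) = 0 := by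
      rw [Int.fract, h1]; push_cast; ring
    simp [pos, h1, h2]
  · have h1 : ⌊(k : ℝ) + l⌋ = k := by
      rw [Int.floor_eq_iff]; constructor <;> linarith [hl.1]
    have h2 : Int.fract ((k : ℝ) + l) = l := by
      rw [Int.fract, h1]; ring
    rw [pos, h1, h2]

lemma pos_intCast_add_apply (γ : ClosedPath d) (k : ℤ) {l : ℝ} (hl : l ∈ Icc (0 : ℝ) 1)
    (j : Fin d) :
    γ.pos (k + l) j = (1 - l) * γ.vertex k j + l * γ.vertex (k + 1) j := by
  rw [γ.pos_intCast_add k hl, AffineMap.lineMap_apply_module]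
  simp

lemma vertex_add_mul (γ : ClosedPath d) (k q : ℤ) : γ.vertex (k + q * γ.n) = γ.vertex k := by
  induction q using Int.induction_on generalizing k with
  | zero => simp
  | succ q ih =>
    rw [← ih k, ← γ.periodic (k + q * γ.n)]
    congr 1; ring
  | pred q ih =>
    rw [← ih k, ← γ.periodic (k + (-q - 1) * γ.n)]
    congr 1; ring

lemma pos_add_mul (γ : ClosedPath d) (t : ℝ) (q : ℤ) : γ.pos (t + q * γ.n) = γ.pos t := by
  have h : t + q * γ.n = t + ((q * γ.n : ℤ) : ℝ) := by push_cast; ring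
  rw [h, pos, pos, Int.floor_add_intCast, Int.fract_add_intCast, vertex_add_mul]
  have : ⌊t⌋ + q * (γ.n : ℤ) + 1 = ⌊t⌋ + 1 + q * γ.n := by ring
  rw [this, vertex_add_mul]

end ClosedPath

lemma eventually_nhdsLT_shift {p : ℝ → Prop} {s a : ℝ} (h : ∀ᶠ u in 𝓝[<] (s + a), p u) :
    ∀ᶠ u in 𝓝[<] s, p (u + a) := by
  have : Tendsto (fun u => u + a) (𝓝[<] s) (𝓝[<] (s + a)) := by
    apply tendsto_nhdsWithin_of_tendsto_nhds_of_eventually_within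
    · exact ((continuous_id.add continuous_const).tendsto s).mono_left nhdsWithin_le_nhds
    · filter_upwards [self_mem_nhdsWithin] with u hu
      exact add_lt_add_left hu a
  exact this.eventually h

lemma eventually_nhdsGT_shift {p : ℝ → Prop} {s a : ℝ} (h : ∀ᶠ u in 𝓝[>] (s + a), p u) :
    ∀ᶠ u in 𝓝[>] s, p (u + a) := by
  have : Tendsto (fun u => u + a) (𝓝[>] s) (𝓝[>] (s + a)) := by
    apply tendsto_nhdsWithin_of_tendsto_nhds_of_eventually_within
    · exact ((continuous_id.add continuous_const).tendsto s).mono_left nhdsWithin_le_nhds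
    · filter_upwards [self_mem_nhdsWithin] with u hu
      exact add_lt_add_left hu a
  exact this.eventually h

/-- A crossing at arbitrary times can be moved into the period `[0, n)`. -/
lemma ClosedPath.exists_isCrossing {d : ℕ} (γ : ClosedPath d) {j : Fin d} {c s t : ℝ} (hst : s ≤ t)
    (hc : ∀ u ∈ Icc s t, γ.pos u j = c)
    (h : ((∀ᶠ u in 𝓝[<] s, γ.pos u j < c) ∧ (∀ᶠ u in 𝓝[>] t, c < γ.pos u j)) ∨
      ((∀ᶠ u in 𝓝[<] s, c < γ.pos u j) ∧ (∀ᶠ u in 𝓝[>] t, γ.pos u j < c))) :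
    ∃ s' t', γ.IsCrossing j c s' t' ∧ γ.pos t' = γ.pos t := by
  have hn : (0 : ℝ) < γ.n := by exact_mod_cast γ.n_pos
  set q : ℤ := ⌊s / γ.n⌋ with hq
  set a : ℝ := q * γ.n with ha
  have hper : ∀ u, γ.pos (u + a) = γ.pos u := fun u => γ.pos_add_mul u q
  have h1 : a ≤ s := by
    have := Int.floor_le (s / γ.n)
    rwa [le_div_iff₀ hn] at this
  have h2 : s < a + γ.n := by
    have := Int.lt_floor_add_one (s / γ.n)
    rw [div_lt_iff₀ hn] at this
    rw [ha, hq]; linarith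
  refine ⟨s - a, t - a, ⟨by linarith, by linarith, by linarith, fun u hu => ?_, ?_⟩, ?_⟩
  · rw [← hper]
    exact hc _ ⟨by linarith [hu.1], by linarith [hu.2]⟩
  · have e1 : s - a + a = s := by ring
    have e2 : t - a + a = t := by ring
    rcases h with ⟨h, h'⟩ | ⟨h, h'⟩
    · left
      rw [← e1] at h
      rw [← e2] at h'
      have k1 := eventually_nhdsLT_shift h
      have k2 := eventually_nhdsGT_shift h'
      simp only [hper] at k1 k2
      exact ⟨k1, k2⟩
    · right
      rw [← e1] at h
      rw [← e2] at h'
      have k1 := eventually_nhdsLT_shift h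
      have k2 := eventually_nhdsGT_shift h'
      simp only [hper] at k1 k2
      exact ⟨k1, k2⟩
  · rw [← hper]; congr 1; ring

/-! ### Breakpoints -/

/-- A finite set of times in `(0, 1)` is contained in a finite partition of `[0, 1]`. -/
lemma exists_breakpoints (A : Set ℝ) (hA : A.Finite) :
    ∃ (c : ℕ) (s : ℕ → ℝ), 0 < c ∧ s 0 = 0 ∧ s c = 1 ∧ (∀ e < c, s e < s (e + 1)) ∧
      ∀ a ∈ A, 0 < a → a < 1 → ∃ e < c, s e = a := by
  classical
  set B : Finset ℝ := insert 0 (insert 1 (hA.toFinset.filter fun a => 0 < a ∧ a < 1)) with hB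
  have hmem : ∀ b ∈ B, 0 ≤ b ∧ b ≤ 1 := by
    intro b hb
    simp only [hB, Finset.mem_insert, Finset.mem_filter, Set.Finite.mem_toFinset] at hb
    rcases hb with h | h | h
    · rw [h]; norm_num
    · rw [h]; norm_num
    · exact ⟨h.2.1.le, h.2.2.le⟩
  have h0 : (0 : ℝ) ∈ B := by simp [hB]
  have h1 : (1 : ℝ) ∈ B := by simp [hB]
  have hcard : 1 < B.card := Finset.one_lt_card.2 ⟨0, h0, 1, h1, by norm_num⟩
  obtain ⟨c, hc⟩ : ∃ c, B.card = c + 1 := ⟨B.card - 1, by omega⟩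
  set o := B.orderEmbOfFin hc with ho
  have hne : B.Nonempty := ⟨0, h0⟩
  refine ⟨c, fun e => if h : e < c + 1 then o ⟨e, h⟩ else 0, by omega, ?_, ?_, ?_, ?_⟩
  · have := Finset.orderEmbOfFin_zero hc (by omega)
    simp only [Nat.zero_lt_succ, dite_true]
    rw [ho, this]
    exact le_antisymm (Finset.min'_le _ _ h0) (hmem _ (Finset.min'_mem _ _)).1
  · have := Finset.orderEmbOfFin_last hc (by omega)
    simp only [Nat.lt_succ_self, dite_true]
    have h2 : (⟨c, Nat.lt_succ_self c⟩ : Fin (c + 1)) = ⟨c + 1 - 1, by omega⟩ := by simp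
    rw [ho, h2, this]
    exact le_antisymm (hmem _ (Finset.max'_mem _ _)).2 (Finset.le_max' _ _ h1)
  · intro e he
    have h2 : e < c + 1 := by omega
    have h3 : e + 1 < c + 1 := by omega
    simp only [h2, h3, dite_true]
    exact o.strictMono (by simp)
  · intro a ha ha0 ha1
    have haB : a ∈ B := by simp [hB, ha, ha0, ha1]
    have : a ∈ Set.range o := by rw [ho, Finset.range_orderEmbOfFin]; exact haB
    obtain ⟨⟨e, he⟩, hea⟩ := this
    refine ⟨e, ?_, by simp [he, hea]⟩
    by_contra hcon
    have hec : e = c := by omega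
    subst hec
    have := Finset.orderEmbOfFin_last hc (by omega)
    have h2 : (⟨e, he⟩ : Fin (e + 1)) = ⟨e + 1 - 1, by omega⟩ := by simp
    rw [ho, h2, this] at hea
    have := Finset.le_max' _ _ h1
    linarith

lemma sum_range_mul_eq (F : ℕ → ℝ) (m c : ℕ) :
    ∑ i ∈ Finset.range (m * c), F i = ∑ k ∈ Finset.range m, ∑ e ∈ Finset.range c, F (k * c + e) := by
  induction m with
  | zero => simp
  | succ m ih =>
    rw [Finset.sum_range_succ, ← ih, add_mul, one_mul, Finset.sum_range_add]

/-- The times `k + s e` with `k ∈ ℤ` and `0 ≤ e < c`, enumerated by `ℤ`. -/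
def breakTime (c : ℕ) (s : ℕ → ℝ) (i : ℤ) : ℝ :=
  ((i / (c : ℤ) : ℤ) : ℝ) + s (i % (c : ℤ)).toNat

section

variable {c : ℕ} {s : ℕ → ℝ}

lemma breakTime_mul_add {k : ℤ} {e : ℕ} (he : e < c) :
    breakTime c s (k * c + e) = k + s e := by
  have hc : (0 : ℤ) < c := by exact_mod_cast (by omega : 0 < c)
  have h1 : (k * (c : ℤ) + e) / c = k := by
    rw [Int.ediv_eq_iff_of_pos hc]
    constructor
    · nlinarith
    · have : (e : ℤ) < c := by exact_mod_cast he
      nlinarith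
  have h2 : (k * (c : ℤ) + e) % c = e := by
    rw [Int.emod_def, h1]; ring
  rw [breakTime, h1, h2, Int.toNat_natCast]

lemma breakTime_mul_add_succ (h0 : s 0 = 0) (h1 : s c = 1) {k : ℤ} {e : ℕ} (he : e < c) :
    breakTime c s (k * c + e + 1) = k + s (e + 1) := by
  rcases Nat.lt_or_ge (e + 1) c with h | h
  · have := breakTime_mul_add (s := s) (k := k) h
    push_cast at this
    rw [← this, add_assoc]
  · have hec : e + 1 = c := by omega
    have := breakTime_mul_add (s := s) (k := k + 1) (e := 0) (show 0 < c by omega)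
    rw [h0] at this
    rw [hec, h1]
    have h2 : k * (c : ℤ) + e + 1 = (k + 1) * c + (0 : ℕ) := by rw [← hec]; push_cast; ring
    rw [h2, this]; push_cast; ring

lemma exists_eq_mul_add (hc : 0 < c) (i : ℤ) : ∃ k : ℤ, ∃ e : ℕ, e < c ∧ i = k * c + e := by
  have hc' : (0 : ℤ) < c := by exact_mod_cast hc
  have h1 := Int.emod_nonneg i hc'.ne'
  have h2 := Int.emod_lt_of_pos i hc'
  refine ⟨i / c, (i % c).toNat, by omega, ?_⟩
  rw [Int.toNat_of_nonneg h1]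
  have := Int.mul_ediv_add_emod i c
  linarith

lemma breakTime_strictMono (hc : 0 < c) (h0 : s 0 = 0) (h1 : s c = 1)
    (hs : ∀ e < c, s e < s (e + 1)) : StrictMono (breakTime c s) := by
  apply strictMono_int_of_lt_succ
  intro i
  obtain ⟨k, e, he, rfl⟩ := exists_eq_mul_add hc i
  rw [breakTime_mul_add_succ h0 h1 he, breakTime_mul_add he]
  linarith [hs e he]

lemma breakTime_cover (h0 : s 0 = 0) (h1 : s c = 1) (t : ℝ) :
    ∃ i, breakTime c s i ≤ t ∧ t < breakTime c s (i + 1) := by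
  have key : ∀ m : ℕ, m ≤ c → Int.fract t < s m → ∃ e < m, s e ≤ Int.fract t ∧
      Int.fract t < s (e + 1) := by
    intro m
    induction m with
    | zero => intro _ h; rw [h0] at h; exact absurd (Int.fract_nonneg t) (not_le.2 h)
    | succ m ih =>
      intro hm h
      rcases le_or_gt (s m) (Int.fract t) with h2 | h2
      · exact ⟨m, by omega, h2, h⟩
      · obtain ⟨e, he, h3⟩ := ih (by omega) h2
        exact ⟨e, by omega, h3⟩
  obtain ⟨e, he, h2, h3⟩ := key c le_rfl (by rw [h1]; exact Int.fract_lt_one t)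
  refine ⟨⌊t⌋ * c + e, ?_, ?_⟩
  · rw [breakTime_mul_add he]; linarith [Int.floor_add_fract t]
  · rw [breakTime_mul_add_succ h0 h1 he]; linarith [Int.floor_add_fract t]

lemma breakpoint_mem_Icc (h0 : s 0 = 0) (h1 : s c = 1) (hs : ∀ e < c, s e < s (e + 1)) {e : ℕ}
    (he : e ≤ c) : s e ∈ Icc (0 : ℝ) 1 := by
  have up : ∀ m, m ≤ c → 0 ≤ s m := by
    intro m
    induction m with
    | zero => intro _; rw [h0]
    | succ m ih => intro hm; linarith [ih (by omega), hs m (by omega)]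
  have dn : ∀ m, m ≤ c → s (c - m) ≤ 1 := by
    intro m
    induction m with
    | zero => intro _; rw [Nat.sub_zero, h1]
    | succ m ih =>
      intro hm
      have h2 := hs (c - (m + 1)) (by omega)
      rw [show c - (m + 1) + 1 = c - m by omega] at h2
      linarith [ih (by omega)]
  have := dn (c - e) (by omega)
  rw [show c - (c - e) = e by omega] at this
  exact ⟨up e he, this⟩

lemma affineBetween_breakTime {d : ℕ} (γ : ClosedPath d) (hc : 0 < c) (h0 : s 0 = 0) (h1 : s c = 1)
    (hs : ∀ e < c, s e < s (e + 1)) (j : Fin d) :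
    AffineBetween (breakTime c s) (fun t => γ.pos t j) := by
  intro i u hu
  obtain ⟨k, e, he, rfl⟩ := exists_eq_mul_add hc i
  rw [breakTime_mul_add_succ h0 h1 he, breakTime_mul_add he] at *
  have hse := breakpoint_mem_Icc h0 h1 hs he.le
  have hse' := breakpoint_mem_Icc h0 h1 hs (show e + 1 ≤ c from he)
  have hpos : 0 < s (e + 1) - s e := by linarith [hs e he]
  have hne := hpos.ne'
  refine ⟨(u - k - s e) / (s (e + 1) - s e), ⟨div_nonneg (by linarith [hu.1]) hpos.le,
    (div_le_one hpos).2 (by linarith [hu.2])⟩, fun h => div_pos (by linarith) hpos,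
    fun h => (div_lt_one hpos).2 (by linarith), ?_⟩
  have hu' : u = k + (u - k) := by ring
  have hmem : u - k ∈ Icc (0 : ℝ) 1 := ⟨by linarith [hu.1, hse.1], by linarith [hu.2, hse'.2]⟩
  simp only
  rw [γ.pos_intCast_add_apply k hse, γ.pos_intCast_add_apply k hse']
  conv_lhs => rw [hu', γ.pos_intCast_add_apply k hmem]
  field_simp
  ring

end

/-! ### The sequence of unit cells followed by a closed path -/

lemma abs_apply_sub_le_dist {d : ℕ} (p q : Pt d) (j : Fin d) : |p j - q j| ≤ dist p q := by
  have := PiLp.norm_apply_le (p := 2) (p - q) j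
  rwa [← dist_eq_norm, Real.norm_eq_abs, PiLp.sub_apply] at this

/-- Along one edge of the path, running from `A` to `B` in some coordinate, the cell changes at
most `|B - A| + 1` times in this coordinate, and it never changes if `A = B`. -/
lemma sum_cell_changes_le {c : ℕ} {s : ℕ → ℝ} (h0 : s 0 = 0) (h1 : s c = 1)
    (hs : ∀ e < c, s e < s (e + 1)) {A B : ℝ} {κ : ℕ → ℤ}
    (hκ : ∀ e < c, |(1 - s e) * A + s e * B - κ e| ≤ 1 / 2)
    (hκ' : ∀ e < c, |(1 - s e) * A + s e * B - κ (e + 1)| ≤ 1 / 2)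
    (hκ'' : ∀ e < c, |(1 - s (e + 1)) * A + s (e + 1) * B - κ (e + 1)| ≤ 1 / 2)
    (hstuck : ∀ e < c, (∃ z : ℤ, (1 - s e) * A + s e * B = z + 1 / 2 ∧
      (1 - s (e + 1)) * A + s (e + 1) * B = z + 1 / 2) → κ (e + 1) = κ e) :
    ∑ e ∈ Finset.range c, |(κ (e + 1) : ℝ) - κ e| ≤ if A = B then 0 else |B - A| + 1 := by
  have hc : 0 < c := by
    rcases Nat.eq_zero_or_pos c with h | h
    · subst h; rw [h0] at h1; norm_num at h1
    · exact h
  split_ifs with hAB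
  · subst hAB
    have hg : ∀ l : ℝ, (1 - l) * A + l * A = A := fun l => by ring
    simp only [hg] at hκ hκ' hstuck
    apply le_of_eq
    apply Finset.sum_eq_zero
    intro e he
    rw [Finset.mem_range] at he
    have h2 := hκ e he
    have h3 := hκ' e he
    have h4 := hstuck e he
    rw [abs_le] at h2 h3
    have h5 : κ (e + 1) = κ e := by
      by_contra hne
      rcases lt_or_gt_of_ne hne with h | h
      · have : (κ (e + 1) : ℝ) + 1 ≤ κ e := by exact_mod_cast h
        exact hne (h4 ⟨κ (e + 1), by linarith, by linarith⟩)
      · have : (κ e : ℝ) + 1 ≤ κ (e + 1) := by exact_mod_cast h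
        exact hne (h4 ⟨κ e, by linarith, by linarith⟩)
    rw [h5]; simp
  · have e0 := hκ 0 hc
    have e1 := hκ'' (c - 1) (by omega)
    rw [show c - 1 + 1 = c by omega, h1] at e1
    rw [h0] at e0
    rw [abs_le] at e0 e1
    rcases lt_or_gt_of_ne hAB with h | h
    · have hmono : ∀ e < c, κ e ≤ κ (e + 1) := by
        intro e he
        have h2 := hκ e he
        have h3 := hκ'' e he
        rw [abs_le] at h2 h3
        have h4 := hs e he
        have : (κ e : ℝ) < κ (e + 1) + 1 := by nlinarith
        have : κ e < κ (e + 1) + 1 := by exact_mod_cast this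
        omega
      rw [Finset.sum_congr rfl (g := fun e => (κ (e + 1) : ℝ) - κ e), Finset.sum_range_sub
        (fun e => (κ e : ℝ)), abs_of_pos (by linarith)]
      · linarith
      · intro e he
        rw [abs_of_nonneg]
        have := hmono e (Finset.mem_range.1 he)
        rw [sub_nonneg]; exact_mod_cast this
    · have hmono : ∀ e < c, κ (e + 1) ≤ κ e := by
        intro e he
        have h2 := hκ e he
        have h3 := hκ'' e he
        rw [abs_le] at h2 h3
        have h4 := hs e he
        have : (κ (e + 1) : ℝ) < κ e + 1 := by nlinarith
        have : κ (e + 1) < κ e + 1 := by exact_mod_cast this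
        omega
      rw [Finset.sum_congr rfl (g := fun e => (κ e : ℝ) - κ (e + 1)), Finset.sum_range_sub'
        (fun e => (κ e : ℝ)), abs_of_neg (by linarith)]
      · linarith
      · intro e he
        rw [abs_of_nonpos, neg_sub]
        have := hmono e (Finset.mem_range.1 he)
        rw [sub_nonpos]; exact_mod_cast this

/-- A closed path followed through the unit cells centred at the integer points: the path visits
`x i` and then stays in the closed cell centred at `κ i` until it reaches `x (i + 1)`. The cell
changes exactly at the ends of the crossings of the half-integer hyperplanes. It is kept while the
path runs inside such a hyperplane, so that touching a hyperplane is not a change. -/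
structure Discretization {d : ℕ} (γ : ClosedPath d) (P : Finset (Pt d)) where
  K : ℕ
  K_pos : 0 < K
  x : ℤ → Pt d
  κ : ℤ → Fin d → ℤ
  x_per : ∀ i, x (i + K) = x i
  κ_per : ∀ i, κ (i + K) = κ i
  close_left : ∀ i j, |x i j - κ i j| ≤ 1 / 2
  close_right : ∀ i j, |x (i + 1) j - κ i j| ≤ 1 / 2
  sum_dist : ∑ i ∈ Finset.range K, dist (x i) (x (i + 1)) = γ.wt
  visits : ∀ p ∈ P, ∃ i, x i = p
  sum_changes : ∑ i ∈ Finset.range K, ∑ j, |(κ i j : ℝ) - κ (i - 1) j| ≤ 2 * d * γ.wt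
  crossing : ∀ i j, κ (i - 1) j ≠ κ i j → ∃ s t, γ.IsCrossing j (x i j) s t ∧ γ.pos t = x i
  change : ∀ j s t, ∀ z : ℤ, γ.IsCrossing j (z + 1 / 2) s t →
    ∃ i, x i = γ.pos t ∧ κ (i - 1) j ≠ κ i j

lemma finite_halfInteger_times (A B : ℝ) (hAB : A ≠ B) :
    {l : ℝ | 0 < l ∧ l < 1 ∧ ∃ z : ℤ, (1 - l) * A + l * B = z + 1 / 2}.Finite := by
  apply ((Set.finite_Icc (⌊min A B⌋ - 1) (⌈max A B⌉)).image
    fun z : ℤ => ((z : ℝ) + 1 / 2 - A) / (B - A)).subset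
  rintro l ⟨h0, h1, z, hz⟩
  have hne : B - A ≠ 0 := sub_ne_zero.2 hAB.symm
  refine ⟨z, ⟨?_, ?_⟩, ?_⟩
  · have h2 : (⌊min A B⌋ : ℝ) ≤ min A B := Int.floor_le _
    have h3 : min A B ≤ z + 1 / 2 := by
      rw [← hz]; nlinarith [min_le_left A B, min_le_right A B]
    have : ((⌊min A B⌋ - 1 : ℤ) : ℝ) ≤ z := by push_cast; linarith
    exact_mod_cast this
  · have h2 : max A B ≤ (⌈max A B⌉ : ℝ) := Int.le_ceil _
    have h3 : (z : ℝ) + 1 / 2 ≤ max A B := by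
      rw [← hz]; nlinarith [le_max_left A B, le_max_right A B]
    have : (z : ℝ) ≤ (⌈max A B⌉ : ℤ) := by linarith
    exact_mod_cast this
  · simp only
    rw [div_eq_iff hne]; linarith

/-- The breakpoints are the vertices, the times at which some coordinate of an edge passes a
half-integer, and times at which the points of `P` are visited; an edge of positive length changes
the cell at most `|B - A| + 1` times per coordinate, which is at most twice its length. -/
theorem nonempty_discretization {d : ℕ} (γ : ClosedPath d) (P : Finset (Pt d)) (hV : γ.Visits P)
    (hE : γ.EdgesAtLeastOne) : Nonempty (Discretization γ P) := by
  choose! tv htv using hV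
  -- one partition of `[0, 1]` serves all edges, which makes the enumeration periodic
  set A : Set ℝ := (⋃ k ∈ Finset.range γ.n, ⋃ j : Fin d,
      {l : ℝ | γ.vertex k j ≠ γ.vertex (k + 1) j ∧ 0 < l ∧ l < 1 ∧ ∃ z : ℤ,
        (1 - l) * γ.vertex k j + l * γ.vertex (k + 1) j = z + 1 / 2}) ∪
    (fun p => Int.fract (tv p)) '' (P : Set (Pt d)) with hA
  have hAfin : A.Finite := by
    refine Set.Finite.union ?_ (P.finite_toSet.image _)
    refine Set.Finite.biUnion (Finset.finite_toSet _) fun k _ => Set.finite_iUnion fun j => ?_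
    by_cases h : γ.vertex k j = γ.vertex (k + 1) j
    · simp [h]
    · exact (finite_halfInteger_times _ _ h).subset fun l hl => hl.2
  obtain ⟨c, s, hc, h0, h1, hs, hAs⟩ := exists_breakpoints A hAfin
  set T := breakTime c s with hT
  have hTm : StrictMono T := breakTime_strictMono hc h0 h1 hs
  have hf : ∀ j, AffineBetween T (fun t => γ.pos t j) := affineBetween_breakTime γ hc h0 h1 hs
  have hK : 0 < γ.n * c := Nat.mul_pos γ.n_pos hc
  have hTK : ∀ i, T (i + (γ.n * c : ℕ)) = T i + γ.n := by
    intro i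
    obtain ⟨k, e, he, rfl⟩ := exists_eq_mul_add hc i
    have : k * (c : ℤ) + e + (γ.n * c : ℕ) = (k + γ.n) * c + e := by push_cast; ring
    rw [this, hT, breakTime_mul_add he, breakTime_mul_add he]
    push_cast; ring
  have hper : ∀ i, γ.pos (T (i + (γ.n * c : ℕ))) = γ.pos (T i) := by
    intro i
    have := γ.pos_add_mul (T i) 1
    rw [hTK]
    simpa using this
  have hpos : ∀ (k : ℤ) (e : ℕ), e < c → ∀ j,
      γ.pos (T (k * c + e)) j = (1 - s e) * γ.vertex k j + s e * γ.vertex (k + 1) j := by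
    intro k e he j
    rw [hT, breakTime_mul_add he, γ.pos_intCast_add_apply k (breakpoint_mem_Icc h0 h1 hs he.le)]
  have hpos' : ∀ (k : ℤ) (e : ℕ), e < c → ∀ j, γ.pos (T (k * c + e + 1)) j =
      (1 - s (e + 1)) * γ.vertex k j + s (e + 1) * γ.vertex (k + 1) j := by
    intro k e he j
    rw [hT, breakTime_mul_add_succ h0 h1 he,
      γ.pos_intCast_add_apply k (breakpoint_mem_Icc h0 h1 hs (show e + 1 ≤ c from he))]
  -- a half-integer passed strictly between two breakpoints would give another breakpoint
  have hok : ∀ j i, ∀ z : ℤ, ¬ (min (γ.pos (T i) j) (γ.pos (T (i + 1)) j) < z + 1 / 2 ∧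
      (z : ℝ) + 1 / 2 < max (γ.pos (T i) j) (γ.pos (T (i + 1)) j)) := by
    intro j i z hz
    obtain ⟨k, e, he, rfl⟩ := exists_eq_mul_add hc i
    rw [hpos k e he j, hpos' k e he j] at hz
    have hse := hs e he
    have hse0 := (breakpoint_mem_Icc h0 h1 hs he.le).1
    have hse1 := (breakpoint_mem_Icc h0 h1 hs (show e + 1 ≤ c from he)).2
    set a := γ.vertex k j with ha
    set b := γ.vertex (k + 1) j with hb
    have hab : a ≠ b := by
      intro hab
      rw [hab] at hz
      have hg : ∀ l : ℝ, (1 - l) * b + l * b = b := fun l => by ring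
      rw [hg, hg, min_self, max_self] at hz
      linarith [hz.1, hz.2]
    have hne : b - a ≠ 0 := sub_ne_zero.2 hab.symm
    set l := ((z : ℝ) + 1 / 2 - a) / (b - a) with hl
    have hleq : (1 - l) * a + l * b = z + 1 / 2 := by
      have : l * (b - a) = z + 1 / 2 - a := by rw [hl]; field_simp
      linarith
    have hl1 : s e < l ∧ l < s (e + 1) := by
      rw [← hleq] at hz
      rcases lt_or_gt_of_ne hab with h | h
      · rw [min_eq_left (by nlinarith), max_eq_right (by nlinarith)] at hz
        constructor <;> nlinarith
      · rw [min_eq_right (by nlinarith), max_eq_left (by nlinarith)] at hz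
        constructor <;> nlinarith
    have hlA : l ∈ A := by
      left
      have hn : (0 : ℤ) < γ.n := by exact_mod_cast γ.n_pos
      have hk0 := Int.emod_nonneg k hn.ne'
      have hk1 := Int.emod_lt_of_pos k hn
      have hk2 : ((k % γ.n).toNat : ℤ) = k % γ.n := Int.toNat_of_nonneg hk0
      have hk3 : k = k % γ.n + (k / γ.n) * γ.n := by
        have := Int.mul_ediv_add_emod k γ.n; linarith
      have hv1 : γ.vertex ((k % γ.n).toNat : ℕ) = γ.vertex k := by
        rw [hk2]; conv_rhs => rw [hk3, γ.vertex_add_mul]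
      have hv2 : γ.vertex (((k % γ.n).toNat : ℕ) + 1) = γ.vertex (k + 1) := by
        rw [hk2]
        conv_rhs => rw [hk3, show k % γ.n + (k / γ.n) * γ.n + 1 =
          k % γ.n + 1 + (k / γ.n) * γ.n by ring, γ.vertex_add_mul]
      simp only [Set.mem_iUnion]
      refine ⟨(k % γ.n).toNat, Finset.mem_range.2 (by omega), j, ?_⟩
      simp only [Set.mem_ofPred_eq]
      rw [hv1, hv2]
      exact ⟨hab, by linarith, by linarith, z, hleq⟩
    obtain ⟨e', he', hl'⟩ := hAs l hlA (by linarith) (by linarith)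
    have t1 := breakTime_mul_add (s := s) (k := 0) he
    have t2 := breakTime_mul_add (s := s) (k := 0) he'
    have t3 := breakTime_mul_add_succ h0 h1 (k := 0) he
    have m1 : T (0 * c + e) < T (0 * c + e') := by rw [hT, t1, t2]; push_cast; linarith
    have m2 : T (0 * c + e') < T (0 * c + e + 1) := by rw [hT, t2, t3]; push_cast; linarith
    rw [hTm.lt_iff_lt] at m1 m2
    omega
  choose κ κper κ1 κ2 κ3 using fun j =>
    exists_cellIndex (g := fun i => γ.pos (T i) j) hK (fun i => by simp only [hper]) (hok j)
  refine ⟨⟨γ.n * c, hK, fun i => γ.pos (T i), fun i j => κ j i, hper, fun i => ?_, fun i j => κ1 j i,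
    fun i j => κ2 j i, ?_, ?_, ?_, ?_, ?_⟩⟩
  · funext j; exact κper j i
  · rw [sum_range_mul_eq, ClosedPath.wt]
    apply Finset.sum_congr rfl
    intro k _
    have hterm : ∀ e ∈ Finset.range c, dist (γ.pos (T ((k * c + e : ℕ) : ℤ)))
        (γ.pos (T (((k * c + e : ℕ) : ℤ) + 1))) =
        (s (e + 1) - s e) * dist (γ.vertex k) (γ.vertex (k + 1)) := by
      intro e he
      rw [Finset.mem_range] at he
      push_cast
      rw [hT, breakTime_mul_add_succ h0 h1 he, breakTime_mul_add he,
        γ.pos_intCast_add k (breakpoint_mem_Icc h0 h1 hs he.le),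
        γ.pos_intCast_add k (breakpoint_mem_Icc h0 h1 hs (show e + 1 ≤ c from he)),
        dist_lineMap_lineMap, Real.dist_eq, abs_sub_comm, abs_of_pos (by linarith [hs e he])]
    rw [Finset.sum_congr rfl hterm, ← Finset.sum_mul, Finset.sum_range_sub, h0, h1]
    ring
  · intro p hp
    have hcase : ∃ e < c, s e = Int.fract (tv p) := by
      rcases (Int.fract_nonneg (tv p)).eq_or_lt with h | h
      · exact ⟨0, hc, by rw [h0]; exact h⟩
      · exact hAs _ (Or.inr ⟨p, hp, rfl⟩) h (Int.fract_lt_one _)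
    obtain ⟨e, he, hse⟩ := hcase
    refine ⟨⌊tv p⌋ * c + e, ?_⟩
    rw [hT, breakTime_mul_add he, hse, Int.floor_add_fract]
    exact htv p hp
  · rw [Finset.sum_comm]
    have hj : ∀ j ∈ (Finset.univ : Finset (Fin d)),
        ∑ i ∈ Finset.range (γ.n * c), |(κ j i : ℝ) - κ j (i - 1)| ≤ 2 * γ.wt := by
      intro j _
      rw [sum_range_mul_eq (fun i => |(κ j i : ℝ) - κ j (i - 1)|), ClosedPath.wt, Finset.mul_sum]
      apply Finset.sum_le_sum
      intro k _
      have := sum_cell_changes_le (A := γ.vertex k j) (B := γ.vertex (k + 1) j) h0 h1 hs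
        (κ := fun e => κ j (k * c + e - 1)) ?_ ?_ ?_ ?_
      · refine le_trans (le_of_eq ?_) (this.trans ?_)
        · apply Finset.sum_congr rfl
          intro e _
          push_cast
          rw [show (k : ℤ) * c + (e + 1) - 1 = k * c + e by ring]
        · split_ifs with h
          · positivity
          · have hne : γ.vertex k ≠ γ.vertex (k + 1) := fun h' => h (by rw [h'])
            have := hE k hne
            have h2 := abs_apply_sub_le_dist (γ.vertex (k + 1)) (γ.vertex k) j
            rw [dist_comm] at h2
            linarith
      · intro e he
        have := κ2 j (k * c + e - 1)
        rw [sub_add_cancel, hpos k e he j] at this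
        exact this
      · intro e he
        have := κ1 j (k * c + e)
        rw [hpos k e he j] at this
        push_cast
        rwa [show (k : ℤ) * c + (e + 1) - 1 = k * c + e by ring]
      · intro e he
        have := κ2 j (k * c + e)
        rw [hpos' k e he j] at this
        push_cast
        rwa [show (k : ℤ) * c + (e + 1) - 1 = k * c + e by ring]
      · rintro e he ⟨z, hz1, hz2⟩
        push_cast
        rw [show (k : ℤ) * c + (e + 1) - 1 = k * c + e by ring]
        apply κ3
        refine ⟨z, ?_, ?_⟩
        · simp only; rw [hpos k e he j, hz1]
        · simp only; rw [hpos' k e he j, hz2]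
    refine (Finset.sum_le_sum hj).trans (le_of_eq ?_)
    simp; ring
  · intro i j hij
    obtain ⟨s', hs', hrun, hcr⟩ := (hf j).exists_crossing hTm hK (fun i => by simp only [hper])
      (κ1 j) (κ2 j) (κ3 j) hij
    exact γ.exists_isCrossing hs' hrun hcr
  · intro j s' t' z hcr
    obtain ⟨i, hi, hκ⟩ := (hf j).exists_cell_change hTm hK (fun i => by simp only [hper])
      (κ1 j) (κ2 j) (κ3 j) (breakTime_cover h0 h1) hcr.2.2.1 hcr.2.2.2.1 hcr.2.2.2.2
    exact ⟨i, by simp only [hi], hκ⟩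

/-! ### Closed walks made of links, and their rearrangement -/

/-- A node of a walk together with one of the two sides of the face at this node. -/
abbrev Port (d : ℕ) : Type := Pt d × Bool

/-- A two-edge polygonal path from `p` via `m` to `q`, leaving the node `p` on the side `bp` and
arriving at the node `q` on the side `bq`. -/
structure Link (d : ℕ) where
  p : Pt d
  bp : Bool
  m : Pt d
  q : Pt d
  bq : Bool

namespace Link

variable {d : ℕ}

/-- The link traversed backwards. -/
def rev (L : Link d) : Link d := ⟨L.q, L.bq, L.m, L.p, L.bp⟩

/-- The length of a link. -/
noncomputable def len (L : Link d) : ℝ := dist L.p L.m + dist L.m L.q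

@[simp] lemma len_rev (L : Link d) : L.rev.len = L.len := by
  simp only [len, rev]
  rw [dist_comm L.q, dist_comm L.m L.p, add_comm]

end Link

open Classical in
/-- The contribution of two consecutive links, one ending at `t` and the other starting at `s`, to
the number of crossings at each node: there is a crossing if the two sides differ. -/
noncomputable def joint {d : ℕ} (t s : Port d) : Pt d → ℕ :=
  fun y => if t.1 = y ∧ t.2 ≠ s.2 then 1 else 0

lemma joint_comm {d : ℕ} {t s : Port d} (h : t.1 = s.1) : joint t s = joint s t := by
  funext y
  simp only [joint, h, ne_comm]

lemma joint_self_side {d : ℕ} {t s : Port d} (h : t.2 = s.2) : joint t s = 0 := by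
  funext y
  simp [joint, h]

lemma joint_apply_of_ne {d : ℕ} {t s : Port d} {y : Pt d} (h : t.1 ≠ y) : joint t s y = 0 := by
  simp [joint, h]

lemma joint_le_one {d : ℕ} (t s : Port d) (y : Pt d) : joint t s y ≤ 1 := by
  unfold joint; split_ifs <;> simp

lemma joint_pos {d : ℕ} {t s : Port d} {y : Pt d} (h : 0 < joint t s y) : t.1 = y ∧ t.2 ≠ s.2 := by
  by_contra hc
  simp [joint, hc] at h

lemma joint_eq_one {d : ℕ} {t s : Port d} (h : t.2 ≠ s.2) : joint t s t.1 = 1 := by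
  simp [joint, h]

/-- `Walk M s t c`: the links in the multiset `M` can be concatenated to a walk from the port `s`
to the port `t` that makes `c y` crossings at the node `y`. -/
inductive Walk {d : ℕ} : Multiset (Link d) → Port d → Port d → (Pt d → ℕ) → Prop
  | single (L : Link d) : Walk {L} (L.p, L.bp) (L.q, L.bq) 0
  | join {M M' : Multiset (Link d)} {s t s' t' : Port d} {c c' : Pt d → ℕ}
      (h : Walk M s t c) (h' : Walk M' s' t' c') (hts : t.1 = s'.1) :
      Walk (M + M') s t' (c + c' + joint t s')

/-- The links in `M` can be concatenated to a closed walk that makes `c y` crossings at `y`. -/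
def ClosedWalk {d : ℕ} (M : Multiset (Link d)) (c : Pt d → ℕ) : Prop :=
  ∃ s t c₀, Walk M s t c₀ ∧ t.1 = s.1 ∧ c = c₀ + joint t s

section

variable {d : ℕ}

lemma Walk.of_eq {M M' : Multiset (Link d)} {s t : Port d} {c c' : Pt d → ℕ} (h : Walk M s t c)
    (hM : M = M') (hc : c = c') : Walk M' s t c' := by
  subst hM; subst hc; exact h

lemma Walk.rev {M : Multiset (Link d)} {s t : Port d} {c : Pt d → ℕ} (h : Walk M s t c) :
    Walk (M.map Link.rev) t s c := by
  induction h with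
  | single L => rw [Multiset.map_singleton]; exact Walk.single L.rev
  | join h h' hts ih ih' =>
    refine (ih'.join ih hts.symm).of_eq ?_ ?_
    · rw [Multiset.map_add, add_comm]
    · rw [joint_comm hts]
      funext y; simp only [Pi.add_apply]; omega

/-- A walk with a crossing at `y` can be cut there. -/
lemma Walk.split {M : Multiset (Link d)} {s t : Port d} {c : Pt d → ℕ} {y : Pt d}
    (h : Walk M s t c) (hy : 0 < c y) :
    ∃ M₁ M₂ t₁ s₂ c₁ c₂, Walk M₁ s t₁ c₁ ∧ Walk M₂ s₂ t c₂ ∧ t₁.1 = y ∧ s₂.1 = y ∧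
      t₁.2 ≠ s₂.2 ∧ M = M₁ + M₂ ∧ c = c₁ + c₂ + joint t₁ s₂ := by
  induction h with
  | single L => simp at hy
  | @join M M' s t s' t' c c' h h' hts ih ih' =>
    by_cases h1 : 0 < joint t s' y
    · obtain ⟨h2, h3⟩ := joint_pos h1
      exact ⟨M, M', t, s', c, c', h, h', h2, hts ▸ h2, h3, rfl, rfl⟩
    by_cases h2 : 0 < c y
    · obtain ⟨M₁, M₂, t₁, s₂, c₁, c₂, w1, w2, e1, e2, e3, e4, e5⟩ := ih h2
      refine ⟨M₁, M₂ + M', t₁, s₂, c₁, _, w1, w2.join h' hts, e1, e2, e3, ?_, ?_⟩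
      · rw [e4, add_assoc]
      · rw [e5]; funext y; simp only [Pi.add_apply]; omega
    · have h3 : 0 < c' y := by simp only [Pi.add_apply] at hy; omega
      obtain ⟨M₁, M₂, t₁, s₂, c₁, c₂, w1, w2, e1, e2, e3, e4, e5⟩ := ih' h3
      refine ⟨M + M₁, M₂, t₁, s₂, _, c₂, h.join w1 hts, w2, e1, e2, e3, ?_, ?_⟩
      · rw [e4, add_assoc]
      · rw [e5]; funext y; simp only [Pi.add_apply]; omega

/-- A closed walk with a crossing at `y` can be rotated so that it starts and ends with it. -/
lemma ClosedWalk.rotate {M : Multiset (Link d)} {c : Pt d → ℕ} {y : Pt d} (h : ClosedWalk M c)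
    (hy : 0 < c y) :
    ∃ s t c₀, Walk M s t c₀ ∧ t.1 = y ∧ s.1 = y ∧ t.2 ≠ s.2 ∧ c = c₀ + joint t s := by
  obtain ⟨s, t, c₀, w, hts, rfl⟩ := h
  by_cases h1 : 0 < joint t s y
  · obtain ⟨h2, h3⟩ := joint_pos h1
    exact ⟨s, t, c₀, w, h2, hts ▸ h2, h3, rfl⟩
  · have h2 : 0 < c₀ y := by simp only [Pi.add_apply] at hy; omega
    obtain ⟨M₁, M₂, t₁, s₂, c₁, c₂, w1, w2, e1, e2, e3, e4, e5⟩ := w.split h2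
    refine ⟨s₂, t₁, _, (w2.join w1 hts).of_eq (by rw [e4, add_comm]) rfl, e1, e2, e3, ?_⟩
    rw [e5]; funext y; simp only [Pi.add_apply]; omega

/-- The multiset `M'` arises from `M` by reversing some of the links. -/
def RevEquiv (M M' : Multiset (Link d)) : Prop :=
  ∃ A B : Multiset (Link d), M = A + B ∧ M' = A + B.map Link.rev

/-- Three crossings at the same node can be replaced by one crossing there, by reversing one of the
three pieces into which they divide the closed walk, or by exchanging two of them. -/
lemma ClosedWalk.reduce {M : Multiset (Link d)} {c : Pt d → ℕ} {y : Pt d} (h : ClosedWalk M c)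
    (hy : 3 ≤ c y) :
    ∃ M' c', ClosedWalk M' c' ∧ RevEquiv M M' ∧ c' y + 2 = c y ∧ ∀ z ≠ y, c' z = c z := by
  obtain ⟨s, t, c₀, w, ht, hs, hne, rfl⟩ := h.rotate (y := y) (by omega)
  have h1 : 2 ≤ c₀ y := by
    have := joint_le_one t s y
    simp only [Pi.add_apply] at hy; omega
  obtain ⟨M₁, M', t₁, s', c₁, c', w1, w', e1, e2, e3, e4, e5⟩ := w.split (y := y) (by omega)
  have h2 : 1 ≤ c₁ y + c' y := by
    have := joint_le_one t₁ s' y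
    rw [e5] at h1
    simp only [Pi.add_apply] at h1; omega
  -- the closed walk, started with a crossing at `y`, is cut at two further ones
  have main : ∃ M₁ M₂ M₃ s₂ s₃ t₁ t₂ c₁ c₂ c₃, Walk M₁ s t₁ c₁ ∧ Walk M₂ s₂ t₂ c₂ ∧
      Walk M₃ s₃ t c₃ ∧ t₁.1 = y ∧ t₂.1 = y ∧ s₂.1 = y ∧ s₃.1 = y ∧ t₁.2 ≠ s₂.2 ∧ t₂.2 ≠ s₃.2 ∧
      M = M₁ + M₂ + M₃ ∧ c₀ = c₁ + c₂ + c₃ + joint t₁ s₂ + joint t₂ s₃ := by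
    by_cases h3 : 0 < c₁ y
    · obtain ⟨N₁, N₂, u₁, v₂, b₁, b₂, x1, x2, f1, f2, f3, f4, f5⟩ := w1.split h3
      refine ⟨N₁, N₂, M', v₂, s', u₁, t₁, b₁, b₂, c', x1, x2, w', f1, e1, f2, e2, f3, e3, ?_, ?_⟩
      · rw [e4, f4]
      · rw [e5, f5]; funext z; simp only [Pi.add_apply]; omega
    · obtain ⟨N₁, N₂, u₁, v₂, b₁, b₂, x1, x2, f1, f2, f3, f4, f5⟩ := w'.split (y := y) (by omega)
      refine ⟨M₁, N₁, N₂, s', v₂, t₁, u₁, c₁, b₁, b₂, w1, x1, x2, e1, f1, e2, f2, e3, f3, ?_, ?_⟩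
      · rw [e4, f4, add_assoc]
      · rw [e5, f5]; funext z; simp only [Pi.add_apply]; omega
  clear e1 e2 e3 e4 e5 h1 h2 w1 w'
  obtain ⟨M₁, M₂, M₃, s₂, s₃, t₁, t₂, c₁, c₂, c₃, w1, w2, w3, a1, a2, a3, a4, n1, n2, rfl, rfl⟩ :=
    main
  have j1 : ∀ {u v : Port d}, u.1 = y → u.2 ≠ v.2 → joint u v y = 1 := by
    intro u v hu huv; rw [← hu]; exact joint_eq_one huv
  have j0 : ∀ {u v : Port d} {z : Pt d}, u.1 = y → z ≠ y → joint u v z = 0 := by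
    intro u v z hu hz; exact joint_apply_of_ne (by rw [hu]; exact hz.symm)
  have js : ∀ {u v : Port d} {z : Pt d}, u.2 = v.2 → joint u v z = 0 := by
    intro u v z hu; rw [joint_self_side hu]; rfl
  -- reversing the second piece merges its ends with the neighbours on the same sides
  by_cases hb : t₁.2 = t₂.2
  · have hb' : s₂.2 = s₃.2 := by
      revert n1 n2 hb
      cases t₁.2 <;> cases t₂.2 <;> cases s₂.2 <;> cases s₃.2 <;> simp
    refine ⟨_, _, ⟨s, t, _, (w1.join w2.rev (a1.trans a2.symm)).join w3 (a3.trans a4.symm),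
      ht.trans hs.symm, rfl⟩, ⟨M₁ + M₃, M₂, ?_, ?_⟩, ?_, ?_⟩
    · abel
    · abel
    · simp only [Pi.add_apply, js hb, js hb', j1 a1 n1, j1 a2 n2]; omega
    · intro z hz
      simp only [Pi.add_apply, js hb, js hb', j0 a1 hz, j0 a2 hz]; omega
  -- otherwise the third piece starts on the side on which the first one ends: exchange the second
  -- and the third piece
  · have hb1 : t₁.2 = s₃.2 := by
      revert n1 n2 hb
      cases t₁.2 <;> cases t₂.2 <;> cases s₂.2 <;> cases s₃.2 <;> simp
    refine ⟨_, _, ⟨s, t₂, _, (w1.join w3 (a1.trans a4.symm)).join w2 (ht.trans a3.symm),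
      a2.trans hs.symm, rfl⟩, ⟨M₁ + M₂ + M₃, 0, by simp, ?_⟩, ?_, ?_⟩
    · simp only [Multiset.map_zero]; abel
    · have hsum : joint t s₂ y + joint t₂ s y = 1 := by
        by_cases hb2 : t.2 = s₂.2
        · have hb3 : t₂.2 ≠ s.2 := by
            revert n1 n2 hb hne hb2
            cases t₁.2 <;> cases t₂.2 <;> cases s₂.2 <;> cases s₃.2 <;> cases t.2 <;>
              cases s.2 <;> simp
          rw [js hb2, j1 a2 hb3]
        · have hb3 : t₂.2 = s.2 := by
            revert n1 n2 hb hne hb2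
            cases t₁.2 <;> cases t₂.2 <;> cases s₂.2 <;> cases s₃.2 <;> cases t.2 <;>
              cases s.2 <;> simp
          rw [js hb3, j1 ht hb2]
      simp only [Pi.add_apply, js hb1, j1 a1 n1, j1 a2 n2, j1 ht hne]; omega
    · intro z hz
      simp only [Pi.add_apply, js hb1, j0 a1 hz, j0 a2 hz, j0 ht hz]; omega

end

section

variable {d : ℕ}

/-- The links in `M` satisfy `V`, have total length at most `w`, and start or end in every point
of `S`. -/
structure LinkBounds (V : Link d → Prop) (S : Set (Pt d)) (w : ℝ) (M : Multiset (Link d)) :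
    Prop where
  valid : ∀ L ∈ M, V L
  visits : ∀ p ∈ S, ∃ L ∈ M, L.p = p ∨ L.q = p
  weight : (M.map Link.len).sum ≤ w

lemma LinkBounds.revEquiv {V : Link d → Prop} (hV : ∀ L, V L → V L.rev) {S : Set (Pt d)} {w : ℝ}
    {M M' : Multiset (Link d)} (h : LinkBounds V S w M) (hM : RevEquiv M M') :
    LinkBounds V S w M' := by
  obtain ⟨A, B, rfl, rfl⟩ := hM
  refine ⟨fun L hL => ?_, fun p hp => ?_, ?_⟩
  · rw [Multiset.mem_add, Multiset.mem_map] at hL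
    rcases hL with hL | ⟨L', hL', rfl⟩
    · exact h.valid L (Multiset.mem_add.2 (Or.inl hL))
    · exact hV _ (h.valid L' (Multiset.mem_add.2 (Or.inr hL')))
  · obtain ⟨L, hL, hp⟩ := h.visits p hp
    rw [Multiset.mem_add] at hL
    rcases hL with hL | hL
    · exact ⟨L, Multiset.mem_add.2 (Or.inl hL), hp⟩
    · exact ⟨L.rev, Multiset.mem_add.2 (Or.inr (Multiset.mem_map_of_mem _ hL)), hp.symm⟩
  · refine le_trans (le_of_eq ?_) h.weight
    simp [Multiset.map_map]

/-- A closed walk can be rearranged so that it makes at most two crossings at the node `y`. -/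
lemma ClosedWalk.exists_le_two {V : Link d → Prop} (hV : ∀ L, V L → V L.rev) {S : Set (Pt d)}
    {w : ℝ} (y : Pt d) {M : Multiset (Link d)} {c : Pt d → ℕ} (h : ClosedWalk M c)
    (hM : LinkBounds V S w M) :
    ∃ M' c', ClosedWalk M' c' ∧ LinkBounds V S w M' ∧ c' y ≤ 2 ∧ (0 < c' y ↔ 0 < c y) ∧
      ∀ z ≠ y, c' z = c z := by
  induction hk : c y using Nat.strong_induction_on generalizing M c with
  | _ k ih =>
    by_cases h3 : 3 ≤ c y
    · obtain ⟨M₁, c₁, w1, r1, e1, e2⟩ := h.reduce h3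
      obtain ⟨M', c', w', r', e1', e2', e3'⟩ := ih (c₁ y) (by omega) w1 (hM.revEquiv hV r1) rfl
      exact ⟨M', c', w', r', e1', by omega, fun z hz => by rw [e3' z hz, e2 z hz]⟩
    · exact ⟨M, c, h, hM, by omega, by rw [hk], fun _ _ => rfl⟩

/-- The straight link from `z` to `p` on the side `b`. -/
def straightLink (z p : Pt d) (b : Bool) : Link d := ⟨z, b, z, p, b⟩

lemma straightLink_len (z p : Pt d) (b : Bool) : (straightLink z p b).len = dist z p := by
  simp [straightLink, Link.len]

/-- Each crossing at `z` is replaced by a detour to `p`, with the crossing made there. -/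
lemma Walk.reroute {V : Link d → Prop} (hV : ∀ L, V L → V L.rev) {z p : Pt d} (hzp : z ≠ p)
    (hT : ∀ b, V (straightLink z p b)) {M : Multiset (Link d)} {s t : Port d} {c : Pt d → ℕ}
    (h : Walk M s t c) (hM : ∀ L ∈ M, V L) :
    ∃ M' c', Walk M' s t c' ∧ (∀ L ∈ M', V L) ∧ M ≤ M' ∧
      (M'.map Link.len).sum = (M.map Link.len).sum + c z * (2 * dist z p) ∧ c' z = 0 ∧
      (∀ y ≠ z, c y ≤ c' y) ∧ (∀ y, y ≠ z → y ≠ p → c' y = c y) := by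
  induction h with
  | single L =>
    exact ⟨{L}, 0, Walk.single L, hM, le_rfl, by simp, rfl, fun _ _ => le_rfl, fun _ _ _ => rfl⟩
  | @join M M' s t s' t' c c' h h' hts ih ih' =>
    obtain ⟨N, b, w1, v1, l1, e1, z1, g1, f1⟩ := ih fun L hL => hM L (Multiset.mem_add.2 (.inl hL))
    obtain ⟨N', b', w2, v2, l2, e2, z2, g2, f2⟩ :=
      ih' fun L hL => hM L (Multiset.mem_add.2 (.inr hL))
    by_cases hj : 0 < joint t s' z
    · obtain ⟨ht, hne⟩ := joint_pos hj
      have hj1 : joint t s' z = 1 := le_antisymm (joint_le_one _ _ _) hj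
      -- go to `p` on the side of arrival, cross there, and return on the other side
      have x1 := w1.join (Walk.single (straightLink z p t.2)) ht
      have x2 := x1.join (Walk.single (straightLink z p s'.2).rev) rfl
      have x3 := x2.join w2 (show (z, s'.2).1 = s'.1 by rw [← hts, ht])
      refine ⟨_, _, x3, ?_, ?_, ?_, ?_, ?_, ?_⟩
      · intro L hL
        simp only [Multiset.mem_add, Multiset.mem_singleton] at hL
        rcases hL with ((hL | rfl) | rfl) | hL
        · exact v1 L hL
        · exact hT _
        · exact hV _ (hT _)
        · exact v2 L hL
      · have : M + M' ≤ N + N' := add_le_add l1 l2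
        refine this.trans ?_
        rw [add_assoc N, add_assoc N]
        exact add_le_add_right (Multiset.le_add_left _ _) _
      · simp only [Multiset.map_add, Multiset.sum_add, Multiset.map_singleton,
          Multiset.sum_singleton, Link.len_rev, straightLink_len, e1, e2, Pi.add_apply, hj1]
        push_cast
        ring
      · simp only [Pi.add_apply, z1, z2, straightLink, Link.rev]
        simp [joint, hzp.symm]
      · intro y hy
        have := g1 y hy
        have := g2 y hy
        have : joint t s' y = 0 := joint_apply_of_ne (by rw [ht]; exact hy.symm)
        simp only [Pi.add_apply, this]
        omega
      · intro y hy hyp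
        simp only [Pi.add_apply, f1 y hy hyp, f2 y hy hyp, straightLink, Link.rev]
        simp [joint, hyp.symm, ht, hy.symm]
    · refine ⟨N + N', _, w1.join w2 hts, ?_, add_le_add l1 l2, ?_, ?_, ?_, ?_⟩
      · intro L hL
        rw [Multiset.mem_add] at hL
        exact hL.elim (v1 L) (v2 L)
      · have : joint t s' z = 0 := by omega
        simp only [Multiset.map_add, Multiset.sum_add, e1, e2, Pi.add_apply, this]
        push_cast
        ring
      · simp only [Pi.add_apply, z1, z2]; omega
      · intro y hy
        have := g1 y hy
        have := g2 y hy
        simp only [Pi.add_apply]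
        omega
      · intro y hy hyp
        simp only [Pi.add_apply, f1 y hy hyp, f2 y hy hyp]

lemma ClosedWalk.reroute {V : Link d → Prop} (hV : ∀ L, V L → V L.rev) {S : Set (Pt d)} {w : ℝ}
    {z p : Pt d} (hzp : z ≠ p) (hT : ∀ b, V (straightLink z p b)) {M : Multiset (Link d)}
    {c : Pt d → ℕ} (h : ClosedWalk M c) (hM : LinkBounds V S w M) :
    ∃ M' c', ClosedWalk M' c' ∧ LinkBounds V S (w + c z * (2 * dist z p)) M' ∧ c' z = 0 ∧
      (∀ y ≠ z, c y ≤ c' y) ∧ (∀ y, y ≠ z → y ≠ p → c' y = c y) := by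
  obtain ⟨s, t, c₀, w0, hts, rfl⟩ := h
  obtain ⟨N, b, w1, v1, l1, e1, z1, g1, f1⟩ := w0.reroute hV hzp hT hM.valid
  have hvis : ∀ N', N ≤ N' → ∀ p ∈ S, ∃ L ∈ N', L.p = p ∨ L.q = p := by
    intro N' hN' p hp
    obtain ⟨L, hL, hLp⟩ := hM.visits p hp
    exact ⟨L, Multiset.mem_of_le (l1.trans hN') hL, hLp⟩
  by_cases hj : 0 < joint t s z
  · obtain ⟨ht, hne⟩ := joint_pos hj
    have hj1 : joint t s z = 1 := le_antisymm (joint_le_one _ _ _) hj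
    have x1 := w1.join (Walk.single (straightLink z p t.2)) ht
    have x2 := x1.join (Walk.single (straightLink z p s.2).rev) rfl
    refine ⟨_, _, ⟨_, _, _, x2, show (z, s.2).1 = s.1 by rw [← hts, ht], rfl⟩, ⟨?_, ?_, ?_⟩,
      ?_, ?_, ?_⟩
    · intro L hL
      simp only [Multiset.mem_add, Multiset.mem_singleton] at hL
      rcases hL with (hL | rfl) | rfl
      · exact v1 L hL
      · exact hT _
      · exact hV _ (hT _)
    · apply hvis
      rw [add_assoc]
      exact Multiset.le_add_right _ _
    · simp only [Multiset.map_add, Multiset.sum_add, Multiset.map_singleton,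
        Multiset.sum_singleton, Link.len_rev, straightLink_len, e1, Pi.add_apply, hj1]
      push_cast
      linarith [hM.weight]
    · simp only [Pi.add_apply, z1, straightLink, Link.rev]
      simp [joint, hzp.symm]
    · intro y hy
      have := g1 y hy
      have : joint t s y = 0 := joint_apply_of_ne (by rw [ht]; exact hy.symm)
      simp only [Pi.add_apply, this]
      omega
    · intro y hy hyp
      simp only [Pi.add_apply, f1 y hy hyp, straightLink, Link.rev]
      simp [joint, hyp.symm, ht, hy.symm]
  · have hj0 : joint t s z = 0 := by omega
    refine ⟨N, _, ⟨s, t, _, w1, hts, rfl⟩, ⟨v1, hvis N le_rfl, ?_⟩, ?_, ?_, ?_⟩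
    · simp only [e1, Pi.add_apply, hj0]
      push_cast
      linarith [hM.weight]
    · simp only [Pi.add_apply, z1, hj0]
    · intro y hy
      have := g1 y hy
      simp only [Pi.add_apply]
      omega
    · intro y hy hyp
      simp only [Pi.add_apply, f1 y hy hyp]

lemma ClosedWalk.exists_forall_le_two {V : Link d → Prop} (hV : ∀ L, V L → V L.rev)
    {S : Set (Pt d)} {w : ℝ} (Y : Finset (Pt d)) {M : Multiset (Link d)} {c : Pt d → ℕ}
    (h : ClosedWalk M c) (hM : LinkBounds V S w M) :
    ∃ M' c', ClosedWalk M' c' ∧ LinkBounds V S w M' ∧ (∀ y ∈ Y, c' y ≤ 2) ∧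
      ∀ z, (0 < c' z ↔ 0 < c z) := by
  classical
  induction Y using Finset.induction_on with
  | empty => exact ⟨M, c, h, hM, by simp, fun _ => Iff.rfl⟩
  | insert y Y hy ih =>
    obtain ⟨M₁, c₁, h1, hM1, e1, f1⟩ := ih
    obtain ⟨M₂, c₂, h2, hM2, e2, f2, g2⟩ := h1.exists_le_two hV y hM1
    refine ⟨M₂, c₂, h2, hM2, fun z hz => ?_, fun z => ?_⟩
    · by_cases hzy : z = y
      · rw [hzy]; exact e2
      · rw [g2 z hzy]
        exact e1 z ((Finset.mem_insert.1 hz).resolve_left hzy)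
    · by_cases hzy : z = y
      · rw [hzy, f2, f1]
      · rw [g2 z hzy, f1]

/-- **Patching.** The crossings of a closed walk at the nodes in `Z` are moved along the edges of
the forest `par` into `Y`: nodes are processed by decreasing rank, and each time the crossings at a
node are first reduced to at most two, so that each edge is used at most four times. -/
theorem ClosedWalk.patch {V : Link d → Prop} (hV : ∀ L, V L → V L.rev) {S : Set (Pt d)}
    {ρ : Type*} [LinearOrder ρ] (rk : Pt d → ρ) (par : Pt d → Pt d) (Y : Finset (Pt d))
    (Z : Finset (Pt d)) (hne : ∀ z ∈ Z, z ≠ par z)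
    (hpar : ∀ z ∈ Z, par z ∈ Y ∨ (par z ∈ Z ∧ rk (par z) < rk z))
    (hT : ∀ z ∈ Z, ∀ b, V (straightLink z (par z) b))
    {w : ℝ} {M : Multiset (Link d)} {c : Pt d → ℕ} (h : ClosedWalk M c) (hM : LinkBounds V S w M)
    (hc : ∀ y, 0 < c y → y ∈ Z ∨ y ∈ Y) :
    ∃ M' c', ClosedWalk M' c' ∧ LinkBounds V S (w + ∑ z ∈ Z, 4 * dist z (par z)) M' ∧
      (∀ y, 0 < c' y → y ∈ Y) ∧ (∀ y, c' y ≤ 2) ∧ ∀ y ∉ Z, 0 < c y → 0 < c' y := by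
  classical
  induction hk : Z.card generalizing Z w M c with
  | zero =>
    rw [Finset.card_eq_zero] at hk
    subst hk
    obtain ⟨M', c', h', hM', e, f⟩ := h.exists_forall_le_two hV Y hM
    refine ⟨M', c', h', by simpa using hM', fun y hy => ?_, fun y => ?_, fun y _ hy => (f y).2 hy⟩
    · simpa using hc y ((f y).1 hy)
    · rcases Nat.eq_zero_or_pos (c' y) with h0 | h0
      · omega
      · exact e y (by simpa using hc y ((f y).1 h0))
  | succ k ih =>
    obtain ⟨z, hz, hmax⟩ := Z.exists_max_image rk (Finset.card_pos.1 (by omega))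
    obtain ⟨M₁, c₁, h1, hM1, e1, f1, g1⟩ := h.exists_le_two hV z hM
    obtain ⟨M₂, c₂, h2, hM2, e2, f2, g2⟩ := h1.reroute hV (hne z hz) (hT z hz) hM1
    have hM2' : LinkBounds V S (w + 4 * dist z (par z)) M₂ := by
      refine ⟨hM2.valid, hM2.visits, hM2.weight.trans ?_⟩
      have : (c₁ z : ℝ) ≤ 2 := by exact_mod_cast e1
      nlinarith [dist_nonneg (x := z) (y := par z)]
    have hpar' : ∀ z' ∈ Z.erase z, par z' ∈ Y ∨
        (par z' ∈ Z.erase z ∧ rk (par z') < rk z') := by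
      intro z' hz'
      rcases hpar z' (Finset.mem_of_mem_erase hz') with h | ⟨h, h'⟩
      · exact Or.inl h
      · refine Or.inr ⟨Finset.mem_erase.2 ⟨?_, h⟩, h'⟩
        intro heq
        rw [heq] at h'
        exact absurd (hmax z' (Finset.mem_of_mem_erase hz')) (not_le.2 h')
    have hc2 : ∀ y, 0 < c₂ y → y ∈ Z.erase z ∨ y ∈ Y := by
      intro y hy
      have hyz : y ≠ z := by rintro rfl; omega
      by_cases hyp : y = par z
      · rcases hpar z hz with h | ⟨h, -⟩
        · exact Or.inr (hyp ▸ h)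
        · exact Or.inl (Finset.mem_erase.2 ⟨hyz, hyp ▸ h⟩)
      · rw [g2 y hyz hyp, g1 y hyz] at hy
        rcases hc y hy with h | h
        · exact Or.inl (Finset.mem_erase.2 ⟨hyz, h⟩)
        · exact Or.inr h
    obtain ⟨M', c', h', hM', a1, a2, a3⟩ := ih (Z.erase z)
      (fun z' hz' => hne z' (Finset.mem_of_mem_erase hz')) hpar'
      (fun z' hz' => hT z' (Finset.mem_of_mem_erase hz')) h2 hM2' hc2
      (by rw [Finset.card_erase_of_mem hz, hk]; rfl)
    refine ⟨M', c', h', ?_, a1, a2, fun y hy hcy => ?_⟩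
    · rw [← Finset.add_sum_erase Z _ hz, ← add_assoc]
      exact hM'
    · have hyz : y ≠ z := by rintro rfl; exact hy hz
      apply a3 y (fun h => hy (Finset.mem_of_mem_erase h))
      have := f2 y hyz
      rw [g1 y hyz] at this
      omega

/-- The links of a closed walk, listed in order. -/
lemma Walk.exists_list {M : Multiset (Link d)} {s t : Port d} {c : Pt d → ℕ} (h : Walk M s t c) :
    ∃ (K : ℕ) (f : ℕ → Link d), M = (Multiset.range (K + 1)).map f ∧ ((f 0).p, (f 0).bp) = s ∧
      ((f K).q, (f K).bq) = t ∧ (∀ i < K, (f i).q = (f (i + 1)).p) ∧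
      c = ∑ i ∈ Finset.range K, joint ((f i).q, (f i).bq) ((f (i + 1)).p, (f (i + 1)).bp) := by
  induction h with
  | single L => exact ⟨0, fun _ => L, by simp, rfl, rfl, by simp, by simp⟩
  | @join M M' s t s' t' c c' h h' hts ih ih' =>
    obtain ⟨K, f, e1, e2, e3, e4, e5⟩ := ih
    obtain ⟨K', f', e1', e2', e3', e4', e5'⟩ := ih'
    set F : ℕ → Link d := fun i => if i < K + 1 then f i else f' (i - (K + 1)) with hF
    have hF1 : ∀ i, i < K + 1 → F i = f i := fun i hi => by simp only [hF, if_pos hi]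
    have hF2 : ∀ i, F (K + 1 + i) = f' i := fun i => by
      simp only [hF, if_neg (show ¬ K + 1 + i < K + 1 by omega), Nat.add_sub_cancel_left]
    refine ⟨K + 1 + K', F, ?_, ?_, ?_, ?_, ?_⟩
    · rw [e1, e1', add_assoc (K + 1) K' 1, Multiset.range_add (K + 1), Multiset.map_add,
        Multiset.map_map]
      congr 1
      · apply Multiset.map_congr rfl
        intro i hi
        exact (hF1 i (Multiset.mem_range.1 hi)).symm
      · apply Multiset.map_congr rfl
        intro i _
        exact (hF2 i).symm
    · rw [hF1 0 (by omega)]; exact e2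
    · rw [hF2]; exact e3'
    · intro i hi
      rcases lt_trichotomy i K with h | h | h
      · rw [hF1 i (by omega), hF1 (i + 1) (by omega)]
        exact e4 i h
      · subst h
        rw [hF1 i (by omega), hF2 0]
        have a1 : (f i).q = t.1 := by rw [← e3]
        have a2 : (f' 0).p = s'.1 := by rw [← e2']
        rw [a1, a2, hts]
      · obtain ⟨m, rfl⟩ : ∃ m, i = K + 1 + m := ⟨i - (K + 1), by omega⟩
        rw [hF2, add_assoc (K + 1), hF2]
        exact e4' m (by omega)
    · rw [Finset.sum_range_add, Finset.sum_range_succ, e5, e5']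
      have b1 : joint t s' = joint ((F K).q, (F K).bq) ((F (K + 1)).p, (F (K + 1)).bp) := by
        rw [hF1 K (by omega), hF2 0, e3, e2']
      rw [b1, add_right_comm]
      congr 1
      · congr 1
        apply Finset.sum_congr rfl
        intro i hi
        rw [Finset.mem_range] at hi
        rw [hF1 i (by omega), hF1 (i + 1) (by omega)]
      · apply Finset.sum_congr rfl
        intro i _
        rw [hF2, add_assoc (K + 1), hF2]

/-- The links of a closed walk, listed in cyclic order. -/
lemma ClosedWalk.exists_cyclic {M : Multiset (Link d)} {c : Pt d → ℕ} (h : ClosedWalk M c) :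
    ∃ (K : ℕ) (f : ℤ → Link d), 0 < K ∧ (∀ i, f (i + K) = f i) ∧
      M = (Multiset.range K).map (fun i : ℕ => f i) ∧
      (∀ i, (f i).q = (f (i + 1)).p) ∧
      c = ∑ i ∈ Finset.range K, joint ((f i).q, (f i).bq) ((f (i + 1)).p, (f (i + 1)).bp) := by
  obtain ⟨s, t, c₀, w, hts, rfl⟩ := h
  obtain ⟨K, f, e1, e2, e3, e4, e5⟩ := w.exists_list
  set F : ℤ → Link d := fun i => f (i % ((K + 1 : ℕ) : ℤ)).toNat with hF
  have hF1 : ∀ i : ℕ, i < K + 1 → F i = f i := by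
    intro i hi
    simp only [hF]
    rw [Int.emod_eq_of_lt (by omega) (by omega), Int.toNat_natCast]
  have hF2 : ∀ i : ℕ, i < K → F ((i : ℤ) + 1) = f (i + 1) := by
    intro i hi
    have := hF1 (i + 1) (by omega)
    push_cast at this
    exact this
  have hF3 : F ((K : ℤ) + 1) = f 0 := by
    simp only [hF]
    push_cast
    rw [Int.emod_self]; rfl
  have hper : ∀ i, F (i + (K + 1 : ℕ)) = F i := by
    intro i
    simp only [hF, Int.add_emod_right]
  refine ⟨K + 1, F, by omega, hper, ?_, ?_, ?_⟩
  · rw [e1]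
    apply Multiset.map_congr rfl
    intro i hi
    exact (hF1 i (Multiset.mem_range.1 hi)).symm
  · have key : ∀ i : ℕ, i < K + 1 → (F i).q = (F ((i : ℤ) + 1)).p := by
      intro i hi
      rw [hF1 i hi]
      rcases Nat.lt_or_ge i K with h | h
      · rw [hF2 i h]; exact e4 i h
      · obtain rfl : i = K := by omega
        rw [hF3]
        have a1 : (f i).q = t.1 := by rw [← e3]
        have a2 : (f 0).p = s.1 := by rw [← e2]
        rw [a1, a2, hts]
    intro i
    have hn : (0 : ℤ) < (K + 1 : ℕ) := by omega
    have h0 := Int.emod_nonneg i hn.ne'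
    have h1 := Int.emod_lt_of_pos i hn
    have h2 := key (i % ((K + 1 : ℕ) : ℤ)).toNat (by omega)
    rw [Int.toNat_of_nonneg h0] at h2
    have a1 : F (i % ((K + 1 : ℕ) : ℤ)) = F i := by simp only [hF, Int.emod_emod]
    have a2 : F (i % ((K + 1 : ℕ) : ℤ) + 1) = F (i + 1) := by
      simp only [hF, Int.emod_add_emod]
    rwa [a1, a2] at h2
  · rw [Finset.sum_range_succ, hF1 K (by omega), hF3, e3, e2, e5]
    congr 1
    apply Finset.sum_congr rfl
    intro i hi
    rw [Finset.mem_range] at hi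
    rw [hF1 i (by omega), hF2 i hi]

end

/-! ### Maximal faces of the dissection -/

/-- The exponent of the side length of the maximal faces in a hyperplane of the dissection that has
the integral distance `o` from the lower boundary of the root cube, which has side `2 ^ (N + 1)`. -/
def lev (N : ℕ) (o : ℤ) : ℕ := Nat.findGreatest (fun e => (2 : ℤ) ^ e ∣ o) (N + 1)

lemma lev_le (N : ℕ) (o : ℤ) : lev N o ≤ N + 1 := Nat.findGreatest_le _

lemma two_pow_lev_dvd (N : ℕ) (o : ℤ) : (2 : ℤ) ^ lev N o ∣ o :=
  Nat.findGreatest_spec (P := fun e => (2 : ℤ) ^ e ∣ o) (Nat.zero_le _) (by simp)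

lemma le_lev {N e : ℕ} {o : ℤ} (he : e ≤ N + 1) (h : (2 : ℤ) ^ e ∣ o) : e ≤ lev N o :=
  Nat.le_findGreatest he h

section

variable {d : ℕ}

/-- The coordinates relative to the lower corner of the root cube of the dissection. -/
noncomputable def sh (a : Fin d → ℕ) (x : Pt d) (k : Fin d) : ℝ := x k + a k - 1 / 2

/-- The point `x` lies in the relative interior of the maximal face orthogonal to the direction `j`
with the position `ν`. The dissection is continued periodically to the whole space, so that the
position is not restricted to the root cube. -/
def InFace (N : ℕ) (a : Fin d → ℕ) (j : Fin d) (ν : Fin d → ℤ) (x : Pt d) : Prop :=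
  sh a x j = ν j ∧ ∀ k, k ≠ j → (ν k : ℝ) * 2 ^ lev N (ν j) < sh a x k ∧
    sh a x k < (ν k + 1) * 2 ^ lev N (ν j)

variable {N : ℕ} {a : Fin d → ℕ}

lemma not_mul_two_pow {e E : ℕ} (heE : e ≤ E) {n z : ℤ} {y : ℝ} (h1 : (n : ℝ) * 2 ^ e < y)
    (h2 : y < (n + 1) * 2 ^ e) : y ≠ z * 2 ^ E := by
  rintro rfl
  obtain ⟨m, rfl⟩ := Nat.exists_eq_add_of_le heE
  rw [pow_add, mul_comm ((2 : ℝ) ^ e), ← mul_assoc] at h1 h2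
  have hp : (0 : ℝ) < 2 ^ e := by positivity
  have h3 : (n : ℝ) < z * 2 ^ m := lt_of_mul_lt_mul_right h1 hp.le
  have h4 : (z : ℝ) * 2 ^ m < n + 1 := lt_of_mul_lt_mul_right h2 hp.le
  have h3' : n < z * 2 ^ m := by exact_mod_cast h3
  have h4' : z * 2 ^ m < n + 1 := by exact_mod_cast h4
  omega

/-- A point is in the relative interior of at most one maximal face: the larger one of two
perpendicular faces contains boundary of the smaller one where they meet. -/
lemma InFace.axis_unique {j j' : Fin d} {ν ν' : Fin d → ℤ} {x : Pt d} (h : InFace N a j ν x)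
    (h' : InFace N a j' ν' x) : j = j' := by
  have key : ∀ {j j' : Fin d} {ν ν' : Fin d → ℤ}, InFace N a j ν x → InFace N a j' ν' x →
      j ≠ j' → ¬ lev N (ν j) ≤ lev N (ν' j') := by
    intro j j' ν ν' h h' hne hle
    obtain ⟨z, hz⟩ := two_pow_lev_dvd N (ν' j')
    have h1 := h.2 j' hne.symm
    apply not_mul_two_pow (z := z) hle h1.1 h1.2
    rw [h'.1]
    conv_lhs => rw [hz]
    push_cast
    ring
  by_contra hne
  rcases le_total (lev N (ν j)) (lev N (ν' j')) with hle | hle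
  · exact key h h' hne hle
  · exact key h' h (Ne.symm hne) hle

lemma eq_of_mem_Ioo_mul {p y : ℝ} (hp : 0 < p) {n n' : ℤ} (h1 : (n : ℝ) * p < y)
    (h2 : y < (n + 1) * p) (h3 : (n' : ℝ) * p < y) (h4 : y < (n' + 1) * p) : n = n' := by
  have h5 : (n : ℝ) < n' + 1 := lt_of_mul_lt_mul_right (h1.trans h4) hp.le
  have h6 : (n' : ℝ) < n + 1 := lt_of_mul_lt_mul_right (h3.trans h2) hp.le
  have h5 : n < n' + 1 := by exact_mod_cast h5
  have h6 : n' < n + 1 := by exact_mod_cast h6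
  omega

lemma InFace.index_unique {j : Fin d} {ν ν' : Fin d → ℤ} {x : Pt d} (h : InFace N a j ν x)
    (h' : InFace N a j ν' x) : ν = ν' := by
  have hj : ν j = ν' j := by
    have := h.1.symm.trans h'.1
    exact_mod_cast this
  funext k
  by_cases hk : k = j
  · rw [hk, hj]
  · have h1 := h.2 k hk
    have h2 := h'.2 k hk
    rw [← hj] at h2
    exact eq_of_mem_Ioo_mul (by positivity) h1.1 h1.2 h2.1 h2.2

lemma InFace.convex {j : Fin d} {ν : Fin d → ℤ} {p q z : Pt d} (hp : InFace N a j ν p)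
    (hq : InFace N a j ν q) {μ : ℝ} (h0 : 0 ≤ μ) (h1 : μ ≤ 1)
    (hz : ∀ k, z k = (1 - μ) * p k + μ * q k) : InFace N a j ν z := by
  have hs : ∀ k, sh a z k = (1 - μ) * sh a p k + μ * sh a q k := by
    intro k; simp only [sh, hz]; ring
  refine ⟨by rw [hs, hp.1, hq.1]; ring, fun k hk => ?_⟩
  have h2 := hp.2 k hk
  have h3 := hq.2 k hk
  rw [hs]
  rcases h0.eq_or_lt with h | h
  · subst h; simpa using h2
  · constructor <;> nlinarith

lemma InFace.apply_axis {j : Fin d} {ν : Fin d → ℤ} {x : Pt d} (h : InFace N a j ν x) :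
    x j = ((ν j - a j : ℤ) : ℝ) + 1 / 2 := by
  have := h.1
  simp only [sh] at this
  push_cast
  linarith

/-! ### Facets of cells as parts of maximal faces -/

lemma IsCell.exists_index {C : Cube d} (h : IsCell (2 ^ N) a C) :
    ∃ e ≤ N + 1, C.side = 2 ^ e ∧ ∃ n : Fin d → ℤ, ∀ k, C.lo k + a k - 1 / 2 = n k * 2 ^ e ∧
      0 ≤ n k ∧ (n k + 1) * 2 ^ e ≤ 2 ^ (N + 1) := by
  induction h with
  | root =>
    refine ⟨N + 1, le_rfl, by push_cast; ring, 0, fun k => ⟨?_, le_rfl, by simp⟩⟩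
    simp
  | child C upper hC hside ih =>
    obtain ⟨e, he, hs, n, hn⟩ := ih
    obtain ⟨m, rfl⟩ : ∃ m, e = m + 1 := by
      refine ⟨e - 1, ?_⟩
      rcases Nat.eq_zero_or_pos e with h | h
      · rw [hs, h] at hside; norm_num at hside
      · omega
    refine ⟨m, by omega, by simp only [hs]; ring, fun k => 2 * n k + if upper k then 1 else 0,
      fun k => ?_⟩
    obtain ⟨h1, h2, h3⟩ := hn k
    have hp : (0 : ℤ) < 2 ^ m := by positivity
    simp only [hs]
    rw [pow_succ] at h1 h3
    by_cases hu : upper k = true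
    · rw [if_pos hu, if_pos hu]
      refine ⟨?_, by omega, by nlinarith⟩
      push_cast
      rw [pow_succ]
      linarith
    · rw [if_neg hu, if_neg hu]
      refine ⟨?_, by omega, by nlinarith⟩
      push_cast
      linarith

lemma isCell_of_index (m : ℕ) (hm : m ≤ N + 1) (n : Fin d → ℤ) (h0 : ∀ k, 0 ≤ n k)
    (h1 : ∀ k, n k < 2 ^ m) :
    IsCell (2 ^ N) a ⟨fun k => -(a k : ℝ) + 1 / 2 + n k * 2 ^ (N + 1 - m), 2 ^ (N + 1 - m)⟩ := by
  induction m generalizing n with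
  | zero =>
    have hn : n = 0 := by
      funext k
      have := h0 k
      have := h1 k
      simp only [pow_zero] at this
      simp only [Pi.zero_apply]
      omega
    have := IsCell.root (L := 2 ^ N) (a := a)
    convert this using 2
    · simp [hn]
    · push_cast; rw [pow_succ]; ring
  | succ m ih =>
    have hpar := ih (by omega) (fun k => n k / 2) (fun k => by have := h0 k; omega)
      (fun k => by have := h1 k; rw [pow_succ] at this; omega)
    have hside : (1 : ℝ) < 2 ^ (N + 1 - m) := one_lt_pow₀ (by norm_num) (by omega)
    have := IsCell.child _ (fun k => decide (n k % 2 = 1)) hpar hside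
    have hpow : (2 : ℝ) ^ (N + 1 - m) = 2 ^ (N + 1 - (m + 1)) * 2 := by
      rw [← pow_succ]; congr 1; omega
    convert this using 2
    · funext k
      simp only [decide_eq_true_eq]
      rw [hpow]
      have h2 : n k = 2 * (n k / 2) + n k % 2 := (Int.mul_ediv_add_emod (n k) 2).symm
      have h3 : (n k : ℝ) = 2 * (n k / 2 : ℤ) + (n k % 2 : ℤ) := by exact_mod_cast h2
      split_ifs with h
      · rw [h3, h]; push_cast; ring
      · have : n k % 2 = 0 := by omega
        rw [h3, this]; push_cast; ring
    · simp only; rw [hpow]; ring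

lemma IsCellFacet.exists_index {F : Facet d} (h : IsCellFacet (2 ^ N) a F) :
    ∃ e ≤ N + 1, F.side = 2 ^ e ∧ ∃ n : Fin d → ℤ, (2 : ℤ) ^ e ∣ n F.axis ∧
      F.lo F.axis + a F.axis - 1 / 2 = n F.axis ∧ 0 ≤ n F.axis ∧ n F.axis ≤ 2 ^ (N + 1) ∧
      ∀ k ≠ F.axis, F.lo k + a k - 1 / 2 = n k * 2 ^ e ∧
      0 ≤ n k ∧ (n k + 1) * 2 ^ e ≤ 2 ^ (N + 1) := by
  obtain ⟨C, j, b, hC, rfl⟩ := h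
  obtain ⟨e, he, hs, n, hn⟩ := hC.exists_index
  have hp : (0 : ℤ) < 2 ^ e := by positivity
  refine ⟨e, he, hs, Function.update n j ((n j + if b then 1 else 0) * 2 ^ e), ?_, ?_, ?_, ?_, ?_⟩
  · simp only [Cube.facet, Function.update_self]
    exact Dvd.intro_left _ rfl
  · simp only [Cube.facet, Function.update_self]
    have := (hn j).1
    split_ifs with hb
    · push_cast; rw [hs]; linarith
    · push_cast; linarith
  · simp only [Cube.facet, Function.update_self]
    have := (hn j).2.1
    apply mul_nonneg _ hp.le
    split_ifs <;> omega
  · simp only [Cube.facet, Function.update_self]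
    have := (hn j).2.2
    split_ifs
    · exact this
    · nlinarith
  · intro k hk
    simp only [Cube.facet] at hk ⊢
    rw [Function.update_of_ne hk, Function.update_of_ne hk]
    exact hn k

/-- The position of the maximal face containing a given face of a cell. -/
def faceIndex (N e : ℕ) (j : Fin d) (n : Fin d → ℤ) : Fin d → ℤ :=
  fun k => if k = j then n j else n k / 2 ^ (lev N (n j) - e)

lemma inFace_faceIndex {e : ℕ} {j : Fin d} {n : Fin d → ℤ} (he : e ≤ N + 1)
    (hd : (2 : ℤ) ^ e ∣ n j) {x : Pt d} (hx : sh a x j = n j)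
    (hx' : ∀ k ≠ j, (n k : ℝ) * 2 ^ e < sh a x k ∧ sh a x k < (n k + 1) * 2 ^ e) :
    InFace N a j (faceIndex N e j n) x := by
  have hj : faceIndex N e j n j = n j := by simp [faceIndex]
  refine ⟨by rw [hj, hx], fun k hk => ?_⟩
  have hk' : faceIndex N e j n k = n k / 2 ^ (lev N (n j) - e) := by simp [faceIndex, hk]
  obtain ⟨h1, h2⟩ := hx' k hk
  obtain ⟨m, hm⟩ := Nat.exists_eq_add_of_le (le_lev he hd)
  rw [hj, hk', hm, Nat.add_sub_cancel_left, pow_add]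
  have hp : (0 : ℝ) < 2 ^ e := by positivity
  have hm0 : (0 : ℤ) < 2 ^ m := by positivity
  have h3 : n k / 2 ^ m * 2 ^ m ≤ n k := Int.ediv_mul_le _ hm0.ne'
  have h4 : n k + 1 ≤ (n k / 2 ^ m + 1) * 2 ^ m := Int.lt_ediv_add_one_mul_self _ hm0
  have h3' : ((n k / 2 ^ m : ℤ) : ℝ) * 2 ^ m ≤ n k := by exact_mod_cast h3
  have h4' : (n k : ℝ) + 1 ≤ ((n k / 2 ^ m : ℤ) + 1) * 2 ^ m := by exact_mod_cast h4
  constructor <;> nlinarith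

lemma sh_eq_of_lo {F : Facet d} {x : Pt d} {k : Fin d} {r : ℝ}
    (h : F.lo k + a k - 1 / 2 = r) : sh a x k = x k - F.lo k + r := by
  rw [← h, sh]; ring

lemma mem_relInt_iff {F : Facet d} {e : ℕ} {n : Fin d → ℤ} (hs : F.side = 2 ^ e)
    (h0 : F.lo F.axis + a F.axis - 1 / 2 = n F.axis)
    (hn : ∀ k ≠ F.axis, F.lo k + a k - 1 / 2 = n k * 2 ^ e) (x : Pt d) :
    x ∈ F.relInt ↔ sh a x F.axis = n F.axis ∧
      ∀ k ≠ F.axis, (n k : ℝ) * 2 ^ e < sh a x k ∧ sh a x k < (n k + 1) * 2 ^ e := by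
  simp only [Facet.relInt, Set.mem_ofPred_eq, mem_Ioo]
  constructor
  · rintro ⟨h1, h2⟩
    refine ⟨by rw [sh_eq_of_lo h0, h1]; ring, fun k hk => ?_⟩
    have := h2 k hk
    rw [sh_eq_of_lo (hn k hk)]
    rw [hs] at this
    constructor <;> linarith [this.1, this.2]
  · rintro ⟨h1, h2⟩
    refine ⟨by rw [sh_eq_of_lo h0] at h1; linarith, fun k hk => ?_⟩
    have := h2 k hk
    rw [sh_eq_of_lo (hn k hk)] at this
    rw [hs]
    constructor <;> linarith [this.1, this.2]

/-- A maximal face in the sense of the dissection is one of the faces described by `InFace`. -/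
lemma IsMaximalFacet.exists_index (hd : 2 ≤ d) {F : Facet d} (h : IsMaximalFacet (2 ^ N) a F) :
    ∃ ν : Fin d → ℤ, F.lo F.axis + a F.axis - 1 / 2 = ν F.axis ∧
      ∀ x, x ∈ F.relInt ↔ InFace N a F.axis ν x := by
  obtain ⟨e, he, hs, n, hdvd, h0, hn0, hn1, hn⟩ := h.1.exists_index
  set j := F.axis with hj
  set E := lev N (n j) with hE
  have hle : e ≤ E := le_lev he hdvd
  have hEN : E ≤ N + 1 := lev_le _ _
  obtain ⟨m, hm⟩ := Nat.exists_eq_add_of_le hle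
  obtain ⟨M, hM⟩ := Nat.exists_eq_add_of_le hEN
  obtain ⟨q, hq⟩ := two_pow_lev_dvd N (n j)
  rw [← hE] at hq
  have hpE : (0 : ℤ) < 2 ^ E := by positivity
  have hpe : (0 : ℤ) < 2 ^ e := by positivity
  have hpm : (0 : ℤ) < 2 ^ m := by positivity
  have hsplit : (2 : ℤ) ^ (N + 1) = 2 ^ E * 2 ^ M := by rw [hM, pow_add]
  have hsplit' : (2 : ℤ) ^ E = 2 ^ e * 2 ^ m := by rw [hm, pow_add]
  have hq0 : 0 ≤ q := by
    by_contra! hq0; nlinarith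
  have hq1 : q ≤ 2 ^ M := by
    rw [hq, hsplit] at hn1
    exact le_of_mul_le_mul_left hn1 hpE
  -- the face of side `2 ^ E` containing `F`, as the lower or the upper face of a cell
  set top : Bool := decide (q = 2 ^ M) with htop
  set c : Fin d → ℤ := fun k => if k = j then (if top then q - 1 else q) else n k / 2 ^ m with hc
  have hM0 : (0 : ℤ) < 2 ^ M := by positivity
  have hcell := isCell_of_index (N := N) (a := a) M (by omega) c (by
      intro k
      simp only [hc]
      split_ifs with h1 h2
      · simp only [htop, decide_eq_true_eq] at h2; omega
      · exact hq0
      · exact Int.ediv_nonneg (hn k h1).2.1 hpm.le) (by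
      intro k
      simp only [hc]
      split_ifs with h1 h2
      · omega
      · simp only [htop, decide_eq_true_eq] at h2; omega
      · rw [Int.ediv_lt_iff_lt_mul hpm]
        have := (hn k h1).2.2
        rw [hsplit, hsplit'] at this
        have h5 : (n k + 1) * 2 ^ e ≤ (2 ^ M * 2 ^ m) * 2 ^ e := by linarith
        have := le_of_mul_le_mul_right h5 hpe
        omega)
  rw [show N + 1 - M = E by omega] at hcell
  set G : Facet d := Cube.facet _ j top with hG
  have hGf : IsCellFacet (2 ^ N) a G := ⟨_, j, top, hcell, rfl⟩
  have hGs : G.side = 2 ^ E := rfl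
  have hGj : G.axis = j := rfl
  have hG0 : G.lo j = F.lo j := by
    simp only [hG, Cube.facet, Function.update_self, hc, if_true]
    have hqr : (n j : ℝ) = 2 ^ E * q := by exact_mod_cast hq
    split_ifs with ht
    · push_cast; linarith
    · linarith
  have hGk : ∀ k ≠ j, G.lo k = -(a k : ℝ) + 1 / 2 + (n k / 2 ^ m : ℤ) * 2 ^ E := by
    intro k hk
    simp only [hG, Cube.facet, Function.update_of_ne hk, hc, if_neg hk]
  have hsub : F.carrier ⊆ G.carrier := by
    rintro x ⟨hx1, hx2⟩
    refine ⟨by rw [hGj, hG0]; exact hx1, fun k hk => ?_⟩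
    rw [hGj] at hk
    have hx := hx2 k hk
    have hnk := (hn k hk).1
    have h3 : n k / 2 ^ m * 2 ^ m ≤ n k := Int.ediv_mul_le _ hpm.ne'
    have h4 : n k + 1 ≤ (n k / 2 ^ m + 1) * 2 ^ m := Int.lt_ediv_add_one_mul_self _ hpm
    have h3' : ((n k / 2 ^ m : ℤ) : ℝ) * 2 ^ m ≤ n k := by exact_mod_cast h3
    have h4' : (n k : ℝ) + 1 ≤ ((n k / 2 ^ m : ℤ) + 1) * 2 ^ m := by exact_mod_cast h4
    have hpe' : (0 : ℝ) < 2 ^ e := by positivity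
    rw [hGk k hk, hGs, hm, pow_add]
    rw [hs] at hx
    constructor
    · nlinarith [hx.1]
    · nlinarith [hx.2]
  have hcar := h.2 G hGf hsub
  obtain ⟨k, hk⟩ : ∃ k : Fin d, k ≠ j := by
    have : Nontrivial (Fin d) := Fin.nontrivial_iff_two_le.2 hd
    exact exists_ne j
  have hEpos : (0 : ℝ) < 2 ^ E := by positivity
  have hlow : (WithLp.toLp 2 G.lo : Pt d) ∈ F.carrier := by
    rw [← hcar]
    refine ⟨rfl, fun k _ => ⟨le_rfl, ?_⟩⟩
    rw [hGs]
    change G.lo k ≤ G.lo k + _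
    linarith
  have hhigh : (WithLp.toLp 2 (Function.update G.lo k (G.lo k + 2 ^ E)) : Pt d) ∈ F.carrier := by
    rw [← hcar]
    refine ⟨?_, fun k' _ => ?_⟩
    · rw [hGj]
      change Function.update G.lo k (G.lo k + 2 ^ E) j = G.lo j
      rw [Function.update_of_ne hk.symm]
    · change Function.update G.lo k (G.lo k + 2 ^ E) k' ∈ _
      rw [hGs]
      by_cases hkk : k' = k
      · subst hkk
        rw [Function.update_self]
        exact ⟨by linarith, le_rfl⟩
      · rw [Function.update_of_ne hkk]
        exact ⟨le_rfl, by linarith⟩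
  -- `F` has the same point set as the face of side `2 ^ E`, hence the same side
  have h5 := (hlow.2 k hk).1
  have h6 := (hhigh.2 k hk).2
  change F.lo k ≤ G.lo k at h5
  change Function.update G.lo k (G.lo k + 2 ^ E) k ≤ _ at h6
  rw [Function.update_self, hs] at h6
  have h7 : (2 : ℝ) ^ E ≤ 2 ^ e := by linarith
  have h8 : E ≤ e := (pow_le_pow_iff_right₀ (by norm_num)).1 h7
  have h9 : E = e := le_antisymm h8 hle
  refine ⟨n, h0, fun x => ?_⟩
  rw [mem_relInt_iff hs h0 (fun k hk => (hn k hk).1), InFace, ← hE, h9]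

end

/-! ### The closed path drawn along a closed walk -/

section

variable {d : ℕ}

/-- The sign of a side: `true` is the side of larger coordinates. -/
noncomputable def sg (b : Bool) : ℝ := if b then 1 else -1

lemma sg_ne_zero (b : Bool) : sg b ≠ 0 := by cases b <;> simp [sg]

lemma abs_sg (b : Bool) : |sg b| = 1 := by cases b <;> simp [sg]

lemma sg_mul_self (b : Bool) : sg b * sg b = 1 := by cases b <;> simp [sg]

lemma sg_of_ne {b b' : Bool} (h : b ≠ b') : sg b' = -sg b := by
  revert h
  cases b <;> cases b' <;> simp [sg]

/-- The end of the short spike at the node `x` on the side `b`. It is not axis-parallel, so that it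
is off every hyperplane through `x` at once. -/
noncomputable def spike (ε : ℝ) (x : Pt d) (b : Bool) : Pt d := WithLp.toLp 2 fun k => x k + sg b * ε

@[simp] lemma spike_apply (ε : ℝ) (x : Pt d) (b : Bool) (k : Fin d) :
    spike ε x b k = x k + sg b * ε := rfl

lemma dist_spike_le {ε : ℝ} (hε : 0 ≤ ε) (x : Pt d) (b : Bool) :
    dist (spike ε x b) x ≤ √d * ε := by
  rw [EuclideanSpace.dist_eq]
  have : ∀ k, dist (spike ε x b k) (x k) ^ 2 = ε ^ 2 := by
    intro k
    rw [Real.dist_eq, sq_abs, spike_apply]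
    have := sg_mul_self b
    ring_nf
    rw [pow_two, this, one_mul]
  simp only [this, Finset.sum_const, Finset.card_univ, Fintype.card_fin, nsmul_eq_mul]
  rw [Real.sqrt_mul (by positivity), Real.sqrt_sq hε]

/-- The closed path along the links `f 0, …, f (K - 1)`, with a spike before and after each link.
A change of sides at a node is thus made along a straight segment through the node. -/
noncomputable def linkPath (f : ℤ → Link d) (K : ℕ) (hK : 0 < K) (hper : ∀ i, f (i + K) = f i)
    (ε : ℝ) : ClosedPath d where
  n := 5 * K
  n_pos := by omega
  vertex v :=
    if v % 5 = 0 then spike ε (f (v / 5)).p (f (v / 5)).bp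
    else if v % 5 = 1 then (f (v / 5)).p
    else if v % 5 = 2 then (f (v / 5)).m
    else if v % 5 = 3 then (f (v / 5)).q
    else spike ε (f (v / 5)).q (f (v / 5)).bq
  periodic v := by
    have h1 : (v + (5 * K : ℕ)) / 5 = v / 5 + K := by omega
    have h2 : (v + (5 * K : ℕ)) % 5 = v % 5 := by omega
    rw [h1, h2, hper]

/-- The links of the walk are of two kinds: links inside a cell, whose sides at the nodes are those
of the cell, and links inside a maximal face. -/
def LinkValid (N : ℕ) (a : Fin d → ℕ) (L : Link d) : Prop :=
  (∃ κ : Fin d → ℤ, (∀ k, |L.m k - κ k| < 1 / 2) ∧ (∀ k, |L.p k - κ k| ≤ 1 / 2) ∧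
    (∀ k, |L.q k - κ k| ≤ 1 / 2) ∧ (∀ j ν, InFace N a j ν L.p → (L.bp = true ↔ L.p j < κ j)) ∧
    (∀ j ν, InFace N a j ν L.q → (L.bq = true ↔ L.q j < κ j))) ∨
  (∃ j ν, InFace N a j ν L.p ∧ InFace N a j ν L.m ∧ InFace N a j ν L.q ∧ L.bp = L.bq)

lemma LinkValid.rev {N : ℕ} {a : Fin d → ℕ} {L : Link d} (h : LinkValid N a L) :
    LinkValid N a L.rev := by
  rcases h with ⟨κ, h1, h2, h3, h4, h5⟩ | ⟨j, ν, h1, h2, h3, h4⟩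
  · exact Or.inl ⟨κ, h1, h3, h2, h5, h4⟩
  · exact Or.inr ⟨j, ν, h3, h2, h1, h4.symm⟩

/-- Within distance `ε`, the coordinates of `x` pass no half-integers. -/
def SpikeFree (ε : ℝ) (x : Pt d) : Prop :=
  ∀ k, ∀ z : ℤ, |x k - (z + 1 / 2)| ≤ ε → x k = z + 1 / 2

lemma exists_spikeFree (x : Pt d) : ∃ ε > 0, ∀ ε' ≤ ε, SpikeFree ε' x := by
  have h1 : ∀ y : ℝ, ∃ ε > 0, ∀ z : ℤ, |y - (z + 1 / 2)| ≤ ε → y = z + 1 / 2 := by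
    intro y
    rcases (Int.fract_nonneg (y - 1 / 2)).eq_or_lt with h | h
    · refine ⟨1 / 2, by norm_num, fun z hz => ?_⟩
      have h2 : y - 1 / 2 = ⌊y - 1 / 2⌋ := by
        have := Int.floor_add_fract (y - 1 / 2); rw [← h] at this; linarith
      rw [abs_le] at hz
      have h3 : (⌊y - 1 / 2⌋ : ℝ) < z + 1 := by linarith
      have h4 : (z : ℝ) < ⌊y - 1 / 2⌋ + 1 := by linarith
      have h3 : ⌊y - 1 / 2⌋ < z + 1 := by exact_mod_cast h3
      have h4 : z < ⌊y - 1 / 2⌋ + 1 := by exact_mod_cast h4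
      have h5 : z = ⌊y - 1 / 2⌋ := by omega
      rw [h5]; linarith
    · have h5 := Int.fract_lt_one (y - 1 / 2)
      have h6 := Int.floor_add_fract (y - 1 / 2)
      refine ⟨min (Int.fract (y - 1 / 2)) (1 - Int.fract (y - 1 / 2)) / 2, ?_, fun z hz => ?_⟩
      · have : 0 < min (Int.fract (y - 1 / 2)) (1 - Int.fract (y - 1 / 2)) :=
          lt_min h (by linarith)
        linarith
      · exfalso
        have e1 := min_le_left (Int.fract (y - 1 / 2)) (1 - Int.fract (y - 1 / 2))
        have e2 := min_le_right (Int.fract (y - 1 / 2)) (1 - Int.fract (y - 1 / 2))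
        rw [abs_le] at hz
        have h3 : (⌊y - 1 / 2⌋ : ℝ) < z := by linarith
        have h4 : (z : ℝ) < ⌊y - 1 / 2⌋ + 1 := by linarith
        have h3 : ⌊y - 1 / 2⌋ < z := by exact_mod_cast h3
        have h4 : z < ⌊y - 1 / 2⌋ + 1 := by exact_mod_cast h4
        omega
  choose ε hε hε' using fun k => h1 (x k)
  rcases isEmpty_or_nonempty (Fin d) with he | he
  · exact ⟨1, one_pos, fun _ _ k => he.elim k⟩
  · obtain ⟨k₀, -, hk₀⟩ := Finset.exists_min_image Finset.univ ε Finset.univ_nonempty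
    exact ⟨ε k₀, hε k₀, fun ε' he' k z hz =>
      hε' k z (hz.trans (he'.trans (hk₀ k (Finset.mem_univ _))))⟩

/-- If a path stays in the hyperplane during `[α, β]` and is on the same side before and after, then
no crossing of the hyperplane meets `[α, β]`. -/
lemma not_crossing_of_same_side {γ : ClosedPath d} {j : Fin d} {c s t α β u σ : ℝ}
    (h : γ.IsCrossing j c s t) (hu : u ∈ Icc s t) (hu' : u ∈ Icc α β)
    (hαβ : ∀ v ∈ Icc α β, γ.pos v j = c) (hα : ∀ᶠ v in 𝓝[<] α, 0 < σ * (γ.pos v j - c))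
    (hβ : ∀ᶠ v in 𝓝[>] β, 0 < σ * (γ.pos v j - c)) : False := by
  obtain ⟨-, -, -, heq, hcr⟩ := h
  have hne : ∀ v, 0 < σ * (γ.pos v j - c) → γ.pos v j ≠ c := by
    intro v hv hvc
    rw [hvc, sub_self, mul_zero] at hv
    exact lt_irrefl _ hv
  obtain ⟨rfl, rfl⟩ := level_interval_unique (f := fun v => γ.pos v j) heq
    (by rcases hcr with h | h
        · exact h.1.mono fun v hv => hv.ne
        · exact h.1.mono fun v hv => hv.ne')
    (by rcases hcr with h | h
        · exact h.2.mono fun v hv => hv.ne'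
        · exact h.2.mono fun v hv => hv.ne)
    hαβ (hα.mono hne) (hβ.mono hne) hu hu'
  rcases hcr with ⟨h1, h2⟩ | ⟨h1, h2⟩ <;>
  · obtain ⟨v, hv1, hv2⟩ := (h1.and hα).exists
    obtain ⟨w, hw1, hw2⟩ := (h2.and hβ).exists
    rcases lt_trichotomy σ 0 with hσ | hσ | hσ
    · nlinarith
    · rw [hσ] at hv2; simp at hv2
    · nlinarith

section

variable {f : ℤ → Link d} {K : ℕ} {hK : 0 < K} {hper : ∀ i, f (i + K) = f i} {ε : ℝ}

lemma linkPath_vertex (i : ℤ) :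
    (linkPath f K hK hper ε).vertex (5 * i) = spike ε (f i).p (f i).bp ∧
    (linkPath f K hK hper ε).vertex (5 * i + 1) = (f i).p ∧
    (linkPath f K hK hper ε).vertex (5 * i + 2) = (f i).m ∧
    (linkPath f K hK hper ε).vertex (5 * i + 3) = (f i).q ∧
    (linkPath f K hK hper ε).vertex (5 * i + 4) = spike ε (f i).q (f i).bq := by
  have h0 : (5 * i) / 5 = i := by omega
  have h1 : (5 * i + 1) / 5 = i := by omega
  have h2 : (5 * i + 2) / 5 = i := by omega
  have h3 : (5 * i + 3) / 5 = i := by omega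
  have h4 : (5 * i + 4) / 5 = i := by omega
  have g0 : (5 * i) % 5 = 0 := by omega
  have g1 : (5 * i + 1) % 5 = 1 := by omega
  have g2 : (5 * i + 2) % 5 = 2 := by omega
  have g3 : (5 * i + 3) % 5 = 3 := by omega
  have g4 : (5 * i + 4) % 5 = 4 := by omega
  simp only [linkPath]
  refine ⟨?_, ?_, ?_, ?_, ?_⟩
  · rw [h0, g0]; simp
  · rw [h1, g1]; simp
  · rw [h2, g2]; simp
  · rw [h3, g3]; simp
  · rw [h4, g4]; simp

lemma linkPath_pos (i : ℤ) (j : Fin d) {l : ℝ} (hl : l ∈ Icc (0 : ℝ) 1) :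
    (linkPath f K hK hper ε).pos (5 * i + l) j = (f i).p j + (1 - l) * (sg (f i).bp * ε) ∧
    (linkPath f K hK hper ε).pos (5 * i + 1 + l) j = (1 - l) * (f i).p j + l * (f i).m j ∧
    (linkPath f K hK hper ε).pos (5 * i + 2 + l) j = (1 - l) * (f i).m j + l * (f i).q j ∧
    (linkPath f K hK hper ε).pos (5 * i + 3 + l) j = (f i).q j + l * (sg (f i).bq * ε) ∧
    ((f i).q = (f (i + 1)).p → (linkPath f K hK hper ε).pos (5 * i + 4 + l) j =
      (f i).q j + ((1 - l) * sg (f i).bq + l * sg (f (i + 1)).bp) * ε) := by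
  obtain ⟨v0, v1, v2, v3, v4⟩ := linkPath_vertex (hK := hK) (hper := hper) (ε := ε) i
  have v5 := (linkPath_vertex (hK := hK) (hper := hper) (ε := ε) (i + 1)).1
  have key := fun k : ℤ => (linkPath f K hK hper ε).pos_intCast_add_apply k hl j
  have k0 := key (5 * i)
  have k1 := key (5 * i + 1)
  have k2 := key (5 * i + 2)
  have k3 := key (5 * i + 3)
  have k4 := key (5 * i + 4)
  rw [v0, v1] at k0
  rw [v1, show 5 * i + 1 + 1 = 5 * i + 2 by ring, v2] at k1
  rw [v2, show 5 * i + 2 + 1 = 5 * i + 3 by ring, v3] at k2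
  rw [v3, show 5 * i + 3 + 1 = 5 * i + 4 by ring, v4] at k3
  rw [v4, show 5 * i + 4 + 1 = 5 * (i + 1) by ring, v5] at k4
  push_cast at k0 k1 k2 k3 k4
  refine ⟨?_, k1, k2, ?_, fun h => ?_⟩
  · rw [k0, spike_apply]; ring
  · rw [k3, spike_apply]; ring
  · rw [k4, spike_apply, spike_apply, h]; ring

lemma eventually_right_of_affine {γ : ClosedPath d} {j : Fin d} {t c v σ : ℝ}
    (h : ∀ l ∈ Icc (0 : ℝ) 1, γ.pos (t + l) j = c + l * v) (hv : 0 < σ * v) :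
    ∀ᶠ u in 𝓝[>] t, 0 < σ * (γ.pos u j - c) := by
  filter_upwards [Ioo_mem_nhdsGT (show t < t + 1 by linarith)] with u hu
  have := h (u - t) ⟨by linarith [hu.1], by linarith [hu.2]⟩
  rw [add_sub_cancel] at this
  rw [this, show σ * (c + (u - t) * v - c) = (u - t) * (σ * v) by ring]
  exact mul_pos (by linarith [hu.1]) hv

lemma eventually_left_of_affine {γ : ClosedPath d} {j : Fin d} {t c v σ : ℝ}
    (h : ∀ l ∈ Icc (0 : ℝ) 1, γ.pos (t - 1 + l) j = c + (1 - l) * v) (hv : 0 < σ * v) :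
    ∀ᶠ u in 𝓝[<] t, 0 < σ * (γ.pos u j - c) := by
  filter_upwards [Ioo_mem_nhdsLT (show t - 1 < t by linarith)] with u hu
  have := h (u - t + 1) ⟨by linarith [hu.1], by linarith [hu.2]⟩
  rw [show t - 1 + (u - t + 1) = u by ring] at this
  rw [this, show σ * (c + (1 - (u - t + 1)) * v - c) = (t - u) * (σ * v) by ring]
  exact mul_pos (by linarith [hu.2]) hv

/-- The change of sides at a node is a crossing of each hyperplane through the node. -/
lemma linkPath_isCrossing (hε : 0 < ε) (j : Fin d) {i : ℤ} (hi0 : 0 ≤ i) (hiK : i < K)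
    (hq : (f i).q = (f (i + 1)).p) (hne : (f i).bq ≠ (f (i + 1)).bp) :
    (linkPath f K hK hper ε).IsCrossing j ((f i).q j) (5 * i + 4 + 1 / 2) (5 * i + 4 + 1 / 2) ∧
      (linkPath f K hK hper ε).pos (5 * i + 4 + 1 / 2) = (f i).q := by
  have hpos : ∀ k, ∀ l ∈ Icc (0 : ℝ) 1, (linkPath f K hK hper ε).pos (5 * i + 4 + l) k =
      (f i).q k + (1 - 2 * l) * (sg (f i).bq * ε) := by
    intro k l hl
    rw [(linkPath_pos i k hl).2.2.2.2 hq, sg_of_ne hne]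
    ring
  have hmid : (linkPath f K hK hper ε).pos (5 * i + 4 + 1 / 2) = (f i).q := by
    ext k
    rw [hpos k _ ⟨by norm_num, by norm_num⟩]
    ring
  have hi0' : (0 : ℝ) ≤ i := by exact_mod_cast hi0
  have hiK' : (i : ℝ) + 1 ≤ K := by exact_mod_cast hiK
  have hr : ∀ᶠ u in 𝓝[>] (5 * (i : ℝ) + 4 + 1 / 2), (linkPath f K hK hper ε).pos u j =
      (f i).q j + 2 * (5 * i + 4 + 1 / 2 - u) * (sg (f i).bq * ε) := by
    filter_upwards [Ioo_mem_nhdsGT (show 5 * (i : ℝ) + 4 + 1 / 2 < 5 * i + 5 by linarith)]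
      with u hu
    have := hpos j (u - (5 * i + 4)) ⟨by linarith [hu.1], by linarith [hu.2]⟩
    rw [add_sub_cancel] at this
    rw [this]; ring
  have hl : ∀ᶠ u in 𝓝[<] (5 * (i : ℝ) + 4 + 1 / 2), (linkPath f K hK hper ε).pos u j =
      (f i).q j + 2 * (5 * i + 4 + 1 / 2 - u) * (sg (f i).bq * ε) := by
    filter_upwards [Ioo_mem_nhdsLT (show 5 * (i : ℝ) + 4 < 5 * i + 4 + 1 / 2 by linarith)]
      with u hu
    have := hpos j (u - (5 * i + 4)) ⟨by linarith [hu.1], by linarith [hu.2]⟩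
    rw [add_sub_cancel] at this
    rw [this]; ring
  refine ⟨⟨by linarith, ?_, le_rfl, fun u hu => ?_, ?_⟩, hmid⟩
  · simp only [linkPath]; push_cast; linarith
  · rw [le_antisymm hu.2 hu.1, hmid]
  · cases hb : (f i).bq
    · left
      rw [hb] at hr hl
      constructor
      · filter_upwards [hl, self_mem_nhdsWithin] with u hu hu'
        rw [hu]
        simp only [sg, mem_Iio] at hu' ⊢
        norm_num
        nlinarith
      · filter_upwards [hr, self_mem_nhdsWithin] with u hu hu'
        rw [hu]
        simp only [sg, mem_Ioi] at hu' ⊢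
        norm_num
        nlinarith
    · right
      rw [hb] at hr hl
      constructor
      · filter_upwards [hl, self_mem_nhdsWithin] with u hu hu'
        rw [hu]
        simp only [sg, mem_Iio] at hu' ⊢
        norm_num
        nlinarith
      · filter_upwards [hr, self_mem_nhdsWithin] with u hu hu'
        rw [hu]
        simp only [sg, mem_Ioi] at hu' ⊢
        norm_num
        nlinarith

lemma not_halfInteger_of_abs_lt {y : ℝ} {κ z : ℤ} (h : |y - κ| < 1 / 2) : y ≠ z + 1 / 2 := by
  rintro rfl
  rw [abs_lt] at h
  have h4 : (z : ℝ) < κ := by linarith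
  have h5 : (κ : ℝ) < z + 1 := by linarith
  have h4 : z < κ := by exact_mod_cast h4
  have h5 : κ < z + 1 := by exact_mod_cast h5
  omega

lemma abs_combo_lt {p m κ l : ℝ} (hp : |p - κ| ≤ 1 / 2) (hm : |m - κ| < 1 / 2) (h0 : 0 < l)
    (h1 : l ≤ 1) : |(1 - l) * p + l * m - κ| < 1 / 2 := by
  rw [abs_le] at hp
  rw [abs_lt] at hm ⊢
  constructor <;> nlinarith

/-- The only crossings of the path through relative interiors of maximal faces are the changes of
sides at nodes. -/
lemma linkPath_crossing {N : ℕ} {a : Fin d → ℕ} (hε : 0 < ε) (hq : ∀ i, (f i).q = (f (i + 1)).p)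
    (hval : ∀ i, LinkValid N a (f i)) (hfree : ∀ i, SpikeFree ε (f i).p) {j : Fin d} {c s t u : ℝ}
    (hcr : (linkPath f K hK hper ε).IsCrossing j c s t) (hu : u ∈ Icc s t) {ν : Fin d → ℤ}
    (hface : InFace N a j ν ((linkPath f K hK hper ε).pos u)) :
    ∃ i : ℤ, 0 ≤ i ∧ i < K ∧ s = 5 * i + 4 + 1 / 2 ∧ t = 5 * i + 4 + 1 / 2 ∧
      (f i).q = (linkPath f K hK hper ε).pos u ∧ (f i).bq ≠ (f (i + 1)).bp := by
  set γ := linkPath f K hK hper ε with hγ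
  have hfree' : ∀ i, SpikeFree ε (f i).q := fun i => by rw [hq i]; exact hfree (i + 1)
  obtain ⟨z, hz⟩ : ∃ z : ℤ, γ.pos u j = z + 1 / 2 := ⟨_, hface.apply_axis⟩
  have hcz : c = z + 1 / 2 := by rw [← hz]; exact (hcr.2.2.2.1 u hu).symm
  have hP := fun (i : ℤ) {l : ℝ} (hl : l ∈ Icc (0 : ℝ) 1) =>
    fun k => linkPath_pos (hK := hK) (hper := hper) (ε := ε) i k hl
  rw [← hγ] at hP
  obtain ⟨i, r, l, hr0, hr5, hl0, hl1, hul⟩ : ∃ (i r : ℤ) (l : ℝ), 0 ≤ r ∧ r < 5 ∧ 0 ≤ l ∧ l < 1 ∧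
      u = 5 * i + r + l := by
    refine ⟨⌊u⌋ / 5, ⌊u⌋ % 5, Int.fract u, by omega, by omega, Int.fract_nonneg u,
      Int.fract_lt_one u, ?_⟩
    have h1 := Int.floor_add_fract u
    have h2 : (⌊u⌋ : ℝ) = 5 * (⌊u⌋ / 5 : ℤ) + (⌊u⌋ % 5 : ℤ) := by
      exact_mod_cast (Int.mul_ediv_add_emod ⌊u⌋ 5).symm
    linarith
  have hl : l ∈ Icc (0 : ℝ) 1 := ⟨hl0, hl1.le⟩
  have hm0 : (0 : ℝ) ∈ Icc (0 : ℝ) 1 := ⟨le_rfl, zero_le_one⟩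
  have hm1 : (1 : ℝ) ∈ Icc (0 : ℝ) 1 := ⟨zero_le_one, le_rfl⟩
  -- at a half-integer coordinate of a node, a spike leaves the hyperplane at once
  have hspike : ∀ {x : Pt d} {μ : ℝ}, SpikeFree ε x → |μ| ≤ 1 → x j + μ * ε = z + 1 / 2 →
      x j = z + 1 / 2 ∧ μ = 0 := by
    intro x μ hx hμ hxz
    have h1 : x j = z + 1 / 2 := by
      apply hx
      rw [← hxz, show x j - (x j + μ * ε) = -(μ * ε) by ring, abs_neg, abs_mul, abs_of_pos hε]
      nlinarith
    refine ⟨h1, ?_⟩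
    have : μ * ε = 0 := by linarith
    exact (mul_eq_zero.1 this).resolve_right hε.ne'
  have hbefore : ∀ i, (f i).p j = c → ∀ᶠ v in 𝓝[<] (5 * (i : ℝ) + 1),
      0 < sg (f i).bp * (γ.pos v j - c) := by
    intro i hpc
    apply eventually_left_of_affine (v := sg (f i).bp * ε)
    · intro l hl
      rw [show 5 * (i : ℝ) + 1 - 1 + l = 5 * i + l by ring, (hP i hl j).1, hpc]
    · rw [← mul_assoc, sg_mul_self, one_mul]; exact hε
  have hafter : ∀ i, (f i).q j = c → ∀ᶠ v in 𝓝[>] (5 * (i : ℝ) + 3),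
      0 < sg (f i).bq * (γ.pos v j - c) := by
    intro i hqc
    apply eventually_right_of_affine (v := sg (f i).bq * ε)
    · intro l hl
      rw [(hP i hl j).2.2.2.1, hqc]
    · rw [← mul_assoc, sg_mul_self, one_mul]; exact hε
  -- a cell link ends on the side of its cell
  have hside : ∀ {x m : Pt d} {κ : Fin d → ℤ} {b : Bool}, x j = c → |x j - κ j| ≤ 1 / 2 →
      |m j - κ j| < 1 / 2 → (b = true ↔ x j < κ j) → 0 < sg b * (m j - c) := by
    intro x m κ b hxc hx hm hb
    have h1 : ((κ j : ℝ) = c + 1 / 2 ∧ b = true) ∨ ((κ j : ℝ) = c - 1 / 2 ∧ b = false) := by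
      rw [hxc, hcz, abs_le] at hx
      have h4 : (κ j : ℝ) ≤ z + 1 := by linarith
      have h5 : (z : ℝ) ≤ κ j := by linarith
      have h4 : κ j ≤ z + 1 := by exact_mod_cast h4
      have h5 : z ≤ κ j := by exact_mod_cast h5
      rcases (show κ j = z + 1 ∨ κ j = z by omega) with h | h
      · left
        have h6 : (κ j : ℝ) = c + 1 / 2 := by rw [h, hcz]; push_cast; ring
        exact ⟨h6, hb.2 (by rw [h6, hxc]; linarith)⟩
      · right
        have h6 : (κ j : ℝ) = c - 1 / 2 := by rw [h, hcz]; ring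
        refine ⟨h6, ?_⟩
        rw [Bool.eq_false_iff]
        intro hbt
        have := hb.1 hbt
        linarith
    rw [abs_lt] at hm
    rcases h1 with ⟨h1, rfl⟩ | ⟨h1, rfl⟩
    · simp only [sg, if_true]; linarith
    · simp only [sg]; norm_num; linarith
  have hface' : ∀ {x : Pt d}, γ.pos u = x → InFace N a j ν x := by rintro x rfl; exact hface
  -- while the path is in a link inside a face, or at the end of a link, there is no crossing
  have htree : u ∈ Icc (5 * (i : ℝ) + 1) (5 * i + 3) → ∀ j' ν', InFace N a j' ν' (f i).p →
      InFace N a j' ν' (f i).m → InFace N a j' ν' (f i).q → (f i).bp = (f i).bq →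
      InFace N a j' ν' (γ.pos u) → False := by
    intro hui j' ν' h1 h2 h3 h4 h5
    obtain rfl := hface.axis_unique h5
    obtain rfl := hface.index_unique h5
    have hc : ∀ {x : Pt d}, InFace N a j ν x → x j = c := by
      intro x hx
      rw [hcz, ← hz, hx.apply_axis, hface.apply_axis]
    refine not_crossing_of_same_side hcr hu hui ?_ (hbefore i (hc h1)) ?_
    · intro v hv
      rcases le_total v (5 * i + 2) with h | h
      · have := (hP i (l := v - (5 * i + 1)) ⟨by linarith [hv.1], by linarith⟩ j).2.1
        rw [add_sub_cancel] at this
        rw [this, hc h1, hc h2]; ring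
      · have := (hP i (l := v - (5 * i + 2)) ⟨by linarith, by linarith [hv.2]⟩ j).2.2.1
        rw [add_sub_cancel] at this
        rw [this, hc h2, hc h3]; ring
    · rw [h4]; exact hafter i (hc h3)
  have hatp : u = 5 * i + 1 → False := by
    intro hu1
    have hpos : γ.pos u = (f i).p := by
      ext k
      have := (hP i hm0 k).2.1
      rw [add_zero] at this
      rw [hu1, this]; ring
    rcases hval i with ⟨κ, h1, h2, h3, h4, h5⟩ | ⟨j', ν', h1, h2, h3, h4⟩
    · have hpc : (f i).p j = c := by rw [← hpos, hz, hcz]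
      refine not_crossing_of_same_side hcr hu (show u ∈ Icc u u from ⟨le_rfl, le_rfl⟩) ?_
        (by rw [hu1]; exact hbefore i hpc) ?_
      · intro v hv
        rw [le_antisymm hv.2 hv.1, hpos, hpc]
      · rw [hu1]
        apply eventually_right_of_affine (v := (f i).m j - c)
        · intro l hl
          rw [(hP i hl j).2.1, hpc]; ring
        · exact hside hpc (h2 j) (h1 j) (h4 j ν (hface' hpos))
    · exact htree ⟨by linarith, by linarith⟩ j' ν' h1 h2 h3 h4 (by rw [hpos]; exact h1)
  have hatq : u = 5 * i + 3 → False := by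
    intro hu1
    have hpos : γ.pos u = (f i).q := by
      ext k
      have := (hP i hm0 k).2.2.2.1
      rw [add_zero] at this
      rw [hu1, this]; ring
    rcases hval i with ⟨κ, h1, h2, h3, h4, h5⟩ | ⟨j', ν', h1, h2, h3, h4⟩
    · have hqc : (f i).q j = c := by rw [← hpos, hz, hcz]
      refine not_crossing_of_same_side hcr hu (show u ∈ Icc u u from ⟨le_rfl, le_rfl⟩) ?_ ?_
        (by rw [hu1]; exact hafter i hqc)
      · intro v hv
        rw [le_antisymm hv.2 hv.1, hpos, hqc]
      · rw [hu1]
        apply eventually_left_of_affine (v := (f i).m j - c)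
        · intro l hl
          rw [show 5 * (i : ℝ) + 3 - 1 + l = 5 * i + 2 + l by ring, (hP i hl j).2.2.1, hqc]; ring
        · exact hside hqc (h3 j) (h1 j) (h5 j ν (hface' hpos))
    · exact htree ⟨by linarith, by linarith⟩ j' ν' h1 h2 h3 h4 (by rw [hpos]; exact h3)
  -- the five edges of a link: spike, first half, second half, spike, and the passage to the next link
  have hr : r = 0 ∨ r = 1 ∨ r = 2 ∨ r = 3 ∨ r = 4 := by omega
  rcases hr with rfl | rfl | rfl | rfl | rfl
  · exfalso
    push_cast at hul
    rw [add_zero] at hul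
    rw [hul, (hP i hl j).1, ← mul_assoc] at hz
    have := (hspike (hfree i) (by
      rw [abs_mul, abs_sg, mul_one, abs_of_nonneg] <;> linarith) hz).2
    rcases mul_eq_zero.1 this with h | h
    · linarith
    · exact sg_ne_zero _ h
  · exfalso
    push_cast at hul
    rcases hl0.eq_or_lt with h | h
    · exact hatp (by rw [hul, ← h]; ring)
    · rcases hval i with ⟨κ, h1, h2, h3, h4, h5⟩ | ⟨j', ν', h1, h2, h3, h4⟩
      · rw [hul, (hP i hl j).2.1] at hz
        exact not_halfInteger_of_abs_lt (abs_combo_lt (h2 j) (h1 j) h hl1.le) hz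
      · exact htree ⟨by linarith, by linarith⟩ j' ν' h1 h2 h3 h4
          (h1.convex h2 hl0 hl1.le fun k => by rw [hul, (hP i hl k).2.1])
  · exfalso
    push_cast at hul
    rcases hval i with ⟨κ, h1, h2, h3, h4, h5⟩ | ⟨j', ν', h1, h2, h3, h4⟩
    · rw [hul, (hP i hl j).2.2.1] at hz
      have := abs_combo_lt (l := 1 - l) (h3 j) (h1 j) (by linarith) (by linarith)
      rw [show (1 - (1 - l)) * (f i).q j + (1 - l) * (f i).m j =
        (1 - l) * (f i).m j + l * (f i).q j by ring] at this
      exact not_halfInteger_of_abs_lt this hz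
    · exact htree ⟨by linarith, by linarith⟩ j' ν' h1 h2 h3 h4
        (h2.convex h3 hl0 hl1.le fun k => by rw [hul, (hP i hl k).2.2.1])
  · exfalso
    push_cast at hul
    rcases hl0.eq_or_lt with h | h
    · exact hatq (by rw [hul, ← h]; ring)
    · rw [hul, (hP i hl j).2.2.2.1, ← mul_assoc] at hz
      have := (hspike (hfree' i) (by
        rw [abs_mul, abs_sg, mul_one, abs_of_nonneg] <;> linarith) hz).2
      rcases mul_eq_zero.1 this with h' | h'
      · linarith
      · exact sg_ne_zero _ h'
  · push_cast at hul
    rw [hul, (hP i hl j).2.2.2.2 (hq i)] at hz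
    obtain ⟨h1, h2⟩ := hspike (hfree' i) (by
      have e1 := abs_add_le ((1 - l) * sg (f i).bq) (l * sg (f (i + 1)).bp)
      rw [abs_mul, abs_mul, abs_sg, abs_sg, abs_of_nonneg hl0,
        abs_of_nonneg (show 0 ≤ 1 - l by linarith)] at e1
      linarith) hz
    have hne : (f i).bq ≠ (f (i + 1)).bp := by
      intro hb
      rw [hb] at h2
      apply sg_ne_zero (f (i + 1)).bp
      linarith
    have hl2 : l = 1 / 2 := by
      rw [sg_of_ne hne] at h2
      have h3 : (1 - 2 * l) * sg (f i).bq = 0 := by linarith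
      rcases mul_eq_zero.1 h3 with h | h
      · linarith
      · exact absurd h (sg_ne_zero _)
    rw [hl2] at hul
    have hpos : (f i).q = γ.pos u := by
      ext k
      rw [hul, (hP i ⟨by norm_num, by norm_num⟩ k).2.2.2.2 (hq i), sg_of_ne hne]
      ring
    have hpu : γ.pos u j = c := hcr.2.2.2.1 u hu
    obtain ⟨hs0, hsn, -, heq, hcr'⟩ := hcr
    have hne0 : ∀ l ∈ Icc (0 : ℝ) 1, l ≠ 1 / 2 → γ.pos (5 * i + 4 + l) j ≠ c := by
      intro l hl hl2 hc
      rw [(hP i hl j).2.2.2.2 (hq i), sg_of_ne hne, hpos, hpu] at hc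
      have h3 : (1 - 2 * l) * (sg (f i).bq * ε) = 0 := by linarith
      rcases mul_eq_zero.1 h3 with h | h
      · exact hl2 (by linarith)
      · exact mul_ne_zero (sg_ne_zero _) hε.ne' h
    obtain ⟨hsu, htu⟩ := level_interval_unique (f := fun v => γ.pos v j) heq
      (by rcases hcr' with h | h
          · exact h.1.mono fun v hv => hv.ne
          · exact h.1.mono fun v hv => hv.ne')
      (by rcases hcr' with h | h
          · exact h.2.mono fun v hv => hv.ne'
          · exact h.2.mono fun v hv => hv.ne)
      (α := u) (β := u) (fun v hv => by rw [le_antisymm hv.2 hv.1]; exact hpu)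
      (by
        filter_upwards [Ioo_mem_nhdsLT (show u - 1 / 2 < u by linarith)] with v hv
        have := hne0 (v - (5 * i + 4)) ⟨by linarith [hv.1], by linarith [hv.2]⟩
          (by intro h; linarith [hv.2])
        rwa [add_sub_cancel] at this)
      (by
        filter_upwards [Ioo_mem_nhdsGT (show u < u + 1 / 2 by linarith)] with v hv
        have := hne0 (v - (5 * i + 4)) ⟨by linarith [hv.1], by linarith [hv.2]⟩
          (by intro h; linarith [hv.1])
        rwa [add_sub_cancel] at this)
      hu ⟨le_rfl, le_rfl⟩
    have hsn' : s < 5 * K := by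
      have h3 : (γ.n : ℝ) = 5 * K := by simp [hγ, linkPath]
      rwa [h3] at hsn
    refine ⟨i, ?_, ?_, by rw [hsu, hul], by rw [htu, hul], hpos, hne⟩
    · have h3 : (-1 : ℝ) < i := by linarith
      have h3 : (-1 : ℤ) < i := by exact_mod_cast h3
      omega
    · have h3 : (i : ℝ) < K := by linarith
      exact_mod_cast h3

end

end

section

variable {d : ℕ}

lemma linkPath_wt_le {f : ℤ → Link d} {K : ℕ} {hK : 0 < K} {hper : ∀ i, f (i + K) = f i} {ε : ℝ}
    (hε : 0 ≤ ε) (hq : ∀ i, (f i).q = (f (i + 1)).p) :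
    (linkPath f K hK hper ε).wt ≤ ∑ i ∈ Finset.range K, (f i).len + 4 * √d * ε * K := by
  have hn : (linkPath f K hK hper ε).n = K * 5 := by simp only [linkPath]; ring
  rw [ClosedPath.wt, hn, sum_range_mul_eq]
  have : ∀ i ∈ Finset.range K, ∑ e ∈ Finset.range 5,
      dist ((linkPath f K hK hper ε).vertex ((i * 5 + e : ℕ) : ℤ))
        ((linkPath f K hK hper ε).vertex (((i * 5 + e : ℕ) : ℤ) + 1)) ≤
      (f i).len + 4 * √d * ε := by
    intro i _
    obtain ⟨v0, v1, v2, v3, v4⟩ := linkPath_vertex (hK := hK) (hper := hper) (ε := ε) i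
    have v5 := (linkPath_vertex (hK := hK) (hper := hper) (ε := ε) (i + 1)).1
    have hc : ∀ e : ℕ, ((i * 5 + e : ℕ) : ℤ) = 5 * i + e := by intro e; push_cast; ring
    simp only [hc, Finset.sum_range_succ, Finset.sum_range_zero]
    push_cast
    simp only [add_assoc, Int.add_zero]
    norm_num only
    rw [v0, v1, v2, v3, v4, show 5 * (i : ℤ) + 5 = 5 * (i + 1) by ring, v5]
    have d1 := dist_spike_le hε (f i).p (f i).bp
    have d2 := dist_spike_le hε (f i).q (f i).bq
    have d3 := dist_spike_le hε (f (i + 1)).p (f (i + 1)).bp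
    have d4 := dist_triangle (spike ε (f i).q (f i).bq) (f i).q
      (spike ε (f (i + 1)).p (f (i + 1)).bp)
    rw [← hq i] at d3 d4 ⊢
    rw [dist_comm (f i).q (spike ε (f i).q (f (i + 1)).bp)] at d4
    rw [dist_comm (f i).q (spike ε (f i).q (f i).bq), Link.len]
    linarith
  refine (Finset.sum_le_sum this).trans (le_of_eq ?_)
  rw [Finset.sum_add_distrib, Finset.sum_const, Finset.card_range, nsmul_eq_mul]
  ring

/-- Every closed walk of valid links can be drawn as a closed path, of almost the same length, whose
crossings of the faces of the dissection are the crossings of the walk. -/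
theorem exists_path_of_closedWalk {N : ℕ} {a : Fin d → ℕ} {S : Set (Pt d)} {w : ℝ}
    {M : Multiset (Link d)} {c : Pt d → ℕ} (h : ClosedWalk M c)
    (hM : LinkBounds (LinkValid N a) S w M) {η : ℝ} (hη : 0 < η) :
    ∃ γ : ClosedPath d, γ.wt ≤ w + η ∧ (∀ p ∈ S, ∃ t, γ.pos t = p) ∧
      (∀ F ν x, x ∈ γ.crossingPoints F → InFace N a F.axis ν x → 0 < c x) ∧
      (∀ F x, x ∈ F.relInt → 0 < c x → x ∈ γ.crossingPoints F) ∧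
      (∀ F ν x, InFace N a F.axis ν x → (γ.crossingsVia F x).encard ≤ c x) := by
  obtain ⟨K, f, hK, hper, rfl, hq, rfl⟩ := h.exists_cyclic
  have hmod : ∀ i : ℤ, ∃ m : ℕ, m < K ∧ f i = f m := by
    intro i
    have hK' : (0 : ℤ) < K := by exact_mod_cast hK
    have h0 := Int.emod_nonneg i hK'.ne'
    have h1 := Int.emod_lt_of_pos i hK'
    refine ⟨(i % K).toNat, by omega, ?_⟩
    rw [Int.toNat_of_nonneg h0]
    have hper' : ∀ q i : ℤ, f (i + q * K) = f i := by
      intro q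
      induction q using Int.induction_on with
      | zero => intro i; simp
      | succ q ih =>
        intro i
        rw [← ih i, ← hper (i + q * K)]
        congr 1; ring
      | pred q ih =>
        intro i
        rw [← ih i, ← hper (i + (-q - 1) * K)]
        congr 1; ring
    rw [← hper' (i / K) (i % K), Int.emod_add_ediv_mul]
  have hval : ∀ i, LinkValid N a (f i) := by
    intro i
    obtain ⟨m, hm, he⟩ := hmod i
    rw [he]
    exact hM.valid _ (Multiset.mem_map.2 ⟨m, Multiset.mem_range.2 hm, rfl⟩)
  obtain ⟨ε, hε, hεη, hfree⟩ : ∃ ε > 0, 4 * √d * ε * K ≤ η ∧ ∀ i, SpikeFree ε (f i).p := by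
    choose e he he' using fun x : Pt d => exists_spikeFree x
    obtain ⟨m₀, -, hm₀⟩ := Finset.exists_min_image (Finset.range K) (fun i => e (f i).p)
      ⟨0, Finset.mem_range.2 hK⟩
    have hB : (0 : ℝ) < 4 * √d * K + 1 := by positivity
    refine ⟨min (e (f m₀).p) (η / (4 * √d * K + 1)), lt_min (he _) (div_pos hη hB), ?_, ?_⟩
    · have h1 := min_le_right (e (f m₀).p) (η / (4 * √d * K + 1))
      have h2 : η / (4 * √d * K + 1) * (4 * √d * K + 1) = η := div_mul_cancel₀ _ hB.ne'
      have h3 : 0 < η / (4 * √d * K + 1) := div_pos hη hB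
      have h4 : 0 ≤ 4 * √d * (K : ℝ) := by positivity
      nlinarith
    · intro i
      obtain ⟨m, hm, hi⟩ := hmod i
      rw [hi]
      exact he' _ _ ((min_le_left _ _).trans (hm₀ m (Finset.mem_range.2 hm)))
  set γ := linkPath f K hK hper ε with hγ
  have happ : ∀ x, (∑ i ∈ Finset.range K, joint ((f i).q, (f i).bq)
      ((f (i + 1)).p, (f (i + 1)).bp)) x =
      ∑ i ∈ Finset.range K, joint ((f i).q, (f i).bq) ((f (i + 1)).p, (f (i + 1)).bp) x :=
    fun x => Finset.sum_apply _ _ _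
  refine ⟨γ, ?_, ?_, ?_, ?_, ?_⟩
  · refine (linkPath_wt_le hε.le hq).trans ?_
    have h1 := hM.weight
    rw [Multiset.map_map] at h1
    have h2 : ∑ i ∈ Finset.range K, (f i).len ≤ w := h1
    linarith
  · intro p hp
    obtain ⟨L, hL, hLp⟩ := hM.visits p hp
    obtain ⟨i, -, rfl⟩ := Multiset.mem_map.1 hL
    have h0 : (0 : ℝ) ∈ Icc (0 : ℝ) 1 := ⟨le_rfl, zero_le_one⟩
    rcases hLp with rfl | rfl
    · refine ⟨5 * (i : ℤ) + 1 + 0, ?_⟩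
      ext k
      rw [hγ, (linkPath_pos i k h0).2.1]; ring
    · refine ⟨5 * (i : ℤ) + 3 + 0, ?_⟩
      ext k
      rw [hγ, (linkPath_pos i k h0).2.2.2.1]; ring
  · rintro F ν x ⟨-, s, t, hcr, u, hu, rfl⟩ hface
    obtain ⟨i, h0, h1, -, -, h4, h5⟩ := linkPath_crossing hε hq hval hfree hcr hu hface
    obtain ⟨m, rfl⟩ := Int.eq_ofNat_of_zero_le h0
    rw [happ]
    apply Finset.sum_pos' (fun _ _ => Nat.zero_le _)
    refine ⟨m, Finset.mem_range.2 (by exact_mod_cast h1), ?_⟩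
    rw [← h4]
    have := joint_eq_one (t := ((f m).q, (f m).bq)) (s := ((f (m + 1)).p, (f (m + 1)).bp)) h5
    simp only at this
    omega
  · intro F x hx hc
    rw [happ] at hc
    obtain ⟨i, hi, hi'⟩ : ∃ i ∈ Finset.range K, 0 < joint ((f i).q, (f i).bq)
        ((f (i + 1)).p, (f (i + 1)).bp) x := by
      by_contra! hcon
      exact absurd (Finset.sum_nonpos hcon) (not_le.2 hc)
    obtain ⟨h1, h2⟩ := joint_pos hi'
    simp only at h1 h2
    have := linkPath_isCrossing (hK := hK) (hper := hper) hε F.axis (i := i) (by omega)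
      (by exact_mod_cast Finset.mem_range.1 hi) (hq i) h2
    rw [h1, hx.1] at this
    exact ⟨hx, _, _, this.1, _, ⟨le_rfl, le_rfl⟩, this.2⟩
  · intro F ν x hface
    set I := (Finset.range K).filter fun i : ℕ => 0 < joint ((f i).q, (f i).bq)
        ((f (i + 1)).p, (f (i + 1)).bp) x with hI
    have hsub : γ.crossingsVia F x ⊆
        (fun i : ℕ => ((5 * (i : ℝ) + 4 + 1 / 2, 5 * (i : ℝ) + 4 + 1 / 2) : ℝ × ℝ)) '' I := by
      rintro ⟨s, t⟩ ⟨hcr, u, hu, rfl⟩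
      obtain ⟨i, h0, h1, h2, h3, h4, h5⟩ := linkPath_crossing hε hq hval hfree hcr hu hface
      obtain ⟨m, rfl⟩ := Int.eq_ofNat_of_zero_le h0
      refine ⟨m, ?_, ?_⟩
      · simp only [hI, Finset.coe_filter, Finset.mem_range]
        refine ⟨by exact_mod_cast h1, ?_⟩
        rw [← h4]
        have := joint_eq_one (t := ((f m).q, (f m).bq)) (s := ((f (m + 1)).p, (f (m + 1)).bp)) h5
        simp only at this
        omega
      · refine Prod.ext ?_ ?_
        · rw [h2]; simp
        · rw [h3]; simp
    calc (γ.crossingsVia F x).encard ≤ _ := Set.encard_le_encard hsub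
      _ ≤ (I : Set ℕ).encard := Set.encard_image_le _ _
      _ = I.card := Set.encard_coe_eq_coe_finsetCard _
      _ ≤ _ := by
        rw [happ]
        norm_cast
        rw [Finset.card_eq_sum_ones]
        refine (Finset.sum_le_sum fun i hi => ?_).trans
          (Finset.sum_le_sum_of_subset (Finset.filter_subset _ _))
        exact (Finset.mem_filter.1 hi).2

/-! ### Simplicity -/

lemma encard_biUnion_le {α β : Type*} (Y : Finset α) (g : α → Set β)
    (h : ∀ y ∈ Y, (g y).encard ≤ 2) : (⋃ y ∈ Y, g y).encard ≤ (2 * Y.card : ℕ) := by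
  classical
  induction Y using Finset.induction_on with
  | empty => simp
  | insert y Y hy ih =>
    rw [Finset.set_biUnion_insert, Finset.card_insert_of_notMem hy]
    refine (Set.encard_union_le _ _).trans ?_
    have h1 := h y (Finset.mem_insert_self _ _)
    have h2 := ih fun z hz => h z (Finset.mem_insert_of_mem hz)
    refine (add_le_add h1 h2).trans (le_of_eq ?_)
    push_cast
    ring

/-- It suffices to control the crossings of the maximal faces: as the numbers of portals per
direction are powers of two, the portals of a maximal face inside the relative interior of a smaller
face are the portals of a regular grid of the smaller face, or there are none. -/
theorem isSimple_of_maximal {N r : ℕ} {a : Fin d → ℕ} (hd : 2 ≤ d) {γ : ClosedPath d}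
    {c : Pt d → ℕ} (h1 : ∀ F ν x, x ∈ γ.crossingPoints F → InFace N a F.axis ν x → 0 < c x)
    (h2 : ∀ F ν x, InFace N a F.axis ν x → (γ.crossingsVia F x).encard ≤ c x)
    (hc : ∀ x, c x ≤ 2)
    (hmax : ∀ j ν, {y | 0 < c y ∧ InFace N a j ν y}.Subsingleton ∨
      ∃ m f : ℕ, 0 < m ∧ 2 * m * (2 ^ f) ^ (d - 1) ≤ r ^ (2 * d - 2) ∧
        {y | 0 < c y ∧ InFace N a j ν y}.encard ≤ m ∧
        ∀ y, 0 < c y → InFace N a j ν y → ∀ k ≠ j, ∃ A : ℤ,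
          sh a y k * 2 ^ f = (A + 1 / 2) * 2 ^ lev N (ν j)) :
    γ.IsSimple (2 ^ N) a r := by
  classical
  intro F hF
  obtain ⟨e, he, hs, n, hdvd, h0, -, -, hn⟩ := hF.exists_index
  have hrel := mem_relInt_iff (a := a) hs h0 (fun k hk => (hn k hk).1)
  set j := F.axis with hj
  set ν := faceIndex N e j n with hν
  have hνj : ν j = n j := by simp [hν, faceIndex]
  have hin : ∀ x ∈ F.relInt, InFace N a j ν x := by
    intro x hx
    rw [hrel] at hx
    exact inFace_faceIndex he hdvd hx.1 hx.2
  have hvia : ∀ p ∈ F.relInt, (γ.crossingsVia F p).encard ≤ 2 := by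
    intro p hp
    refine (h2 F ν p (hin p hp)).trans ?_
    exact_mod_cast hc p
  refine ⟨?_, hvia⟩
  have hsub : γ.crossingPoints F ⊆ {y | 0 < c y ∧ InFace N a j ν y} := fun y hy =>
    ⟨h1 F ν y hy (hin y hy.1), hin y hy.1⟩
  rcases hmax j ν with hm | ⟨m, f, hm0, hm, hcard, hgrid⟩
  · exact Or.inl (hm.anti hsub)
  obtain ⟨D, hD⟩ := Nat.exists_eq_add_of_le (le_lev he hdvd)
  rw [hνj, hD] at hgrid
  -- `F` has the side `2 ^ e`, and the spacing of the portals is `2 ^ (e + D - f)`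
  rcases le_or_gt D f with hDf | hDf
  · obtain ⟨g, rfl⟩ := Nat.exists_eq_add_of_le hDf
    refine Or.inr ⟨2 * m, 2 ^ g, by omega, by positivity, ?_, ?_, ?_⟩
    · refine le_trans (Nat.mul_le_mul_left _ (Nat.pow_le_pow_left ?_ _)) hm
      exact Nat.pow_le_pow_right (by norm_num) (by omega)
    · have hfin : {y | 0 < c y ∧ InFace N a j ν y}.Finite :=
        Set.finite_of_encard_le_coe hcard
      set Y := hfin.toFinset.filter fun y => y ∈ γ.crossingPoints F with hY
      have hYm : Y.card ≤ m := by
        refine (Finset.card_filter_le _ _).trans ?_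
        rw [hfin.encard_eq_coe_toFinset_card] at hcard
        exact_mod_cast hcard
      have hcov : γ.crossings F ⊆ ⋃ y ∈ Y, γ.crossingsVia F y := by
        rintro ⟨s, t⟩ ⟨hcr, u, hu, hur⟩
        have hy : γ.pos u ∈ γ.crossingPoints F := ⟨hur, s, t, hcr, u, hu, rfl⟩
        simp only [Set.mem_iUnion]
        refine ⟨γ.pos u, ?_, hcr, u, hu, rfl⟩
        rw [hY, Finset.mem_filter, Set.Finite.mem_toFinset]
        exact ⟨hsub hy, hy⟩
      refine (Set.encard_le_encard hcov).trans ((encard_biUnion_le Y _ fun y hy => ?_).trans ?_)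
      · exact hvia y (Finset.mem_filter.1 hy).2.1
      · exact_mod_cast Nat.mul_le_mul_left 2 hYm
    · intro y hy
      refine ⟨hy.1.1, fun k hk => ?_⟩
      obtain ⟨A, hA⟩ := hgrid y (hsub hy).1 (hsub hy).2 k hk
      have hyk := ((hrel y).1 hy.1).2 k hk
      have hlo := (hn k hk).1
      have hp1 : (0 : ℝ) < 2 ^ e := by positivity
      have hp2 : (0 : ℝ) < 2 ^ D := by positivity
      have hp3 : (0 : ℝ) < 2 ^ g := by positivity
      have hA' : sh a y k * 2 ^ g = (A + 1 / 2) * 2 ^ e := by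
        rw [pow_add, pow_add] at hA
        have h3 : (sh a y k * 2 ^ g - (A + 1 / 2) * 2 ^ e) * 2 ^ D = 0 := by linarith
        have := (mul_eq_zero.1 h3).resolve_right hp2.ne'
        linarith
      have h4 : (n k : ℝ) * 2 ^ g < A + 1 / 2 := by
        have : (n k : ℝ) * 2 ^ e * 2 ^ g < (A + 1 / 2) * 2 ^ e := by
          rw [← hA']; exact mul_lt_mul_of_pos_right hyk.1 hp3
        nlinarith
      have h5 : (A : ℝ) + 1 / 2 < (n k + 1) * 2 ^ g := by
        have : (A + 1 / 2) * 2 ^ e < ((n k : ℝ) + 1) * 2 ^ e * 2 ^ g := by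
          rw [← hA']; exact mul_lt_mul_of_pos_right hyk.2 hp3
        nlinarith
      have h4' : n k * 2 ^ g ≤ A := by
        have : ((n k * 2 ^ g : ℤ) : ℝ) < (A + 1 : ℤ) := by push_cast; linarith
        have : n k * 2 ^ g < A + 1 := by exact_mod_cast this
        omega
      have h5' : A < (n k + 1) * 2 ^ g := by
        have : ((A : ℤ) : ℝ) < ((n k + 1) * 2 ^ g : ℤ) := by push_cast; linarith
        exact_mod_cast this
      refine ⟨(A - n k * 2 ^ g).toNat, ?_, ?_⟩
      · have : A - n k * 2 ^ g < 2 ^ g := by linarith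
        zify
        rw [Int.toNat_of_nonneg (by omega)]
        exact_mod_cast this
      · have h6 : (((A - n k * 2 ^ g).toNat : ℕ) : ℝ) = A - n k * 2 ^ g := by
          have : (((A - n k * 2 ^ g).toNat : ℕ) : ℤ) = A - n k * 2 ^ g :=
            Int.toNat_of_nonneg (by omega)
          exact_mod_cast this
        rw [h6, hs]
        have h7 := sh_eq_of_lo (x := y) hlo
        have h8 : sh a y k = (A + 1 / 2) * 2 ^ e / 2 ^ g := by
          rw [eq_div_iff hp3.ne']; exact hA'
        have h9 : y k = F.lo k + (sh a y k - n k * 2 ^ e) := by rw [h7]; ring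
        rw [h9, h8]
        push_cast
        field_simp
        ring
  · left
    obtain ⟨k, hk⟩ : ∃ k : Fin d, k ≠ j := by
      have : Nontrivial (Fin d) := Fin.nontrivial_iff_two_le.2 hd
      exact exists_ne j
    -- the coordinates of the portals are multiples of `2 ^ e`, so that none is in the interior of `F`
    have hempty : γ.crossingPoints F = ∅ := by
      rw [Set.eq_empty_iff_forall_notMem]
      intro y hy
      obtain ⟨A, hA⟩ := hgrid y (hsub hy).1 (hsub hy).2 k hk
      have hyk := ((hrel y).1 hy.1).2 k hk
      obtain ⟨g, rfl⟩ : ∃ g, D = f + g + 1 := ⟨D - f - 1, by omega⟩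
      apply not_mul_two_pow (z := 2 * A + 1) (E := e + g) (by omega) hyk.1 hyk.2
      have hp : (0 : ℝ) < 2 ^ f := by positivity
      have h3 : (sh a y k - ((2 * A + 1 : ℤ) : ℝ) * 2 ^ (e + g)) * 2 ^ f = 0 := by
        push_cast
        rw [sub_mul, hA, show e + (f + g + 1) = e + g + f + 1 by ring, pow_succ, pow_add _ (e + g)]
        ring
      have := (mul_eq_zero.1 h3).resolve_right hp.ne'
      linarith
    rw [hempty]
    exact Set.subsingleton_empty

end

/-! ### The closed walk of a discretized path -/

section

variable {d : ℕ}

/-- Two points of a closed unit cell are joined through its interior at almost no additional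
length. -/
lemma exists_interior_point {κ : Fin d → ℤ} {p q : Pt d} (hp : ∀ k, |p k - κ k| ≤ 1 / 2)
    (hq : ∀ k, |q k - κ k| ≤ 1 / 2) {η : ℝ} (hη : 0 < η) :
    ∃ m : Pt d, (∀ k, |m k - κ k| < 1 / 2) ∧ dist p m + dist m q ≤ dist p q + η := by
  set c : Pt d := WithLp.toLp 2 fun k => (κ k : ℝ) with hc
  set m : ℝ → Pt d := fun δ => (1 - δ) • midpoint ℝ p q + δ • c with hm
  have hcont : Continuous fun δ => dist p (m δ) + dist (m δ) q := by fun_prop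
  have h0 : dist p (m 0) + dist (m 0) q = dist p q := by
    simp only [hm, sub_zero, one_smul, zero_smul, add_zero]
    rw [dist_left_midpoint, dist_midpoint_right]
    norm_num
    ring
  have hev : ∀ᶠ δ in 𝓝[>] (0 : ℝ), dist p (m δ) + dist (m δ) q < dist p q + η := by
    apply (hcont.tendsto 0).mono_left nhdsWithin_le_nhds |>.eventually_lt_const
    rw [h0]; linarith
  obtain ⟨δ, h1, h2⟩ := (hev.and (Ioo_mem_nhdsGT zero_lt_one)).exists
  refine ⟨m δ, fun k => ?_, h1.le⟩
  have hmk : m δ k = (1 - δ) * ((p k + q k) / 2) + δ * κ k := by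
    simp only [hm, hc, midpoint_eq_smul_add, PiLp.add_apply, PiLp.smul_apply, smul_eq_mul,
      invOf_eq_inv]
    ring
  have e1 := hp k
  have e2 := hq k
  rw [abs_le] at e1 e2
  rw [hmk, abs_lt]
  constructor <;> nlinarith [h2.1, h2.2]

open Classical in
/-- The side of the cell centred at `κ` at a point `x` of its boundary, with respect to the face
that contains `x` in its relative interior; `false` if there is no such face. -/
noncomputable def cellSide (N : ℕ) (a : Fin d → ℕ) (κ : Fin d → ℤ) (x : Pt d) : Bool :=
  decide (∃ j ν, InFace N a j ν x ∧ x j < κ j)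

lemma cellSide_eq_true_iff {N : ℕ} {a : Fin d → ℕ} {κ : Fin d → ℤ} {x : Pt d} {j : Fin d}
    {ν : Fin d → ℤ} (h : InFace N a j ν x) : cellSide N a κ x = true ↔ x j < κ j := by
  simp only [cellSide, decide_eq_true_eq]
  constructor
  · rintro ⟨j', ν', h1, h2⟩
    rwa [h.axis_unique h1]
  · intro h2
    exact ⟨j, ν, h, h2⟩

lemma exists_of_cellSide_ne {N : ℕ} {a : Fin d → ℕ} {κ κ' : Fin d → ℤ} {x : Pt d}
    (h : cellSide N a κ x ≠ cellSide N a κ' x) : ∃ j ν, InFace N a j ν x ∧ κ j ≠ κ' j := by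
  by_cases hx : ∃ j ν, InFace N a j ν x
  · obtain ⟨j, ν, hx⟩ := hx
    refine ⟨j, ν, hx, fun heq => h ?_⟩
    rw [Bool.eq_iff_iff, cellSide_eq_true_iff hx, cellSide_eq_true_iff hx, heq]
  · exfalso
    push Not at hx
    apply h
    simp [cellSide, hx]

lemma cellSide_ne {N : ℕ} {a : Fin d → ℕ} {κ κ' : Fin d → ℤ} {x : Pt d} {j : Fin d}
    {ν : Fin d → ℤ} (hx : InFace N a j ν x) (h1 : |x j - κ j| ≤ 1 / 2) (h2 : |x j - κ' j| ≤ 1 / 2)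
    (hne : κ j ≠ κ' j) : cellSide N a κ x ≠ cellSide N a κ' x := by
  have key : ∀ {κ κ' : Fin d → ℤ}, |x j - κ j| ≤ 1 / 2 → |x j - κ' j| ≤ 1 / 2 → κ j < κ' j →
      cellSide N a κ x ≠ cellSide N a κ' x := by
    intro κ κ' h1 h2 h heq
    have h3 : (κ j : ℝ) + 1 ≤ κ' j := by exact_mod_cast h
    rw [abs_le] at h1 h2
    rw [Bool.eq_iff_iff, cellSide_eq_true_iff hx, cellSide_eq_true_iff hx] at heq
    have := heq.2 (by linarith)
    linarith
  rcases lt_or_gt_of_ne hne with h | h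
  · exact key h1 h2 h
  · exact (key h2 h1 h).symm

lemma Discretization.add_mul_period {γ : ClosedPath d} {P : Finset (Pt d)}
    (D : Discretization γ P) (q i : ℤ) :
    D.x (i + q * D.K) = D.x i ∧ D.κ (i + q * D.K) = D.κ i := by
  induction q using Int.induction_on generalizing i with
  | zero => simp
  | succ q ih =>
    rw [← (ih i).1, ← (ih i).2, ← D.x_per (i + q * D.K), ← D.κ_per (i + q * D.K)]
    constructor <;> congr 1 <;> ring
  | pred q ih =>
    rw [← (ih i).1, ← (ih i).2, ← D.x_per (i + (-q - 1) * D.K), ← D.κ_per (i + (-q - 1) * D.K)]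
    constructor <;> congr 1 <;> ring

/-- All indices are equivalent to indices of one period, with the same neighbourhood. -/
lemma Discretization.reduce {γ : ClosedPath d} {P : Finset (Pt d)} (D : Discretization γ P)
    (i : ℤ) : ∃ m : ℕ, m < D.K ∧ ∀ k : ℤ, D.x (m + k) = D.x (i + k) ∧ D.κ (m + k) = D.κ (i + k) := by
  have hK' : (0 : ℤ) < D.K := by exact_mod_cast D.K_pos
  have h0 := Int.emod_nonneg i hK'.ne'
  have h1 := Int.emod_lt_of_pos i hK'
  refine ⟨(i % D.K).toNat, by omega, fun k => ?_⟩
  rw [Int.toNat_of_nonneg h0]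
  have h2 := D.add_mul_period (i / D.K) (i % D.K + k)
  rw [show i % D.K + k + i / D.K * D.K = i % D.K + i / D.K * D.K + k by ring,
    Int.emod_add_ediv_mul] at h2
  exact ⟨h2.1.symm, h2.2.symm⟩

/-- The closed walk through the points of the discretized path, with one link inside each cell. A
change of cell at a point of the relative interior of a face is a crossing of the walk. -/
theorem Discretization.exists_closedWalk {γ : ClosedPath d} {P : Finset (Pt d)}
    (D : Discretization γ P) (N : ℕ) (a : Fin d → ℕ) {η : ℝ} (hη : 0 < η) :
    ∃ M c, ClosedWalk M c ∧ LinkBounds (LinkValid N a) P (γ.wt + η) M ∧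
      (∀ y, 0 < c y → ∃ i j ν, D.x i = y ∧ InFace N a j ν y ∧ D.κ (i - 1) j ≠ D.κ i j) ∧
      (∀ i j ν, InFace N a j ν (D.x i) → D.κ (i - 1) j ≠ D.κ i j → 0 < c (D.x i)) := by
  have hK : (0 : ℝ) < D.K := by exact_mod_cast D.K_pos
  choose m hm1 hm2 using fun i : ℤ => exists_interior_point (D.close_left i) (D.close_right i)
    (div_pos hη hK)
  set s : ℤ → ℤ → Bool := fun i i' => cellSide N a (D.κ i) (D.x i') with hs
  set L : ℤ → Link d := fun i => ⟨D.x i, s i i, m i, D.x (i + 1), s i (i + 1)⟩ with hL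
  set J : ℤ → Pt d → ℕ := fun i => joint (D.x (i + 1), s i (i + 1)) (D.x (i + 1), s (i + 1) (i + 1))
    with hJ
  have hw : ∀ n : ℕ, Walk ((Multiset.range (n + 1)).map fun i : ℕ => L i) (D.x 0, s 0 0)
      (D.x (n + 1), s n (n + 1)) (∑ i ∈ Finset.range n, J i) := by
    intro n
    induction n with
    | zero =>
      refine Walk.of_eq (t := (D.x ((0 : ℕ) + 1), s (0 : ℕ) ((0 : ℕ) + 1)))
        (Walk.single (L (0 : ℕ))) ?_ ?_
      · simp
      · simp
    | succ n ih =>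
      have := ih.join (Walk.single (L (n + 1))) rfl
      refine (this.of_eq ?_ ?_)
      · rw [Multiset.range_succ (n + 1), Multiset.map_cons, ← Multiset.singleton_add, add_comm]
        push_cast
        rfl
      · rw [Finset.sum_range_succ, add_zero]
  obtain ⟨n, hn⟩ : ∃ n, D.K = n + 1 := ⟨D.K - 1, by have := D.K_pos; omega⟩
  have hxn : D.x ((n : ℤ) + 1) = D.x 0 := by
    have := D.x_per 0
    rw [hn, zero_add] at this
    exact_mod_cast this
  have hκn : D.κ ((n : ℤ) + 1) = D.κ 0 := by
    have := D.κ_per 0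
    rw [hn, zero_add] at this
    exact_mod_cast this
  have hlast : J n = joint (D.x (n + 1), s n (n + 1)) (D.x 0, s 0 0) := by
    simp only [hJ, hs, hκn, hxn]
  refine ⟨_, _, ⟨_, _, _, hw n, hxn, rfl⟩, ⟨?_, ?_, ?_⟩, ?_, ?_⟩
  · intro L' hL'
    obtain ⟨i, -, rfl⟩ := Multiset.mem_map.1 hL'
    exact Or.inl ⟨D.κ i, hm1 i, D.close_left i, D.close_right i,
      fun j ν h => cellSide_eq_true_iff h, fun j ν h => cellSide_eq_true_iff h⟩
  · intro p hp
    obtain ⟨i, rfl⟩ := D.visits p hp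
    obtain ⟨i', hi', h1⟩ := D.reduce i
    have h1 := (h1 0).1
    rw [add_zero, add_zero] at h1
    exact ⟨L i', Multiset.mem_map.2 ⟨i', Multiset.mem_range.2 (by omega), rfl⟩, Or.inl h1⟩
  · rw [Multiset.map_map, ← hn, ← D.sum_dist]
    change ∑ i ∈ Finset.range D.K, (L i).len ≤ _
    calc _ ≤ ∑ i ∈ Finset.range D.K, (dist (D.x i) (D.x (i + 1)) + η / D.K) :=
          Finset.sum_le_sum fun i _ => hm2 i
      _ = _ := by
        rw [Finset.sum_add_distrib, Finset.sum_const, Finset.card_range, nsmul_eq_mul,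
          mul_div_cancel₀ _ hK.ne']
  · intro y hy
    rw [← hlast, ← Finset.sum_range_succ, Finset.sum_apply] at hy
    obtain ⟨i, -, hi⟩ : ∃ i ∈ Finset.range (n + 1), 0 < J i y := by
      by_contra! hcon
      exact absurd (Finset.sum_nonpos hcon) (not_le.2 hy)
    obtain ⟨h1, h2⟩ := joint_pos hi
    simp only at h1 h2
    obtain ⟨j, ν, h3, h4⟩ := exists_of_cellSide_ne h2
    rw [h1] at h3
    exact ⟨i + 1, j, ν, h1, h3, by rwa [add_sub_cancel_right]⟩
  · intro i j ν hface hne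
    obtain ⟨i', hi', e⟩ := D.reduce (i - 1)
    obtain ⟨e1, e4⟩ := e 1
    have e3 := (e 0).2
    rw [sub_add_cancel] at e1 e4
    rw [add_zero, add_zero] at e3
    rw [← hlast, ← Finset.sum_range_succ, Finset.sum_apply]
    apply Finset.sum_pos' (fun _ _ => Nat.zero_le _)
    refine ⟨i', Finset.mem_range.2 (by omega), ?_⟩
    have h5 : s i' (i' + 1) ≠ s (i' + 1) (i' + 1) := by
      simp only [hs, e1, e3, e4]
      have h6 := D.close_right (i - 1) j
      rw [sub_add_cancel] at h6
      exact cellSide_ne hface h6 (D.close_left i j) hne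
    have := joint_eq_one (t := (D.x (i' + 1), s i' (i' + 1)))
      (s := (D.x (i' + 1), s (i' + 1) (i' + 1))) h5
    simp only [e1] at this
    simp only [hJ, e1]
    omega

end

/-! ### Dyadic cells inside a hyperplane -/

section

variable {d : ℕ}

lemma dist_le_sqrt_mul {x y : Pt d} {δ : ℝ} (h : ∀ k, |x k - y k| ≤ δ) (hδ : 0 ≤ δ) :
    dist x y ≤ √d * δ := by
  rw [EuclideanSpace.dist_eq]
  calc √(∑ k, dist (x k) (y k) ^ 2) ≤ √(∑ _k : Fin d, δ ^ 2) := by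
        apply Real.sqrt_le_sqrt
        apply Finset.sum_le_sum
        intro k _
        rw [Real.dist_eq]
        exact pow_le_pow_left₀ (abs_nonneg _) (h k) 2
    _ = √d * δ := by
        rw [Finset.sum_const, Finset.card_univ, Fintype.card_fin, nsmul_eq_mul,
          Real.sqrt_mul (Nat.cast_nonneg d), Real.sqrt_sq hδ]

/-- Within its hyperplane orthogonal to the direction `j`, the point `x` lies on the boundary of a
cell of the dyadic grid of spacing `2 ^ e`. -/
def OnGrid (a : Fin d → ℕ) (j : Fin d) (x : Pt d) (e : ℕ) : Prop :=
  ∃ k, k ≠ j ∧ ∃ z : ℤ, sh a x k = z * 2 ^ e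

open Classical in
/-- The number of scales up to that of the root cube at which `x` lies on the boundary of a cell. -/
noncomputable def gridDepth (N : ℕ) (a : Fin d → ℕ) (j : Fin d) (x : Pt d) : ℕ :=
  ((Finset.range (N + 2)).filter (OnGrid a j x)).card

lemma OnGrid.mono {a : Fin d → ℕ} {j : Fin d} {x : Pt d} {e e' : ℕ} (h : OnGrid a j x e)
    (he : e' ≤ e) : OnGrid a j x e' := by
  obtain ⟨k, hk, z, hz⟩ := h
  obtain ⟨m, rfl⟩ := Nat.exists_eq_add_of_le he
  refine ⟨k, hk, z * 2 ^ m, ?_⟩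
  rw [hz, pow_add]
  push_cast
  ring

lemma onGrid_iff {N : ℕ} {a : Fin d → ℕ} {j : Fin d} {x : Pt d} {e : ℕ} (he : e ≤ N + 1) :
    OnGrid a j x e ↔ e < gridDepth N a j x := by
  classical
  constructor
  · intro h
    have : Finset.range (e + 1) ⊆ (Finset.range (N + 2)).filter (OnGrid a j x) := by
      intro e' he'
      rw [Finset.mem_range] at he'
      exact Finset.mem_filter.2 ⟨Finset.mem_range.2 (by omega), h.mono (by omega)⟩
    have := Finset.card_le_card this
    rw [Finset.card_range] at this
    unfold gridDepth
    convert Nat.lt_of_succ_le this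
  · intro h
    by_contra hcon
    have : (Finset.range (N + 2)).filter (OnGrid a j x) ⊆ Finset.range e := by
      intro e' he'
      rw [Finset.mem_filter] at he'
      rw [Finset.mem_range]
      by_contra! hle
      exact hcon (he'.2.mono hle)
    have := Finset.card_le_card this
    rw [Finset.card_range] at this
    unfold gridDepth at h
    have h2 := h.trans_le (by convert this)
    omega

/-- A total order on the points of a hyperplane, in which points of the relative interior of a face
come before points of its boundary. -/
noncomputable def key (N : ℕ) (a : Fin d → ℕ) (j : Fin d) (x : Pt d) : ℕ ×ₗ Lex (Fin d → ℝ) :=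
  toLex (gridDepth N a j x, toLex x.ofLp)

lemma key_injective (N : ℕ) (a : Fin d → ℕ) (j : Fin d) : Function.Injective (key N a j) := by
  intro x y h
  have h1 := congrArg (fun p => ofLex (ofLex p).2) h
  exact WithLp.ofLp_injective 2 h1

lemma gridDepth_le_of_key_le {N : ℕ} {a : Fin d → ℕ} {j : Fin d} {x y : Pt d}
    (h : key N a j y ≤ key N a j x) : gridDepth N a j y ≤ gridDepth N a j x := by
  rcases (Prod.Lex.le_iff).1 h with h | h
  · exact h.le
  · exact h.1.le

/-- The points `x` and `y` lie in the same hyperplane orthogonal to the direction `j` and there in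
the same half-open cell of the dyadic grid of spacing `2 ^ i`. -/
def SameCell (a : Fin d → ℕ) (j : Fin d) (i : ℤ) (x y : Pt d) : Prop :=
  x j = y j ∧ ∀ k, k ≠ j → ⌊sh a x k / 2 ^ i⌋ = ⌊sh a y k / 2 ^ i⌋

lemma SameCell.mono {a : Fin d → ℕ} {j : Fin d} {i i' : ℤ} {x y : Pt d} (h : SameCell a j i x y)
    (hi : i ≤ i') : SameCell a j i' x y := by
  obtain ⟨m, rfl⟩ := Int.le.dest hi
  refine ⟨h.1, fun k hk => ?_⟩
  have e : ∀ s : ℝ, s / 2 ^ (i + (m : ℤ)) = s / 2 ^ i / ((2 ^ m : ℕ) : ℝ) := by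
    intro s
    rw [zpow_add₀ two_ne_zero, div_div, zpow_natCast]
    push_cast
    rfl
  rw [e, e, Int.floor_div_natCast, Int.floor_div_natCast, h.2 k hk]

lemma SameCell.dist_le {a : Fin d → ℕ} {j : Fin d} {i : ℤ} {x y : Pt d} (h : SameCell a j i x y) :
    dist x y ≤ √d * 2 ^ i := by
  have hp : (0 : ℝ) < 2 ^ i := by positivity
  apply dist_le_sqrt_mul _ hp.le
  intro k
  by_cases hk : k = j
  · rw [hk, h.1, sub_self, abs_zero]; exact hp.le
  · have h1 := Int.abs_sub_lt_one_of_floor_eq_floor (h.2 k hk)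
    rw [← sub_div, abs_div, abs_of_pos hp, div_lt_one hp] at h1
    have h2 : sh a x k - sh a y k = x k - y k := by simp only [sh]; ring
    rw [h2] at h1
    exact h1.le

/-- The half-open cells inside the closure of a face contain points of its boundary, too. These come
late in the order: a predecessor of a point of the relative interior lies in it as well. -/
lemma InFace.of_sameCell {N : ℕ} {a : Fin d → ℕ} {j : Fin d} {ν : Fin d → ℤ} {x y : Pt d} {i : ℤ}
    (h : InFace N a j ν x) (hi : i ≤ lev N (ν j)) (hxy : SameCell a j i x y)
    (hkey : key N a j y ≤ key N a j x) : InFace N a j ν y := by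
  have hlev := lev_le N (ν j)
  have hx : ¬ OnGrid a j x (lev N (ν j)) := by
    rintro ⟨k, hk, z, hz⟩
    exact not_mul_two_pow le_rfl (h.2 k hk).1 (h.2 k hk).2 hz
  have hy : ¬ OnGrid a j y (lev N (ν j)) := by
    rw [onGrid_iff hlev] at hx ⊢
    have := gridDepth_le_of_key_le hkey
    omega
  refine ⟨?_, fun k hk => ?_⟩
  · rw [← h.1, sh, sh, hxy.1]
  have hp : (0 : ℝ) < 2 ^ lev N (ν j) := by positivity
  have h1 := (hxy.mono hi).2 k hk
  rw [zpow_natCast] at h1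
  have h2 : ⌊sh a x k / 2 ^ lev N (ν j)⌋ = ν k := by
    rw [Int.floor_eq_iff, le_div_iff₀ hp, div_lt_iff₀ hp]
    exact ⟨(h.2 k hk).1.le, (h.2 k hk).2⟩
  rw [h2, eq_comm, Int.floor_eq_iff, le_div_iff₀ hp, div_lt_iff₀ hp] at h1
  exact ⟨lt_of_le_of_ne h1.1 fun heq => hy ⟨k, hk, ν k, heq.symm⟩, h1.2⟩

/-- Some point of `X` precedes `x` in the order given by `key` and lies in the same cell of the
dyadic grid of spacing `2 ^ i`. -/
def Dominated (N : ℕ) (a : Fin d → ℕ) (j : Fin d) (X : Finset (Pt d)) (i : ℤ) (x : Pt d) : Prop :=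
  ∃ y ∈ X, key N a j y < key N a j x ∧ SameCell a j i x y

lemma Dominated.mono {N : ℕ} {a : Fin d → ℕ} {j : Fin d} {X : Finset (Pt d)} {i i' : ℤ} {x : Pt d}
    (h : Dominated N a j X i x) (hi : i ≤ i') : Dominated N a j X i' x := by
  obtain ⟨y, h1, h2, h3⟩ := h
  exact ⟨y, h1, h2, h3.mono hi⟩

lemma exists_threshold (N : ℕ) (a : Fin d → ℕ) (j : Fin d) (X : Finset (Pt d)) (x : Pt d) :
    ∃ s : WithTop ℤ, ∀ i : ℤ, Dominated N a j X i x ↔ s ≤ i := by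
  by_cases hex : ∃ i, Dominated N a j X i x
  · have hlim : Tendsto (fun i : ℤ => √d * (2 : ℝ) ^ i) atBot (𝓝 0) := by
      have h1 : Tendsto (fun i : ℤ => (2 : ℝ) ^ i) atBot (𝓝 0) := by
        have h2 : Tendsto (fun i : ℤ => ((2 : ℝ)⁻¹) ^ (-i).toNat) atBot (𝓝 0) := by
          apply (tendsto_pow_atTop_nhds_zero_of_lt_one (by norm_num) (by norm_num)).comp
          rw [tendsto_atTop]
          intro b
          filter_upwards [eventually_le_atBot (-(b : ℤ))] with i hi
          omega
        refine h2.congr' ?_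
        filter_upwards [eventually_le_atBot (0 : ℤ)] with i hi
        rw [← zpow_natCast, Int.toNat_of_nonneg (by omega), inv_zpow', neg_neg]
      simpa using h1.const_mul √d
    have hev : ∀ᶠ i : ℤ in atBot, ∀ y ∈ X, y ≠ x → √d * (2 : ℝ) ^ i < dist x y := by
      rw [Filter.eventually_all_finset]
      intro y _
      by_cases hy : y = x
      · simp [hy]
      · filter_upwards [hlim.eventually_lt_const (dist_pos.2 (Ne.symm hy))] with i hi _
        exact hi
    obtain ⟨b, hb⟩ := hev.exists
    obtain ⟨σ, h1, h2⟩ := Int.exists_least_of_bdd (P := fun i => Dominated N a j X i x)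
      ⟨b, fun i hi => by
        by_contra! hlt
        obtain ⟨y, h1, h2, h3⟩ := hi.mono hlt.le
        exact absurd h3.dist_le (not_le.2 (hb y h1 (fun h => by rw [h] at h2; exact lt_irrefl _ h2)))⟩
      hex
    refine ⟨σ, fun i => ⟨fun h => by exact_mod_cast h2 i h, fun h => h1.mono (by exact_mod_cast h)⟩⟩
  · push Not at hex
    exact ⟨⊤, fun i => ⟨fun h => absurd h (hex i), fun h => by simp at h⟩⟩

/-- The least `σ` such that `x` is dominated in its cell of the dyadic grid of spacing `2 ^ σ`. -/
noncomputable def threshold (N : ℕ) (a : Fin d → ℕ) (j : Fin d) (X : Finset (Pt d)) (x : Pt d) :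
    WithTop ℤ := (exists_threshold N a j X x).choose

lemma dominated_iff {N : ℕ} {a : Fin d → ℕ} {j : Fin d} {X : Finset (Pt d)} {x : Pt d} {i : ℤ} :
    Dominated N a j X i x ↔ threshold N a j X x ≤ i := (exists_threshold N a j X x).choose_spec i

/-- The dyadic structure in hyperplanes orthogonal to `j` does not depend on `a j`. -/
lemma threshold_update (N : ℕ) (a : Fin d → ℕ) (j : Fin d) (t : ℕ) :
    threshold N (Function.update a j t) j = threshold N a j := by
  have hsh : ∀ x : Pt d, ∀ k ≠ j, sh (Function.update a j t) x k = sh a x k := by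
    intro x k hk; simp only [sh, Function.update_of_ne hk]
  have h1 : OnGrid (Function.update a j t) j = OnGrid a j := by
    funext x e
    rw [eq_iff_iff]
    constructor <;> rintro ⟨k, hk, z, hz⟩ <;> refine ⟨k, hk, z, ?_⟩
    · rw [← hsh x k hk, hz]
    · rw [hsh x k hk, hz]
  have h2 : key N (Function.update a j t) j = key N a j := by
    have h5 : ∀ x, gridDepth N (Function.update a j t) j x = gridDepth N a j x := by
      intro x
      unfold gridDepth
      congr 1
      ext e
      simp only [Finset.mem_filter, h1]
    funext x; simp only [key, h5]
  have h3 : SameCell (Function.update a j t) j = SameCell a j := by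
    funext i x y
    rw [eq_iff_iff]
    constructor <;> rintro ⟨e1, e2⟩ <;> refine ⟨e1, fun k hk => ?_⟩ <;> have := e2 k hk
    · rwa [hsh x k hk, hsh y k hk] at this
    · rwa [hsh x k hk, hsh y k hk]
  have h4 : Dominated N (Function.update a j t) j = Dominated N a j := by
    funext X i x; simp only [Dominated, h2, h3]
  funext X x
  simp only [threshold, h4]

/-- In a face of side `2 ^ E`, at most one point in each cell of side `2 ^ (E - m)` is not
dominated. -/
lemma card_not_dominated_le {N : ℕ} {a : Fin d → ℕ} {j : Fin d} {X B : Finset (Pt d)}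
    {ν : Fin d → ℤ} {m : ℕ} (hBX : B ⊆ X) (hB : ∀ x ∈ B, InFace N a j ν x)
    (hdom : ∀ x ∈ B, ¬ Dominated N a j X ((lev N (ν j) : ℤ) - m) x) :
    B.card ≤ (2 ^ m) ^ (d - 1) := by
  classical
  set E := lev N (ν j)
  set φ : Pt d → ({k : Fin d // k ≠ j} → ℤ) := fun x k => ⌊sh a x k / 2 ^ ((E : ℤ) - m)⌋ with hφ
  set T : Finset ({k : Fin d // k ≠ j} → ℤ) := Fintype.piFinset fun k =>
    Finset.Ico (ν k * 2 ^ m) ((ν k + 1) * 2 ^ m) with hT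
  have hcard : T.card = (2 ^ m) ^ (d - 1) := by
    rw [hT, Fintype.card_piFinset]
    have : ∀ k : {k : Fin d // k ≠ j},
        (Finset.Ico (ν k * 2 ^ m) ((ν k + 1) * 2 ^ m)).card = 2 ^ m := by
      intro k
      rw [Int.card_Ico]
      have : (ν k + 1) * 2 ^ m - ν k * 2 ^ m = ((2 ^ m : ℕ) : ℤ) := by push_cast; ring
      rw [this, Int.toNat_natCast]
    rw [Finset.prod_congr rfl fun k _ => this k, Finset.prod_const, Finset.card_univ,
      Fintype.card_subtype_compl, Fintype.card_fin, Fintype.card_subtype_eq]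
  rw [← hcard]
  apply Finset.card_le_card_of_injOn φ
  · intro x hx
    simp only [hT, Finset.mem_coe, Fintype.mem_piFinset, Finset.mem_Ico]
    rintro ⟨k, hk⟩
    have h1 := (hB x hx).2 k hk
    have hp : (0 : ℝ) < 2 ^ ((E : ℤ) - m) := by positivity
    have hpE : (2 : ℝ) ^ E = 2 ^ m * 2 ^ ((E : ℤ) - m) := by
      rw [← zpow_natCast, ← zpow_natCast, ← zpow_add₀ two_ne_zero]
      congr 1; ring
    change _ * 2 ^ E < _ ∧ _ < _ * 2 ^ E at h1
    rw [hpE, ← mul_assoc, ← mul_assoc] at h1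
    simp only [hφ]
    constructor
    · rw [Int.le_floor, le_div_iff₀ hp]
      push_cast
      exact h1.1.le
    · rw [Int.floor_lt, div_lt_iff₀ hp]
      push_cast
      exact h1.2
  · intro x hx y hy hxy
    by_contra hne
    have hj : x j = y j := by
      have := (hB x hx).1.trans (hB y hy).1.symm
      simp only [sh] at this
      linarith
    rcases lt_or_gt_of_ne ((key_injective N a j).ne hne) with h | h
    · exact hdom y hy ⟨x, hBX hx, h, hj.symm, fun k hk => (congrFun hxy ⟨k, hk⟩).symm⟩
    · exact hdom x hx ⟨y, hBX hy, h, hj, fun k hk => congrFun hxy ⟨k, hk⟩⟩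

/-- The nearest portal: the centre of the cube of side `2 ^ E / 2 ^ f` in which a point of a face of
side `2 ^ E` lies. -/
lemma InFace.exists_portal {N : ℕ} {a : Fin d → ℕ} {j : Fin d} {ν : Fin d → ℤ} {x : Pt d}
    (h : InFace N a j ν x) (f : ℕ) :
    ∃ y, InFace N a j ν y ∧
      (∀ k ≠ j, ∃ A : ℤ, sh a y k * 2 ^ f = (A + 1 / 2) * 2 ^ lev N (ν j)) ∧
      dist x y ≤ √d * (2 ^ lev N (ν j) / 2 ^ f / 2) := by
  set E := lev N (ν j) with hE
  have hpE : (0 : ℝ) < 2 ^ E := by positivity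
  have hpf : (0 : ℝ) < 2 ^ f := by positivity
  set A : Fin d → ℤ := fun k => ⌊sh a x k * 2 ^ f / 2 ^ E⌋ with hA
  set y : Pt d := WithLp.toLp 2 fun k => if k = j then x j else
    (A k + 1 / 2) * 2 ^ E / 2 ^ f - a k + 1 / 2 with hy
  have hyj : sh a y j = sh a x j := by simp [sh, hy]
  have hyk : ∀ k ≠ j, sh a y k * 2 ^ f = (A k + 1 / 2) * 2 ^ E := by
    intro k hk
    simp only [sh, hy, if_neg hk]
    field_simp
    ring
  have hAk : ∀ k, (A k : ℝ) * 2 ^ E ≤ sh a x k * 2 ^ f ∧ sh a x k * 2 ^ f < (A k + 1) * 2 ^ E := by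
    intro k
    rw [← le_div_iff₀ hpE, ← div_lt_iff₀ hpE]
    exact ⟨Int.floor_le _, Int.lt_floor_add_one _⟩
  refine ⟨y, ⟨by rw [hyj, h.1], fun k hk => ?_⟩, fun k hk => ⟨A k, hyk k hk⟩, ?_⟩
  · obtain ⟨h1, h2⟩ := h.2 k hk
    rw [← hE] at h1 h2 ⊢
    obtain ⟨h3, h4⟩ := hAk k
    have h5 : (ν k : ℝ) * 2 ^ f < A k + 1 := by
      have : (ν k : ℝ) * 2 ^ f * 2 ^ E < (A k + 1) * 2 ^ E := by nlinarith
      exact lt_of_mul_lt_mul_right this hpE.le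
    have h6 : (A k : ℝ) < (ν k + 1) * 2 ^ f := by
      have : (A k : ℝ) * 2 ^ E < (ν k + 1) * 2 ^ f * 2 ^ E := by nlinarith
      exact lt_of_mul_lt_mul_right this hpE.le
    have h5' : ν k * 2 ^ f < A k + 1 := by exact_mod_cast h5
    have h6' : A k < (ν k + 1) * 2 ^ f := by exact_mod_cast h6
    have h5'' : ν k * 2 ^ f ≤ A k := by omega
    have h6'' : A k + 1 ≤ (ν k + 1) * 2 ^ f := by omega
    have h5r : (ν k : ℝ) * 2 ^ f ≤ A k := by exact_mod_cast h5''
    have h6r : (A k : ℝ) + 1 ≤ (ν k + 1) * 2 ^ f := by exact_mod_cast h6''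
    have h7 := hyk k hk
    constructor
    · refine lt_of_mul_lt_mul_right (a := 2 ^ f) ?_ hpf.le
      rw [h7]; nlinarith
    · refine lt_of_mul_lt_mul_right (a := 2 ^ f) ?_ hpf.le
      rw [h7]; nlinarith
  · apply dist_le_sqrt_mul _ (by positivity)
    intro k
    have h8 : x k - y k = sh a x k - sh a y k := by simp only [sh]; ring
    rw [h8]
    by_cases hk : k = j
    · rw [hk, hyj, sub_self, abs_zero]; positivity
    · have h9 := hyk k hk
      obtain ⟨h3, h4⟩ := hAk k
      rw [div_div, le_div_iff₀ (by positivity), ← abs_of_pos (show (0 : ℝ) < 2 ^ f * 2 by positivity),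
        ← abs_mul, abs_le]
      constructor <;> linarith

end

/-! ### Moving the crossings of one face to few portals -/

/-- An upper bound for the cost, divided by `√d`, that a crossing point with threshold `s` causes in
a face of side `2 ^ e`: a point with a threshold of at most `e - ρ` is joined to an earlier point
at that scale, while the points with larger thresholds share the cost of the detours to portals. -/
noncomputable def moveCost (ρ e : ℕ) : WithTop ℤ → ℝ
  | ⊤ => 0
  | (σ : ℤ) => if σ ≤ (e : ℤ) - ρ then 4 * 2 ^ σ else
      if σ ≤ e then 32 * 2 ^ (2 * (e : ℤ) - σ) / 4 ^ ρ else 0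

lemma moveCost_nonneg (ρ e : ℕ) (s : WithTop ℤ) : 0 ≤ moveCost ρ e s := by
  cases s with
  | top => exact le_rfl
  | coe σ => simp only [moveCost]; split_ifs <;> positivity

/-- With `c` points left, the number of portals is `(2 ^ f) ^ D` with `f = 2 * ρ - τ - 1` and
`τ = ⌈log c / log (2 ^ D)⌉`. -/
lemma portal_count_le {D ρ r c : ℕ} (hD : 0 < D) (hr : 2 ^ ρ ≤ r) (hc : 2 ≤ c)
    (hcρ : c ≤ (2 ^ ρ) ^ D) :
    Nat.clog (2 ^ D) c ≤ ρ ∧ 0 < Nat.clog (2 ^ D) c ∧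
      2 * c * (2 ^ (2 * ρ - Nat.clog (2 ^ D) c - 1)) ^ D ≤ r ^ (2 * D) := by
  have hb : 1 < 2 ^ D := Nat.one_lt_two_pow hD.ne'
  set τ := Nat.clog (2 ^ D) c with hτ
  have h1 : τ ≤ ρ := Nat.clog_le_of_le_pow (by rwa [← pow_mul, mul_comm, pow_mul])
  have h2 : 0 < τ := Nat.clog_pos hb hc
  have h3 : c ≤ (2 ^ D) ^ τ := Nat.le_pow_clog hb c
  refine ⟨h1, h2, ?_⟩
  calc 2 * c * (2 ^ (2 * ρ - τ - 1)) ^ D ≤ 2 ^ D * (2 ^ D) ^ τ * (2 ^ (2 * ρ - τ - 1)) ^ D := by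
        gcongr
        exact Nat.le_self_pow hD.ne' 2
    _ = (2 ^ ρ) ^ (2 * D) := by
        rw [← pow_mul, ← pow_mul, ← pow_mul, ← pow_add, ← pow_add]
        congr 1
        obtain ⟨u, hu⟩ : ∃ u, 2 * ρ = τ + 1 + u := ⟨2 * ρ - τ - 1, by omega⟩
        rw [show 2 * ρ - τ - 1 = u by omega, show ρ * (2 * D) = 2 * ρ * D by ring, hu]
        ring
    _ ≤ r ^ (2 * D) := Nat.pow_le_pow_left hr _

section

variable {d : ℕ}

/-- The total cost of the detours to portals is paid by the points that are dominated in the cell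
of the face: if there are many points, then most of them have small thresholds. -/
lemma card_mul_le_sum {N : ℕ} {a : Fin d → ℕ} {j : Fin d} {X B : Finset (Pt d)} {ν : Fin d → ℤ}
    (hd : 2 ≤ d) {ρ : ℕ} (hBX : B ⊆ X) (hB : ∀ x ∈ B, InFace N a j ν x)
    (hdom : ∀ x ∈ B, ¬ Dominated N a j X ((lev N (ν j) : ℤ) - ρ) x) (hc : 2 ≤ B.card) :
    4 * (2 : ℝ) ^ (lev N (ν j) + Nat.clog (2 ^ (d - 1)) B.card) / 4 ^ ρ * B.card ≤
      ∑ x ∈ B, moveCost ρ (lev N (ν j)) (threshold N a j X x) := by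
  classical
  set E := lev N (ν j) with hE
  set τ := Nat.clog (2 ^ (d - 1)) B.card with hτ
  have hb : 1 < 2 ^ (d - 1) := Nat.one_lt_two_pow (by omega)
  have hτ0 : 0 < τ := Nat.clog_pos hb hc
  -- truncated: `m = 0` if `τ = 1`
  set m := τ - 2 with hm
  set B₁ := B.filter fun x => Dominated N a j X ((E : ℤ) - m) x with hB1
  set B₂ := B.filter fun x => ¬ Dominated N a j X ((E : ℤ) - m) x with hB2
  have hsum : B₁.card + B₂.card = B.card := Finset.card_filter_add_card_filter_not _
  have h2 : B₂.card ≤ (2 ^ m) ^ (d - 1) := by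
    apply card_not_dominated_le (N := N) (a := a) (j := j) (X := X) (ν := ν)
    · exact (Finset.filter_subset _ _).trans hBX
    · intro x hx; exact hB x (Finset.mem_filter.1 hx).1
    · intro x hx; exact (Finset.mem_filter.1 hx).2
  have h3 : 2 * (2 ^ m) ^ (d - 1) ≤ B.card := by
    by_cases h : τ = 1
    · rw [hm, h]; simpa using hc
    · have h4 : (2 ^ (d - 1)) ^ τ.pred < B.card := Nat.pow_pred_clog_lt_self hb hc
      rw [show τ.pred = m + 1 by rw [Nat.pred_eq_sub_one]; omega, pow_succ, ← pow_mul,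
        mul_comm (d - 1), pow_mul] at h4
      have h5 : 2 ≤ 2 ^ (d - 1) := hb
      nlinarith [Nat.zero_le ((2 ^ m) ^ (d - 1))]
  -- at least half of the points are dominated at scale `2 ^ (E - m)`, and `2 ^ τ ≤ 4 * 2 ^ m`
  have h4 : B.card ≤ 2 * B₁.card := by omega
  have h5 : ∀ x ∈ B₁, 32 * (2 : ℝ) ^ (E + m) / 4 ^ ρ ≤ moveCost ρ E (threshold N a j X x) := by
    intro x hx
    rw [hB1, Finset.mem_filter, dominated_iff] at hx
    have h6 := hdom x hx.1
    rw [dominated_iff] at h6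
    obtain ⟨hx1, hx2⟩ := hx
    cases hs : threshold N a j X x with
    | top => rw [hs] at hx2; simp at hx2
    | coe σ =>
      rw [hs] at hx2 h6
      have hx2 : σ ≤ (E : ℤ) - m := by exact_mod_cast hx2
      have h6 : ¬ σ ≤ (E : ℤ) - ρ := by exact_mod_cast h6
      simp only [moveCost, if_neg h6]
      rw [if_pos (by omega)]
      gcongr
      rw [← zpow_natCast]
      apply zpow_le_zpow_right₀ (by norm_num)
      push_cast
      omega
  calc 4 * (2 : ℝ) ^ (E + τ) / 4 ^ ρ * B.card
      ≤ 4 * (2 : ℝ) ^ (E + m + 2) / 4 ^ ρ * (2 * B₁.card) := by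
        have h6 : (2 : ℝ) ^ (E + τ) ≤ 2 ^ (E + m + 2) :=
          pow_le_pow_right₀ one_le_two (by omega)
        have h7 : (B.card : ℝ) ≤ 2 * B₁.card := by exact_mod_cast h4
        gcongr
    _ = ∑ _x ∈ B₁, 32 * (2 : ℝ) ^ (E + m) / 4 ^ ρ := by
        rw [Finset.sum_const, nsmul_eq_mul, pow_add]; ring
    _ ≤ ∑ x ∈ B₁, moveCost ρ E (threshold N a j X x) := Finset.sum_le_sum h5
    _ ≤ _ := Finset.sum_le_sum_of_subset_of_nonneg (Finset.filter_subset _ _)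
        fun x _ _ => moveCost_nonneg _ _ _

/-- The crossing points of one maximal face can be moved, along a forest inside the face, to few
points: if more than one is left, then all of them belong to a sufficiently coarse grid. -/
theorem exists_face_forest {N : ℕ} {a : Fin d → ℕ} (hd : 2 ≤ d) {ρ r : ℕ}
    (hr : 2 ^ ρ ≤ r) (j : Fin d) (ν : Fin d → ℤ) (X A : Finset (Pt d))
    (hA : ∀ x, x ∈ A ↔ x ∈ X ∧ InFace N a j ν x) :
    ∃ (par : Pt d → Pt d) (Y : Finset (Pt d)),
      (∀ x ∈ A, InFace N a j ν (par x)) ∧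
      (∀ x ∈ A, par x ∈ Y ∨ (par x ∈ A ∧ key N a j (par x) < key N a j x)) ∧
      (∀ y ∈ Y, InFace N a j ν y) ∧
      ((Y : Set (Pt d)).Subsingleton ∨ ∃ m f : ℕ, 0 < m ∧
        2 * m * (2 ^ f) ^ (d - 1) ≤ r ^ (2 * d - 2) ∧ Y.card ≤ m ∧
        ∀ y ∈ Y, ∀ k ≠ j, ∃ A : ℤ, sh a y k * 2 ^ f = (A + 1 / 2) * 2 ^ lev N (ν j)) ∧
      (∑ x ∈ A, 4 * dist x (par x) ≤
        √d * ∑ x ∈ A, moveCost ρ (lev N (ν j)) (threshold N a j X x)) ∧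
      (∀ x, A = {x} → par x = x ∧ Y = {x}) := by
  classical
  set E := lev N (ν j) with hE
  set near : Pt d → Prop := Dominated N a j X ((E : ℤ) - ρ) with hnear
  set B := A.filter fun x => ¬ near x with hB
  have hBA : ∀ x ∈ B, x ∈ A := fun x hx => (Finset.mem_filter.1 hx).1
  have hBX : B ⊆ X := fun x hx => ((hA x).1 (hBA x hx)).1
  have hBF : ∀ x ∈ B, InFace N a j ν x := fun x hx => ((hA x).1 (hBA x hx)).2
  have hBn : ∀ x ∈ B, ¬ near x := fun x hx => (Finset.mem_filter.1 hx).2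
  have hnext : ∀ x ∈ A, near x → ∃ y, y ∈ A ∧ key N a j y < key N a j x ∧
      4 * dist x y ≤ √d * moveCost ρ E (threshold N a j X x) := by
    intro x hx hn
    have h1 := hn
    rw [hnear, dominated_iff] at h1
    cases hs : threshold N a j X x with
    | top => rw [hs] at h1; simp at h1
    | coe σ =>
      rw [hs] at h1
      have h1 : σ ≤ (E : ℤ) - ρ := by exact_mod_cast h1
      obtain ⟨y, hy1, hy2, hy3⟩ : Dominated N a j X σ x := by rw [dominated_iff, hs]
      refine ⟨y, (hA y).2 ⟨hy1, ((hA x).1 hx).2.of_sameCell (by omega) hy3 hy2.le⟩, hy2, ?_⟩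
      simp only [moveCost, if_pos h1]
      have := hy3.dist_le
      linarith
  choose! next hnext1 hnext2 hnext3 using hnext
  -- the positions of the points that are not joined to earlier ones
  obtain ⟨dest, hdest1, hdest2, hdest3, hdest4⟩ : ∃ dest : Pt d → Pt d,
      (∀ x ∈ B, InFace N a j ν (dest x)) ∧
      (((B.image dest : Finset (Pt d)) : Set (Pt d)).Subsingleton ∨ ∃ m f : ℕ, 0 < m ∧
        2 * m * (2 ^ f) ^ (d - 1) ≤ r ^ (2 * d - 2) ∧ B.card ≤ m ∧
        ∀ x ∈ B, ∀ k ≠ j, ∃ A : ℤ, sh a (dest x) k * 2 ^ f = (A + 1 / 2) * 2 ^ E) ∧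
      (∑ x ∈ B, 4 * dist x (dest x) ≤
        √d * ∑ x ∈ B, moveCost ρ E (threshold N a j X x)) ∧
      (B.card ≤ 1 → ∀ x ∈ B, dest x = x) := by
    by_cases hc : B.card ≤ 1
    · refine ⟨id, hBF, Or.inl ?_, ?_, fun _ _ _ => rfl⟩
      · rw [Finset.image_id]
        exact fun x hx y hy => Finset.card_le_one.1 hc x hx y hy
      · simp only [id, dist_self, mul_zero, Finset.sum_const_zero]
        exact mul_nonneg (Real.sqrt_nonneg _) (Finset.sum_nonneg fun x _ => moveCost_nonneg _ _ _)
    · have hc : 2 ≤ B.card := by omega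
      have hcρ : B.card ≤ (2 ^ ρ) ^ (d - 1) := card_not_dominated_le hBX hBF hBn
      set τ := Nat.clog (2 ^ (d - 1)) B.card with hτ
      -- in terms of `g` portals and at most `2 * c` crossings: `2 * c * g ≤ r ^ (2 * d - 2)`
      obtain ⟨h1, h2, h3⟩ := portal_count_le (by omega) hr hc hcρ
      have hportal : ∀ x ∈ B, ∃ y, InFace N a j ν y ∧
          (∀ k ≠ j, ∃ A : ℤ, sh a y k * 2 ^ (2 * ρ - τ - 1) = (A + 1 / 2) * 2 ^ E) ∧
          dist x y ≤ √d * (2 ^ E / 2 ^ (2 * ρ - τ - 1) / 2) :=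
        fun x hx => (hBF x hx).exists_portal _
      choose! dest e1 e2 e3 using hportal
      refine ⟨dest, e1, Or.inr ⟨B.card, 2 * ρ - τ - 1, by omega, ?_, le_rfl, e2⟩, ?_, fun h => by omega⟩
      · rw [show 2 * d - 2 = 2 * (d - 1) by omega]; exact h3
      · have hpow : 4 * ((2 : ℝ) ^ E / 2 ^ (2 * ρ - τ - 1) / 2) = 4 * 2 ^ (E + τ) / 4 ^ ρ := by
          rw [show (4 : ℝ) = 2 ^ 2 by norm_num, ← pow_mul]
          obtain ⟨u, hu⟩ : ∃ u, 2 * ρ = τ + 1 + u := ⟨2 * ρ - τ - 1, by omega⟩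
          rw [show 2 * ρ - τ - 1 = u by omega, hu, pow_add 2 E τ, pow_add, pow_add]
          field_simp
        calc ∑ x ∈ B, 4 * dist x (dest x)
            ≤ ∑ _x ∈ B, √d * (4 * 2 ^ (E + τ) / 4 ^ ρ) := by
              apply Finset.sum_le_sum
              intro x hx
              rw [← hpow]
              linarith [e3 x hx]
          _ = √d * (4 * 2 ^ (E + τ) / 4 ^ ρ * B.card) := by
              rw [Finset.sum_const, nsmul_eq_mul]; ring
          _ ≤ _ := by
              gcongr
              exact card_mul_le_sum hd hBX hBF hBn hc
  set par : Pt d → Pt d := fun x => if near x then next x else dest x with hpar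
  have hp1 : ∀ x, near x → par x = next x := fun x h => if_pos h
  have hp2 : ∀ x, ¬ near x → par x = dest x := fun x h => if_neg h
  have hmem : ∀ x ∈ A, ¬ near x → x ∈ B := fun x hx h => Finset.mem_filter.2 ⟨hx, h⟩
  refine ⟨par, B.image dest, ?_, ?_, ?_, ?_, ?_, ?_⟩
  · intro x hx
    by_cases h : near x
    · rw [hp1 x h]; exact ((hA _).1 (hnext1 x hx h)).2
    · rw [hp2 x h]; exact hdest1 x (hmem x hx h)
  · intro x hx
    by_cases h : near x
    · rw [hp1 x h]; exact Or.inr ⟨hnext1 x hx h, hnext2 x hx h⟩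
    · rw [hp2 x h]; exact Or.inl (Finset.mem_image_of_mem _ (hmem x hx h))
  · intro y hy
    obtain ⟨x, hx, rfl⟩ := Finset.mem_image.1 hy
    exact hdest1 x hx
  · rcases hdest2 with h | ⟨m, f, h1, h2, h3, h4⟩
    · exact Or.inl h
    · refine Or.inr ⟨m, f, h1, h2, Finset.card_image_le.trans h3, fun y hy => ?_⟩
      obtain ⟨x, hx, rfl⟩ := Finset.mem_image.1 hy
      exact h4 x hx
  · rw [← Finset.sum_filter_add_sum_filter_not A near,
      ← Finset.sum_filter_add_sum_filter_not A near fun x => moveCost _ _ _, mul_add]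
    apply add_le_add
    · rw [Finset.mul_sum]
      apply Finset.sum_le_sum
      intro x hx
      obtain ⟨hx, hn⟩ := Finset.mem_filter.1 hx
      rw [hp1 x hn]
      exact hnext3 x hx hn
    · refine le_trans (le_of_eq ?_) hdest3
      apply Finset.sum_congr rfl
      intro x hx
      rw [hp2 x (hBn x hx)]
  · rintro x rfl
    have hx : x ∈ ({x} : Finset (Pt d)) := Finset.mem_singleton_self x
    have hn : ¬ near x := by
      intro h
      have h1 := hnext1 x hx h
      have h2 := hnext2 x hx h
      rw [Finset.mem_singleton] at h1
      rw [h1] at h2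
      exact lt_irrefl _ h2
    have hBx : B = {x} := by
      rw [hB, Finset.filter_singleton, if_pos hn]
    have h1 : dest x = x := hdest4 (by rw [hBx]; simp) x (hmem x hx hn)
    refine ⟨by rw [hp2 x hn, h1], ?_⟩
    rw [hBx, Finset.image_singleton, h1]

end

/-! ### Faces that are crossed at a single point -/

section

variable {d : ℕ}

lemma ClosedPath.continuous_pos (γ : ClosedPath d) : Continuous γ.pos := by
  have hline : ∀ k : ℤ, Continuous fun u : ℝ =>
      AffineMap.lineMap (γ.vertex k) (γ.vertex (k + 1)) (u - k) := fun k =>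
    AffineMap.lineMap_continuous.comp (continuous_id.sub continuous_const)
  have hpos : ∀ k : ℤ, ∀ u ∈ Icc (k : ℝ) (k + 1),
      γ.pos u = AffineMap.lineMap (γ.vertex k) (γ.vertex (k + 1)) (u - k) := by
    intro k u hu
    have := γ.pos_intCast_add k (l := u - k)
      ⟨by linarith [hu.1], by linarith [hu.2]⟩
    rwa [add_sub_cancel] at this
  rw [continuous_iff_continuousAt]
  intro t
  rw [continuousAt_iff_continuous_left_right]
  constructor
  · set k := ⌈t⌉ - 1
    have h1 : (k : ℝ) < t := by
      have := Int.ceil_lt_add_one t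
      simp only [k]; push_cast; linarith
    have h2 : t ≤ k + 1 := by
      have := Int.le_ceil t
      simp only [k]; push_cast; linarith
    refine (hline k).continuousWithinAt.congr_of_eventuallyEq ?_ (hpos k t ⟨h1.le, h2⟩)
    filter_upwards [self_mem_nhdsWithin, mem_nhdsWithin_of_mem_nhds (Ioi_mem_nhds h1)] with u hu hu'
    exact hpos k u ⟨le_of_lt hu', (mem_Iic.1 hu).trans h2⟩
  · set k := ⌊t⌋
    have h1 : (k : ℝ) ≤ t := Int.floor_le t
    have h2 : t < k + 1 := Int.lt_floor_add_one t
    refine (hline k).continuousWithinAt.congr_of_eventuallyEq ?_ (hpos k t ⟨h1, h2.le⟩)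
    filter_upwards [self_mem_nhdsWithin, mem_nhdsWithin_of_mem_nhds (Iio_mem_nhds h2)] with u hu hu'
    exact hpos k u ⟨h1.trans (mem_Ici.1 hu), le_of_lt hu'⟩

/-- If the path crosses a face at a single point, then it does not move during the crossing. -/
lemma ClosedPath.pos_eq_of_crossingPoints_eq {γ : ClosedPath d} {F : Facet d} {x : Pt d}
    (h : γ.crossingPoints F = {x}) {s t u : ℝ}
    (hst : γ.IsCrossing F.axis (F.lo F.axis) s t) (hu : u ∈ Icc s t) (hux : γ.pos u = x) :
    γ.pos t = x := by
  have hx : x ∈ γ.crossingPoints F := h ▸ rfl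
  have hmem : ∀ v ∈ Icc s t, γ.pos v ∈ F.relInt → γ.pos v = x := by
    intro v hv hrel
    have : γ.pos v ∈ γ.crossingPoints F := ⟨hrel, s, t, hst, v, hv, rfl⟩
    rwa [h] at this
  -- the points of the crossing form a connected set in which `x` is isolated
  set U : Set (Pt d) := {y | ∀ k, k ≠ F.axis → y k ∈ Ioo (F.lo k) (F.lo k + F.side)} with hU
  have hUo : IsOpen U := by
    have : U = ⋂ k, ⋂ _ : k ≠ F.axis, {y : Pt d | y k ∈ Ioo (F.lo k) (F.lo k + F.side)} := by
      ext y; simp [hU]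
    rw [this]
    refine isOpen_iInter_of_finite fun k => isOpen_iInter_of_finite fun _ => ?_
    exact isOpen_Ioo.preimage (by fun_prop : Continuous fun y : Pt d => y k)
  have hCU : ∀ v ∈ Icc s t, γ.pos v ∈ U → γ.pos v = x := fun v hv hvU =>
    hmem v hv ⟨hst.2.2.2.1 v hv, hvU⟩
  have hpre : IsPreconnected (γ.pos '' Icc s t) :=
    isPreconnected_Icc.image _ γ.continuous_pos.continuousOn
  by_contra hne
  obtain ⟨y, ⟨v, hv, rfl⟩, h1, h2⟩ := hpre U {x}ᶜ hUo isOpen_compl_singleton (by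
      rintro _ ⟨v, hv, rfl⟩
      by_cases hvx : γ.pos v = x
      · left; rw [hvx]; exact hx.1.2
      · right; exact hvx)
    ⟨x, ⟨u, hu, hux⟩, hx.1.2⟩ ⟨γ.pos t, ⟨t, ⟨hst.2.2.1, le_rfl⟩, rfl⟩, hne⟩
  exact h2 (hCU v hv h1)

/-! ### The simple path for a fixed shift -/

open Classical in
/-- The points at which the discretized path crosses hyperplanes orthogonal to the direction `j`. -/
noncomputable def Discretization.crossX {γ : ClosedPath d} {P : Finset (Pt d)}
    (D : Discretization γ P) (j : Fin d) : Finset (Pt d) :=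
  ((Finset.range D.K).filter fun i : ℕ => D.κ (i - 1) j ≠ D.κ i j).image fun i : ℕ => D.x i

lemma Discretization.mem_crossX {γ : ClosedPath d} {P : Finset (Pt d)} (D : Discretization γ P)
    {j : Fin d} {x : Pt d} : x ∈ D.crossX j ↔ ∃ i, D.x i = x ∧ D.κ (i - 1) j ≠ D.κ i j := by
  classical
  simp only [Discretization.crossX, Finset.mem_image, Finset.mem_filter, Finset.mem_range]
  constructor
  · rintro ⟨i, ⟨-, h⟩, rfl⟩
    exact ⟨i, rfl, h⟩
  · rintro ⟨i, rfl, h⟩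
    obtain ⟨m, hm, hper⟩ := D.reduce i
    have h0 := hper 0
    have h1 := (hper (-1)).2
    rw [add_zero, add_zero] at h0
    rw [← sub_eq_add_neg, ← sub_eq_add_neg] at h1
    exact ⟨m, ⟨hm, by rwa [h1, h0.2]⟩, h0.1⟩

lemma Discretization.sum_card_crossX_le {γ : ClosedPath d} {P : Finset (Pt d)}
    (D : Discretization γ P) : (∑ j, ((D.crossX j).card : ℝ)) ≤ 2 * d * γ.wt := by
  classical
  refine le_trans ?_ D.sum_changes
  rw [Finset.sum_comm]
  apply Finset.sum_le_sum
  intro j _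
  calc ((D.crossX j).card : ℝ)
      ≤ ((Finset.range D.K).filter fun i : ℕ => D.κ (i - 1) j ≠ D.κ i j).card := by
        exact_mod_cast Finset.card_image_le
    _ = ∑ i ∈ (Finset.range D.K).filter (fun i : ℕ => D.κ (i - 1) j ≠ D.κ i j), (1 : ℝ) := by simp
    _ ≤ ∑ i ∈ (Finset.range D.K).filter (fun i : ℕ => D.κ (i - 1) j ≠ D.κ i j),
          |(D.κ i j : ℝ) - D.κ (i - 1) j| := by
        apply Finset.sum_le_sum
        intro i hi
        have h1 : 1 ≤ |D.κ i j - D.κ (i - 1) j| :=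
          Int.one_le_abs (sub_ne_zero.2 (Finset.mem_filter.1 hi).2.symm)
        exact_mod_cast h1
    _ ≤ _ := Finset.sum_le_sum_of_subset_of_nonneg (Finset.filter_subset _ _)
        fun _ _ _ => abs_nonneg _

/-- For each shift there is a simple path whose additional length is bounded by a sum over the
points at which the given path crosses hyperplanes. -/
theorem exists_simple_path {γ : ClosedPath d} {P : Finset (Pt d)} (D : Discretization γ P)
    (hd : 2 ≤ d) {ρ r : ℕ} (hr : 2 ^ ρ ≤ r) (N : ℕ) (a : Fin d → ℕ) {η : ℝ} (hη : 0 < η) :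
    ∃ γ' : ClosedPath d, γ'.Visits P ∧ γ'.IsSimple (2 ^ N) a r ∧
      (∀ F, IsMaximalFacet (2 ^ N) a F → ∀ x, γ.crossingPoints F = {x} →
        γ'.crossingPoints F = {x}) ∧
      γ'.wt ≤ γ.wt + √d * (∑ j, ∑ x ∈ D.crossX j,
        moveCost ρ (lev N ⌊sh a x j⌋) (threshold N a j (D.crossX j) x)) + η := by
  classical
  obtain ⟨M, c, hM, hMb, hc1, hc2⟩ := D.exists_closedWalk N a (half_pos hη)
  set A : Fin d → (Fin d → ℤ) → Finset (Pt d) := fun j ν =>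
    (D.crossX j).filter (InFace N a j ν) with hA
  have hAmem : ∀ j ν x, x ∈ A j ν ↔ x ∈ D.crossX j ∧ InFace N a j ν x := fun j ν x =>
    Finset.mem_filter
  choose par Y h1 h2 h3 h4 h5 h6 using fun j ν =>
    exists_face_forest hd hr j ν (D.crossX j) (A j ν) (hAmem j ν)
  -- `loc x` is the only face with `x` in its relative interior, if there is one
  obtain ⟨loc, hloc⟩ : ∃ loc : Pt d → Fin d × (Fin d → ℤ), ∀ x j ν, InFace N a j ν x →
      loc x = (j, ν) := by
    have : ∀ x : Pt d, ∃ p : Fin d × (Fin d → ℤ), ∀ j ν, InFace N a j ν x → p = (j, ν) := by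
      intro x
      by_cases h : ∃ j ν, InFace N a j ν x
      · obtain ⟨j, ν, h⟩ := h
        refine ⟨(j, ν), fun j' ν' h' => ?_⟩
        obtain rfl := h.axis_unique h'
        rw [h.index_unique h']
      · push Not at h
        exact ⟨(⟨0, by omega⟩, 0), fun j ν h' => absurd h' (h j ν)⟩
    choose loc hloc using this
    exact ⟨loc, hloc⟩
  have hlocA : ∀ j ν x, x ∈ A j ν → loc x = (j, ν) := fun j ν x hx =>
    hloc x j ν ((hAmem j ν x).1 hx).2
  set T : Finset (Pt d) := Finset.univ.biUnion fun j => (D.crossX j).filter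
    fun x => ∃ ν, InFace N a j ν x with hT
  have hTmem : ∀ x, x ∈ T ↔ ∃ j ν, x ∈ A j ν := by
    intro x
    simp only [hT, Finset.mem_biUnion, Finset.mem_univ, true_and, Finset.mem_filter, hAmem]
    constructor
    · rintro ⟨j, hx, ν, hν⟩; exact ⟨j, ν, hx, hν⟩
    · rintro ⟨j, ν, hx, hν⟩; exact ⟨j, hx, ν, hν⟩
  set par' : Pt d → Pt d := fun x => par (loc x).1 (loc x).2 x with hpar'
  have hparA : ∀ j ν x, x ∈ A j ν → par' x = par j ν x := by
    intro j ν x hx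
    simp only [hpar', hlocA j ν x hx]
  set Z := T.filter fun x => x ≠ par' x with hZ
  set Y' := (T.image loc).biUnion fun p => Y p.1 p.2 with hY'
  have hYmem : ∀ j ν x, x ∈ A j ν → Y j ν ⊆ Y' := by
    intro j ν x hx y hy
    refine Finset.mem_biUnion.2 ⟨(j, ν), Finset.mem_image.2 ⟨x, (hTmem x).2 ⟨j, ν, hx⟩, ?_⟩, hy⟩
    exact hlocA j ν x hx
  have hYface : ∀ y ∈ Y', ∀ j ν, InFace N a j ν y → y ∈ Y j ν := by
    intro y hy j ν hν
    obtain ⟨p, -, hp⟩ := Finset.mem_biUnion.1 hy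
    have e1 := hloc y _ _ (h3 p.1 p.2 y hp)
    have e2 := hloc y _ _ hν
    rw [e1] at e2
    rw [Prod.mk.injEq] at e2
    rwa [e2.1, e2.2] at hp
  have hfix : ∀ j ν x, x ∈ A j ν → x = par' x → x ∈ Y' := by
    intro j ν x hx hfix
    rw [hparA j ν x hx] at hfix
    rcases h2 j ν x hx with h | h
    · rw [← hfix] at h; exact hYmem j ν x hx h
    · rw [← hfix] at h; exact absurd h.2 (lt_irrefl _)
  obtain ⟨M', c', hM', hMb', hc1', hc2', hc3'⟩ := hM.patch (fun _ h => h.rev)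
    (fun x => key N a (loc x).1 x) par' Y' Z (fun z hz => (Finset.mem_filter.1 hz).2) (by
      intro z hz
      obtain ⟨j, ν, hx⟩ := (hTmem z).1 (Finset.mem_filter.1 hz).1
      rw [hparA j ν z hx]
      rcases h2 j ν z hx with h | ⟨h, h'⟩
      · exact Or.inl (hYmem j ν z hx h)
      · by_cases hw : par j ν z = par' (par j ν z)
        · exact Or.inl (hfix j ν _ h hw)
        · refine Or.inr ⟨Finset.mem_filter.2 ⟨(hTmem _).2 ⟨j, ν, h⟩, hw⟩, ?_⟩
          simp only [hlocA j ν _ h, hlocA j ν _ hx]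
          exact h') (by
      intro z hz b
      obtain ⟨j, ν, hx⟩ := (hTmem z).1 (Finset.mem_filter.1 hz).1
      have hzF := ((hAmem j ν z).1 hx).2
      rw [hparA j ν z hx]
      exact Or.inr ⟨j, ν, hzF, hzF, h1 j ν z hx, rfl⟩) hMb (by
      intro y hy
      obtain ⟨i, j, ν, e1, e2, e3⟩ := hc1 y hy
      have hx : y ∈ A j ν := (hAmem j ν y).2 ⟨D.mem_crossX.2 ⟨i, e1, e3⟩, e2⟩
      by_cases hw : y = par' y
      · exact Or.inr (hfix j ν y hx hw)
      · exact Or.inl (Finset.mem_filter.2 ⟨(hTmem y).2 ⟨j, ν, hx⟩, hw⟩))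
  obtain ⟨γ', hwt, hvis, hp1, hp2, hp3⟩ := exists_path_of_closedWalk hM' hMb' (half_pos hη)
  refine ⟨γ', hvis, ?_, ?_, ?_⟩
  · refine isSimple_of_maximal hd hp1 hp3 hc2' fun j ν => ?_
    have hsub : {y | 0 < c' y ∧ InFace N a j ν y} ⊆ (Y j ν : Set (Pt d)) := fun y hy =>
      hYface y (hc1' y hy.1) j ν hy.2
    rcases h4 j ν with h | ⟨m, f, e1, e2, e3, e4⟩
    · exact Or.inl (h.anti hsub)
    · refine Or.inr ⟨m, f, e1, e2, ?_, fun y hy hyF => e4 y (hsub ⟨hy, hyF⟩)⟩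
      refine (Set.encard_le_encard hsub).trans ?_
      rw [Set.encard_coe_eq_coe_finsetCard]
      exact_mod_cast e3
  · intro F hF x hx
    obtain ⟨ν, hν0, hν⟩ := hF.exists_index hd
    set j := F.axis with hj
    have hxc : x ∈ γ.crossingPoints F := hx ▸ rfl
    have hxF : InFace N a j ν x := (hν x).1 hxc.1
    have hlo : F.lo j = ((ν j - a j : ℤ) : ℝ) + 1 / 2 := by push_cast; linarith
    obtain ⟨-, s, t, hst, u, hu, hux⟩ := hxc
    have hend := ClosedPath.pos_eq_of_crossingPoints_eq hx hst hu hux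
    have hst' := hst
    rw [← hj, hlo] at hst'
    obtain ⟨i, hi1, hi2⟩ := D.change j s t _ hst'
    rw [hend] at hi1
    have hxA : x ∈ A j ν := (hAmem j ν x).2 ⟨D.mem_crossX.2 ⟨i, hi1, hi2⟩, hxF⟩
    -- the discretized path has no further crossing points in the face, so that `x` is not moved
    have hAx : A j ν = {x} := by
      ext y
      rw [Finset.mem_singleton]
      constructor
      · intro hy
        obtain ⟨hy1, hy2⟩ := (hAmem j ν y).1 hy
        obtain ⟨i', rfl, hi'⟩ := D.mem_crossX.1 hy1
        obtain ⟨s', t', hst2, ht'⟩ := D.crossing i' j hi'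
        have hrel := (hν _).2 hy2
        have : D.x i' ∈ γ.crossingPoints F := by
          refine ⟨hrel, s', t', ?_, t', ⟨hst2.2.2.1, le_rfl⟩, ht'⟩
          rw [← hj, ← hrel.1]
          exact hst2
        rwa [hx] at this
      · rintro rfl; exact hxA
    obtain ⟨e1, e2⟩ := h6 j ν x hAx
    have hxZ : x ∉ Z := by
      intro h
      apply (Finset.mem_filter.1 h).2
      rw [hparA j ν x hxA, e1]
    have hpos : 0 < c' x := by
      apply hc3' x hxZ
      rw [← hi1]
      exact hc2 i j ν (by rwa [hi1]) hi2
    ext y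
    rw [Set.mem_singleton_iff]
    constructor
    · intro hy
      have hyF := (hν y).1 hy.1
      have := hYface y (hc1' y (hp1 F ν y hy hyF)) j ν hyF
      rwa [e2, Finset.mem_singleton] at this
    · rintro rfl
      exact hp2 F y ((hν y).2 hxF) hpos
  · have hcost : ∑ z ∈ Z, 4 * dist z (par' z) ≤ √d * (∑ j, ∑ x ∈ D.crossX j,
        moveCost ρ (lev N ⌊sh a x j⌋) (threshold N a j (D.crossX j) x)) := by
      set g : Fin d → Pt d → ℝ := fun j x =>
        moveCost ρ (lev N ⌊sh a x j⌋) (threshold N a j (D.crossX j) x) with hg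
      have hg0 : ∀ j x, 0 ≤ g j x := fun j x => moveCost_nonneg _ _ _
      have hfib : ∀ p ∈ T.image loc, (T.filter fun z => loc z = p) = A p.1 p.2 := by
        intro p hp
        ext z
        rw [Finset.mem_filter]
        constructor
        · rintro ⟨hz, rfl⟩
          obtain ⟨j, ν, hx⟩ := (hTmem z).1 hz
          rwa [hlocA j ν z hx]
        · intro hz
          exact ⟨(hTmem z).2 ⟨_, _, hz⟩, hlocA _ _ z hz⟩
      calc ∑ z ∈ Z, 4 * dist z (par' z) ≤ ∑ z ∈ T, 4 * dist z (par' z) :=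
            Finset.sum_le_sum_of_subset_of_nonneg (Finset.filter_subset _ _)
              fun _ _ _ => by positivity
        _ = ∑ p ∈ T.image loc, ∑ z ∈ T.filter (fun z => loc z = p), 4 * dist z (par' z) :=
            (Finset.sum_fiberwise_of_maps_to (fun z hz => Finset.mem_image_of_mem _ hz) _).symm
        _ ≤ ∑ p ∈ T.image loc, ∑ z ∈ T.filter (fun z => loc z = p), √d * g (loc z).1 z := by
            apply Finset.sum_le_sum
            intro p hp
            rw [hfib p hp, ← Finset.mul_sum _ fun z => g (loc z).1 z]
            refine le_trans (le_of_eq ?_) ((h5 p.1 p.2).trans (le_of_eq ?_))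
            · exact Finset.sum_congr rfl fun z hz => by rw [hparA _ _ z hz]
            · congr 1
              apply Finset.sum_congr rfl
              intro z hz
              simp only [hg, hlocA _ _ z hz]
              rw [((hAmem _ _ z).1 hz).2.1, Int.floor_intCast]
        _ = √d * ∑ z ∈ T, g (loc z).1 z := by
            rw [Finset.sum_fiberwise_of_maps_to fun z hz => Finset.mem_image_of_mem _ hz,
              Finset.mul_sum]
        _ ≤ _ := by
            gcongr
            rw [hT, Finset.sum_biUnion]
            · apply Finset.sum_le_sum
              intro j _
              refine le_trans (le_of_eq ?_) (Finset.sum_le_sum_of_subset_of_nonneg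
                (Finset.filter_subset (fun x => ∃ ν, InFace N a j ν x) _) fun x _ _ => hg0 j x)
              apply Finset.sum_congr rfl
              intro x hx
              obtain ⟨ν, hν⟩ := (Finset.mem_filter.1 hx).2
              rw [hloc x j ν hν]
            · intro j _ j' _ hne
              rw [Function.onFun, Finset.disjoint_left]
              intro x hx hx'
              obtain ⟨ν, hν⟩ := (Finset.mem_filter.1 hx).2
              obtain ⟨ν', hν'⟩ := (Finset.mem_filter.1 hx').2
              exact hne (hν.axis_unique hν')
    linarith

end

/-! ### The expected cost for a random shift -/

/-- For random `t`, the hyperplane at `z + t` carries faces of side `2 ^ e` with probability at most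
`2 / 2 ^ e`. The factor `2` is needed only for `e = N + 1`, where at most one `t` counts. -/
lemma card_lev_eq_mul_le (N e : ℕ) (z : ℤ) :
    ((Finset.Icc 1 (2 ^ N)).filter fun t : ℕ => lev N (z + t) = e).card * 2 ^ e ≤ 2 * 2 ^ N := by
  set B := (Finset.Icc 1 (2 ^ N)).filter fun t : ℕ => lev N (z + t) = e with hB
  have hp : (0 : ℤ) < 2 ^ e := by positivity
  by_cases heN : N + 1 < e
  · have : B = ∅ := by
      rw [hB, Finset.filter_eq_empty_iff]
      intro t _ h
      have := lev_le N (z + t)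
      omega
    rw [this]; simp
  have hdvd : ∀ t ∈ B, ∃ q : ℤ, z + t = q * 2 ^ e := by
    intro t ht
    have h1 := two_pow_lev_dvd N (z + t)
    rw [(Finset.mem_filter.1 ht).2] at h1
    exact exists_eq_mul_left_of_dvd h1
  have hcard : B.card ≤ ((z + 2 ^ N) / 2 ^ e - z / 2 ^ e).toNat := by
    rw [← Int.card_Ioc]
    apply Finset.card_le_card_of_injOn fun t : ℕ => (z + t) / 2 ^ e
    · intro t ht
      obtain ⟨q, hq⟩ := hdvd t ht
      have ht1 := Finset.mem_Icc.1 (Finset.mem_filter.1 ht).1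
      have ht2 : (t : ℤ) ≤ 2 ^ N := by exact_mod_cast ht1.2
      rw [Finset.mem_coe, Finset.mem_Ioc]
      constructor
      · simp only [hq]
        rw [Int.mul_ediv_cancel _ hp.ne', Int.ediv_lt_iff_lt_mul hp, ← hq]
        omega
      · exact Int.ediv_le_ediv hp (by omega)
    · intro t ht t' ht' h
      obtain ⟨q, hq⟩ := hdvd t ht
      obtain ⟨q', hq'⟩ := hdvd t' ht'
      simp only [hq, hq'] at h
      rw [Int.mul_ediv_cancel _ hp.ne', Int.mul_ediv_cancel _ hp.ne'] at h
      rw [h, ← hq'] at hq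
      omega
  by_cases he : e ≤ N
  · obtain ⟨m, rfl⟩ := Nat.exists_eq_add_of_le he
    have h1 : ((z + 2 ^ (e + m)) / 2 ^ e - z / 2 ^ e).toNat = 2 ^ m := by
      rw [pow_add, Int.add_mul_ediv_left _ _ hp.ne', add_sub_cancel_left]
      exact_mod_cast Int.toNat_natCast (2 ^ m)
    rw [h1] at hcard
    calc B.card * 2 ^ e ≤ 2 ^ m * 2 ^ e := Nat.mul_le_mul_right _ hcard
      _ ≤ 2 * 2 ^ (e + m) := by rw [← pow_add, add_comm m]; omega
  · have he' : e = N + 1 := by omega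
    have h1 : (z + 2 ^ N) / 2 ^ e ≤ z / 2 ^ e + 1 := by
      have h0 : (z + 2 ^ e) / 2 ^ e = z / 2 ^ e + 1 := by
        simpa using Int.add_mul_ediv_right z 1 hp.ne'
      rw [← h0]
      apply Int.ediv_le_ediv hp
      have : (2 : ℤ) ^ N ≤ 2 ^ e := pow_le_pow_right₀ (by norm_num) (by omega)
      omega
    have h2 : B.card ≤ 1 := by omega
    calc B.card * 2 ^ e ≤ 1 * 2 ^ e := Nat.mul_le_mul_right _ h2
      _ = 2 * 2 ^ N := by rw [he', pow_succ]; ring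

/-- The costs, weighted by the probabilities, form two geometric series with the largest terms at
`e = σ + ρ`. -/
lemma sum_moveCost_div_le (ρ n : ℕ) (s : WithTop ℤ) :
    ∑ e ∈ Finset.range n, moveCost ρ e s / 2 ^ e ≤ 40 / 2 ^ ρ := by
  cases s with
  | top => simp only [moveCost, zero_div, Finset.sum_const_zero]; positivity
  | coe σ =>
    -- each term is at most the decrement of `u` or the increment of `v`
    set u : ℕ → ℝ := fun e => min (2 ^ (1 - (ρ : ℤ))) (2 ^ (σ - e + 1)) with hu
    set v : ℕ → ℝ := fun e => min (2 ^ (e - σ)) (2 ^ (ρ : ℤ)) with hv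
    have hmono : ∀ {m n : ℤ}, m ≤ n → (2 : ℝ) ^ m ≤ 2 ^ n := fun h =>
      zpow_le_zpow_right₀ one_le_two h
    have hu1 : ∀ e, u (e + 1) ≤ u e := fun e => min_le_min le_rfl (hmono (by push_cast; omega))
    have hv1 : ∀ e, v e ≤ v (e + 1) := fun e => min_le_min (hmono (by push_cast; omega)) le_rfl
    have hterm : ∀ e, moveCost ρ e (σ : ℤ) / 2 ^ e ≤
        4 * (u e - u (e + 1)) + 32 / 4 ^ ρ * (v (e + 1) - v e) := by
      intro e
      have hnn : 0 ≤ 32 / (4 : ℝ) ^ ρ := by positivity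
      simp only [moveCost]
      split_ifs with h1 h2
      · have e1 : u e = 2 * 2 ^ (σ - e) := by
          simp only [hu]
          rw [min_eq_right (hmono (by omega)), zpow_add_one₀ two_ne_zero, mul_comm]
        have e2 : u (e + 1) = 2 ^ (σ - e) := by
          simp only [hu]
          rw [min_eq_right (hmono (by push_cast; omega))]
          congr 1; push_cast; ring
        have e3 : 4 * (2 : ℝ) ^ σ / 2 ^ e = 4 * 2 ^ (σ - e) := by
          rw [zpow_sub₀ two_ne_zero, zpow_natCast, mul_div_assoc]
        rw [e1, e2, e3]
        have := mul_nonneg hnn (sub_nonneg.2 (hv1 e))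
        linarith
      · have e1 : v e = 2 ^ (e - σ) := by
          simp only [hv]
          rw [min_eq_left (hmono (by omega))]
        have e2 : v (e + 1) = 2 * 2 ^ (e - σ) := by
          simp only [hv]
          rw [min_eq_left (hmono (by push_cast; omega)), mul_comm, ← zpow_add_one₀ two_ne_zero]
          congr 1; push_cast; ring
        have e3 : 32 * (2 : ℝ) ^ (2 * (e : ℤ) - σ) / 4 ^ ρ / 2 ^ e = 32 / 4 ^ ρ * 2 ^ (e - σ) := by
          rw [show 2 * (e : ℤ) - σ = (e - σ) + e by ring, zpow_add₀ two_ne_zero, zpow_natCast]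
          field_simp
        rw [e1, e2, e3]
        have := hu1 e
        linarith
      · have := mul_nonneg hnn (sub_nonneg.2 (hv1 e))
        have := hu1 e
        rw [zero_div]
        linarith
    refine (Finset.sum_le_sum fun e _ => hterm e).trans ?_
    rw [Finset.sum_add_distrib, ← Finset.mul_sum, ← Finset.mul_sum, Finset.sum_range_sub',
      Finset.sum_range_sub]
    have h1 : u 0 - u n ≤ 2 / 2 ^ ρ := by
      have h2 : u 0 ≤ 2 ^ (1 - (ρ : ℤ)) := min_le_left _ _
      rw [zpow_sub₀ two_ne_zero, zpow_natCast, zpow_one] at h2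
      have h3 : 0 ≤ u n := by positivity
      linarith
    have h2 : v n - v 0 ≤ 2 ^ ρ := by
      have h3 : v n ≤ 2 ^ (ρ : ℤ) := min_le_right _ _
      rw [zpow_natCast] at h3
      have h4 : 0 ≤ v 0 := by positivity
      linarith
    calc 4 * (u 0 - u n) + 32 / 4 ^ ρ * (v n - v 0)
        ≤ 4 * (2 / 2 ^ ρ) + 32 / 4 ^ ρ * 2 ^ ρ := by gcongr
      _ = 40 / 2 ^ ρ := by
          rw [show (4 : ℝ) = 2 * 2 by norm_num, mul_pow]
          field_simp
          norm_num

lemma sum_moveCost_lev_le (ρ N : ℕ) (s : WithTop ℤ) (z : ℤ) :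
    ∑ t ∈ Finset.Icc 1 (2 ^ N), moveCost ρ (lev N (z + (t : ℕ))) s ≤ 2 ^ N * (80 / 2 ^ ρ) := by
  have hmaps : ∀ t ∈ Finset.Icc 1 (2 ^ N), lev N (z + (t : ℕ)) ∈ Finset.range (N + 2) := by
    intro t _
    rw [Finset.mem_range]
    have := lev_le N (z + t)
    omega
  rw [← Finset.sum_fiberwise_of_maps_to hmaps]
  calc _ ≤ ∑ e ∈ Finset.range (N + 2), 2 * 2 ^ N * (moveCost ρ e s / 2 ^ e) := by
        apply Finset.sum_le_sum
        intro e _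
        rw [Finset.sum_congr rfl fun t ht => by rw [(Finset.mem_filter.1 ht).2], Finset.sum_const,
          nsmul_eq_mul, ← mul_div_assoc, le_div_iff₀ (by positivity), mul_right_comm]
        have h1 : (((Finset.Icc 1 (2 ^ N)).filter fun t : ℕ => lev N (z + t) = e).card : ℝ) * 2 ^ e
            ≤ 2 * 2 ^ N := by exact_mod_cast card_lev_eq_mul_le N e z
        exact mul_le_mul_of_nonneg_right h1 (moveCost_nonneg _ _ _)
    _ ≤ 2 * 2 ^ N * (40 / 2 ^ ρ) := by
        rw [← Finset.mul_sum]
        gcongr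
        exact sum_moveCost_div_le _ _ _
    _ = _ := by ring

/-- Averaging over one coordinate of the shift first. -/
lemma sum_shifts_le {d L : ℕ} (hL : 0 < L) (j : Fin d) (G : (Fin d → ℕ) → ℝ) (B : ℝ)
    (h : ∀ a, ∑ t ∈ Finset.Icc 1 L, G (Function.update a j t) ≤ L * B) :
    ∑ a ∈ shifts d L, G a ≤ (shifts d L).card * B := by
  have key : ∑ a ∈ shifts d L, ∑ t ∈ Finset.Icc 1 L, G (Function.update a j t) =
      L * ∑ a ∈ shifts d L, G a := by
    have h1 : (L : ℝ) * ∑ a ∈ shifts d L, G a =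
        ∑ a ∈ shifts d L, ∑ _t ∈ Finset.Icc 1 L, G a := by
      simp [Finset.mul_sum]
    rw [h1, ← Finset.sum_product', ← Finset.sum_product']
    have hmem : ∀ p ∈ shifts d L ×ˢ Finset.Icc 1 L,
        (Function.update p.1 j p.2, p.1 j) ∈ shifts d L ×ˢ Finset.Icc 1 L := by
      intro p hp
      rw [Finset.mem_product, shifts, Fintype.mem_piFinset] at hp ⊢
      refine ⟨fun k => ?_, hp.1 j⟩
      by_cases hk : k = j
      · subst hk; simpa using hp.2
      · simpa [Function.update_of_ne hk] using hp.1 k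
    refine Finset.sum_nbij' (fun p => (Function.update p.1 j p.2, p.1 j))
      (fun p => (Function.update p.1 j p.2, p.1 j)) hmem hmem ?_ ?_ ?_
    · intro p _; simp
    · intro p _; simp
    · intro p _; rfl
  have h2 : (L : ℝ) * ∑ a ∈ shifts d L, G a ≤ L * ((shifts d L).card * B) := by
    rw [← key]
    refine (Finset.sum_le_sum fun a _ => h a).trans (le_of_eq ?_)
    rw [Finset.sum_const, nsmul_eq_mul]
    ring
  exact le_of_mul_le_mul_left h2 (by exact_mod_cast hL)

section

variable {d : ℕ}

/-- The expected cost of one crossing point: its threshold is independent of the `j`-th coordinate of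
the shift, which alone determines the size of the face. -/
lemma sum_shifts_moveCost_le (ρ N : ℕ) (j : Fin d) (X : Finset (Pt d)) (x : Pt d) :
    ∑ a ∈ shifts d (2 ^ N), moveCost ρ (lev N ⌊sh a x j⌋) (threshold N a j X x) ≤
      (shifts d (2 ^ N)).card * (80 / 2 ^ ρ) := by
  apply sum_shifts_le (by positivity) j
  intro a
  have h1 : ∀ t : ℕ, ⌊sh (Function.update a j t) x j⌋ = ⌊x j - 1 / 2⌋ + t := by
    intro t
    rw [sh, Function.update_self, show x j + t - 1 / 2 = x j - 1 / 2 + t by ring,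
      Int.floor_add_natCast]
  simp only [h1, threshold_update]
  refine (sum_moveCost_lev_le ρ N _ _).trans (le_of_eq ?_)
  push_cast
  rfl

/-! ### Paths of length zero -/

lemma ClosedPath.not_isCrossing_of_wt_eq_zero {γ : ClosedPath d} (h : γ.wt = 0) (j : Fin d) (c : ℝ)
    (s t : ℝ) : ¬ γ.IsCrossing j c s t := by
  have hstep : ∀ k : ℤ, γ.vertex k = γ.vertex (k + 1) := by
    intro k
    have hn : (0 : ℤ) < γ.n := by exact_mod_cast γ.n_pos
    have h0 := Int.emod_nonneg k hn.ne'
    have h1 := Int.emod_lt_of_pos k hn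
    obtain ⟨m, hm⟩ := Int.eq_ofNat_of_zero_le h0
    have h2 := (Finset.sum_eq_zero_iff_of_nonneg fun _ _ => dist_nonneg).1 h m
      (Finset.mem_range.2 (by omega))
    rw [dist_eq_zero, ← hm, ← γ.vertex_add_mul _ (k / γ.n),
      ← γ.vertex_add_mul (k % γ.n + 1) (k / γ.n)] at h2
    rwa [show k % γ.n + 1 + k / γ.n * γ.n = k % γ.n + k / γ.n * γ.n + 1 by ring,
      Int.emod_add_ediv_mul] at h2
  have hconst : ∀ k : ℤ, γ.vertex k = γ.vertex 0 := by
    intro k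
    induction k using Int.induction_on with
    | zero => rfl
    | succ k ih => rw [← hstep, ih]
    | pred k ih => rw [hstep, sub_add_cancel, ih]
  have hpos : ∀ t, γ.pos t = γ.vertex 0 := by
    intro t
    rw [ClosedPath.pos, hconst ⌊t⌋, hconst (⌊t⌋ + 1), AffineMap.lineMap_same_apply]
  rintro ⟨-, -, hst, hc, h | h⟩
  all_goals
    obtain ⟨u, hu⟩ := h.1.exists
    have := hc s ⟨le_rfl, hst⟩
    rw [hpos] at this hu
    rw [this] at hu
    exact lt_irrefl _ hu

lemma ClosedPath.isSimple_of_wt_eq_zero {γ : ClosedPath d} (h : γ.wt = 0) (L : ℕ) (a : Fin d → ℕ)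
    (r : ℕ) : γ.IsSimple L a r := by
  intro F _
  refine ⟨Or.inl ?_, fun p _ => ?_⟩
  · rintro x ⟨-, s, t, hst, -⟩
    exact absurd hst (ClosedPath.not_isCrossing_of_wt_eq_zero h _ _ _ _)
  · have : γ.crossingsVia F p = ∅ := by
      rw [Set.eq_empty_iff_forall_notMem]
      rintro I ⟨hI, -⟩
      exact ClosedPath.not_isCrossing_of_wt_eq_zero h _ _ _ _ hI
    rw [this, Set.encard_empty]
    exact zero_le

lemma expect_le {L : ℕ} (hL : 0 < L) {f : (Fin d → ℕ) → ℝ} {B : ℝ}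
    (h : ∑ a ∈ shifts d L, f a ≤ (shifts d L).card * B) : expect d L f ≤ B := by
  have hne : (shifts d L).Nonempty :=
    ⟨fun _ => 1, Fintype.mem_piFinset.2 fun _ => Finset.mem_Icc.2 ⟨le_rfl, hL⟩⟩
  have hc : (0 : ℝ) < (shifts d L).card := by exact_mod_cast Finset.card_pos.2 hne
  rw [expect, div_le_iff₀ hc, mul_comm]
  exact h

/-- The constant `320` is `2 * 2 * 80`: the path has at most `2 * d * γ.wt` crossings, and
`1 / 2 ^ Nat.log 2 r < 2 / r`. -/
lemma sum_shifts_cost_le {γ : ClosedPath d} {P : Finset (Pt d)} (D : Discretization γ P)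
    (hd : 0 < d) {r : ℕ} (hr : 0 < r) (N : ℕ) :
    ∑ a ∈ shifts d (2 ^ N), √d * (∑ j, ∑ x ∈ D.crossX j,
        moveCost (Nat.log 2 r) (lev N ⌊sh a x j⌋) (threshold N a j (D.crossX j) x)) ≤
      (shifts d (2 ^ N)).card * (320 * ((d : ℝ) ^ 2 * γ.wt / r)) := by
  have hwt : 0 ≤ γ.wt := Finset.sum_nonneg fun _ _ => dist_nonneg
  have hr' : (0 : ℝ) < r := by exact_mod_cast hr
  have hd' : (1 : ℝ) ≤ d := by exact_mod_cast hd
  have e1 : √(d : ℝ) ≤ d := by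
    rw [Real.sqrt_le_left (by positivity)]
    nlinarith
  have e2 : (80 : ℝ) / 2 ^ Nat.log 2 r ≤ 160 / r := by
    have : r < 2 ^ (Nat.log 2 r + 1) := Nat.lt_pow_succ_log_self one_lt_two r
    have : (r : ℝ) < 2 ^ Nat.log 2 r * 2 := by rw [← pow_succ]; exact_mod_cast this
    rw [div_le_div_iff₀ (by positivity) hr']
    linarith
  have e3 := D.sum_card_crossX_le
  have e4 : ∑ j, ∑ x ∈ D.crossX j, ∑ a ∈ shifts d (2 ^ N),
      moveCost (Nat.log 2 r) (lev N ⌊sh a x j⌋) (threshold N a j (D.crossX j) x) ≤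
      ∑ j, ∑ _x ∈ D.crossX j, (shifts d (2 ^ N)).card * (80 / 2 ^ Nat.log 2 r : ℝ) :=
    Finset.sum_le_sum fun j _ => Finset.sum_le_sum fun x _ => sum_shifts_moveCost_le _ N j _ x
  have e5 : ∑ a ∈ shifts d (2 ^ N), √d * (∑ j, ∑ x ∈ D.crossX j,
        moveCost (Nat.log 2 r) (lev N ⌊sh a x j⌋) (threshold N a j (D.crossX j) x)) =
      √d * ∑ j, ∑ x ∈ D.crossX j, ∑ a ∈ shifts d (2 ^ N),
        moveCost (Nat.log 2 r) (lev N ⌊sh a x j⌋) (threshold N a j (D.crossX j) x) := by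
    rw [← Finset.mul_sum, Finset.sum_comm]
    exact congrArg _ (Finset.sum_congr rfl fun j _ => Finset.sum_comm)
  simp only [Finset.sum_const, nsmul_eq_mul, ← Finset.sum_mul] at e4
  rw [e5]
  have hc : (0 : ℝ) ≤ (shifts d (2 ^ N)).card := Nat.cast_nonneg _
  generalize ((shifts d (2 ^ N)).card : ℝ) = c at e4 hc ⊢
  have h1 : c * (80 / 2 ^ Nat.log 2 r) ≤ c * (160 / r) := mul_le_mul_of_nonneg_left e2 hc
  have h2 : 0 ≤ c * (80 / 2 ^ Nat.log 2 r) := mul_nonneg hc (by positivity)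
  have h3 : 0 ≤ 2 * d * γ.wt := by positivity
  have h4 : 0 ≤ c * (160 / r) := mul_nonneg hc (by positivity)
  calc _ ≤ √d * ((∑ j, ((D.crossX j).card : ℝ)) * (c * (80 / 2 ^ Nat.log 2 r))) :=
        mul_le_mul_of_nonneg_left e4 (Real.sqrt_nonneg _)
    _ ≤ d * ((2 * d * γ.wt) * (c * (160 / r))) :=
        mul_le_mul e1 (mul_le_mul e3 h1 h2 h3)
          (mul_nonneg (Finset.sum_nonneg fun _ _ => Nat.cast_nonneg _) h2) (Nat.cast_nonneg _)
    _ = _ := by ring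

/-- The slack left for spikes and interior points is charged to the bound, which is positive unless
the given path has length zero; in that case the path has no crossings at all. -/
theorem exists_simple_paths {γ : ClosedPath d} {P : Finset (Pt d)} (hV : γ.Visits P)
    (hE : γ.EdgesAtLeastOne) (hd : 2 ≤ d) {r : ℕ} (hr : 0 < r) (N : ℕ) :
    ∃ γ' : (Fin d → ℕ) → ClosedPath d,
      (∀ a, (γ' a).Visits P ∧ (γ' a).IsSimple (2 ^ N) a r ∧
        ∀ F, IsMaximalFacet (2 ^ N) a F → ∀ x, γ.crossingPoints F = {x} →
          (γ' a).crossingPoints F = {x}) ∧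
      expect d (2 ^ N) (fun a => (γ' a).wt - γ.wt) ≤ 321 * ((d : ℝ) ^ 2 * γ.wt / r) := by
  have hwt : 0 ≤ γ.wt := Finset.sum_nonneg fun _ _ => dist_nonneg
  rcases hwt.eq_or_lt with h0 | h0
  · refine ⟨fun _ => γ, fun a => ⟨hV, ClosedPath.isSimple_of_wt_eq_zero h0.symm _ _ _,
      fun _ _ _ h => h⟩, ?_⟩
    simp [expect, ← h0]
  obtain ⟨D⟩ := nonempty_discretization γ P hV hE
  have hη0 : 0 < (d : ℝ) ^ 2 * γ.wt / r := by positivity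
  choose γ' h1 h2 h3 h4 using fun a =>
    exists_simple_path D hd (Nat.pow_log_le_self 2 hr.ne') N a hη0
  refine ⟨γ', fun a => ⟨h1 a, h2 a, h3 a⟩, expect_le (by positivity) ?_⟩
  refine (Finset.sum_le_sum fun a _ =>
    sub_left_le_of_le_add ((h4 a).trans_eq (add_assoc _ _ _))).trans ?_
  rw [Finset.sum_add_distrib, Finset.sum_const, nsmul_eq_mul]
  refine (add_le_add_left (sum_shifts_cost_le D (by omega) hr N) _).trans (le_of_eq ?_)
  ring

end

end StructThm

theorem mainTheorem3 :
    ∃ (C : ℝ) (r₀ : ℕ), 0 < C ∧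
      ∀ (d : ℕ), 2 ≤ d →
      ∀ (L : ℕ), (∃ N : ℕ, L = 2 ^ N) →
      ∀ (P : Finset (StructThm.Pt d)),
        (∀ p ∈ P, ∀ i : Fin d, ∃ k : ℕ, k ≤ L ∧ p i = (k : ℝ)) →
      ∀ (γ : StructThm.ClosedPath d), γ.Visits P → γ.EdgesAtLeastOne →
      ∀ (r : ℕ), r₀ ≤ r →
      ∃ γ' : (Fin d → ℕ) → StructThm.ClosedPath d,
        (∀ a ∈ StructThm.shifts d L,
          (γ' a).Visits P ∧ (γ' a).IsSimple L a r ∧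
          ∀ F : StructThm.Facet d, StructThm.IsMaximalFacet L a F →
            ∀ x : StructThm.Pt d, γ.crossingPoints F = {x} → (γ' a).crossingPoints F = {x}) ∧
        StructThm.expect d L (fun a => (γ' a).wt - γ.wt) ≤ C * ((d : ℝ) ^ 2 * γ.wt / r) := by
  refine ⟨321, 1, by norm_num, ?_⟩
  rintro d hd L ⟨N, rfl⟩ P - γ hV hE r hr
  obtain ⟨γ', h1, h2⟩ := StructThm.exists_simple_paths hV hE hd hr N
  exact ⟨γ', fun a _ => h1 a, h2⟩
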